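/- Let $A$ be a finite alphabet and let $X\subseteq A^{\mathbb Z}$ be a subshift, i.e. a closed set with $\sigma(X)=X$, where $\sigma(x)[i]=x[i+1]$. Let $L(X)$ be the set of all finite words occurring in points of $X$. Call $X$ transitive if for all $u,v\in L(X)$ there is $w\in L(X)$ with $uwv\in L(X)$, and sofic if $L(X)$ is a regular language. Let $\mathrm{Aut}(X)$ be the group (under composition) of all bijections $F:X\to X$ that are given by a local rule, i.e. for which there are integers $m\le a$ and a map $f:A^{a-m+1}\to A$ with $F(x)[i]=f(x[i+m],\dots,x[i+a])$ for all $x\in X$, $i\in\mathbb Z$. For $S\subseteq \mathrm{Aut}(X)$ let $C(S)$ be the centralizer of $S$ in $\mathrm{Aut}(X)$, and let $k(X)\in\mathbb N\cup\{\infty,\bot\}$ be the minimal cardinality of a set $S\subseteq\mathrm{Aut}(X)$ with $C(S)=\langle\sigma\rangle$, with $k(X)=\bot$ if no such set exists. Theorem (Finitary Ryan's theorem). $k(X)=2$ for every infinite transitive sofic shift $X$. That is, there are two distinct automorphisms of $X$ whose centralizer in $\mathrm{Aut}(X)$ is exactly the group generated by the shift, and no set of fewer than two automorphisms has this property. -/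

import Mathlib

namespace OneDimShift

open SymbolicDynamics.FullShift

section Language

variable {A : Type*} [TopologicalSpace A]

/-- The word `x[i] x[i+1] ⋯ x[i+n-1]`. -/
def subword (x : ℤ → A) (i : ℤ) (n : ℕ) : List A :=
  List.ofFn fun k : Fin n => x (i + (k : ℕ))

/-- The language `L(X)`: all finite words (the empty one included) that are
subwords of points of `X`. -/
def language (X : Subshift A ℤ) : Language A :=
  {w | ∃ x ∈ X.carrier, ∃ (i : ℤ) (n : ℕ), w = subword x i n}

/-- Transitivity: for all `u, v ∈ L(X)` there is `w ∈ L(X)` with `uwv ∈ L(X)`. -/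
def IsTransitive (X : Subshift A ℤ) : Prop :=
  ∀ u ∈ language X, ∀ v ∈ language X, ∃ w ∈ language X, u ++ w ++ v ∈ language X

/-- A subshift is sofic if its language is regular. -/
def IsSofic (X : Subshift A ℤ) : Prop :=
  (language X).IsRegular

end Language

section Automorphisms

variable {A : Type*} [TopologicalSpace A]

/-- `F : X → X` is a cellular automaton: there are a memory `m`, an anticipation `a ≥ m` and a
local rule `f : A^{a-m+1} → A` with `F(x)[i] = f(x[i+m], …, x[i+a])`. -/
def IsCellularAutomaton (X : Subshift A ℤ) (F : X.carrier → X.carrier) : Prop :=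
  ∃ m a : ℤ, m ≤ a ∧ ∃ f : (Set.Icc m a → A) → A,
    ∀ (x : X.carrier) (i : ℤ), (F x).1 i = f fun k => x.1 (i + k)

/-- The translation `σ^g : X → X`. -/
def translate (X : Subshift A ℤ) (g : ℤ) (x : X.carrier) : X.carrier :=
  ⟨shift g x.1, X.mapsTo g x.2⟩

@[simp] theorem translate_apply (X : Subshift A ℤ) (g : ℤ) (x : X.carrier) (i : ℤ) :
    (translate X g x).1 i = x.1 (g + i) := rfl

theorem IsCellularAutomaton.translate_comm {X : Subshift A ℤ} {F : X.carrier → X.carrier}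
    (hF : IsCellularAutomaton X F) (g : ℤ) (x : X.carrier) :
    F (translate X g x) = translate X g (F x) := by
  obtain ⟨m, a, -, f, hf⟩ := hF
  apply Subtype.ext
  funext i
  rw [translate_apply, hf, hf]
  simp only [translate_apply, add_assoc]

theorem isCellularAutomaton_translate (X : Subshift A ℤ) (g : ℤ) :
    IsCellularAutomaton X (translate X g) :=
  ⟨g, g, le_rfl, fun w => w ⟨g, by simp⟩, fun x i => by simp [add_comm]⟩

theorem IsCellularAutomaton.continuous [DiscreteTopology A] {X : Subshift A ℤ}
    {F : X.carrier → X.carrier} (hF : IsCellularAutomaton X F) : Continuous F := by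
  obtain ⟨m, a, -, f, hf⟩ := hF
  refine Continuous.subtype_mk (f := fun x => (F x).1) (continuous_pi fun i => ?_) _
  simp only [hf]
  have : Continuous f := continuous_of_discreteTopology
  exact this.comp (continuous_pi fun k => (continuous_apply _).comp continuous_subtype_val)

/-- Every continuous map from `X` to `A` depends on finitely many coordinates only. -/
theorem exists_window [Finite A] [DiscreteTopology A] (X : Subshift A ℤ) (g : X.carrier → A)
    (hg : Continuous g) :
    ∃ n : ℕ, ∀ x y : X.carrier, (∀ k ∈ Finset.Icc (-(n : ℤ)) n, x.1 k = y.1 k) → g x = g y := by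
  have : CompactSpace X.carrier := isCompact_iff_compactSpace.mp X.isClosed.isCompact
  let V : ℕ → Set X.carrier := fun n =>
    {x | ∀ y : X.carrier, (∀ k ∈ Finset.Icc (-(n : ℤ)) n, x.1 k = y.1 k) → g x = g y}
  have hVmono : Monotone V := by
    intro n p hnp x hx y hy
    refine hx y fun k hk => hy k ?_
    rw [Finset.mem_Icc] at hk ⊢
    omega
  have hVopen : ∀ n, IsOpen (V n) := by
    intro n
    rw [isOpen_iff_forall_mem_open]
    intro x hx
    refine ⟨Subtype.val ⁻¹' cylinder (Finset.Icc (-(n : ℤ)) n) x.1, ?_,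
      (isOpen_cylinder _ _).preimage continuous_subtype_val, fun k _ => rfl⟩
    intro z hz y hy
    rw [← hx z fun k hk => (hz k hk).symm]
    exact hx y fun k hk => ((hz k hk).symm).trans (hy k hk)
  have hVcover : (Set.univ : Set X.carrier) ⊆ ⋃ n, V n := by
    intro x _
    have hopen : IsOpen (g ⁻¹' {g x}) := (isOpen_discrete _).preimage hg
    obtain ⟨O, hO, hOg⟩ := isOpen_induced_iff.mp hopen
    have hxO : x.1 ∈ O := by
      have : x ∈ Subtype.val ⁻¹' O := by rw [hOg]; rfl
      exact this
    obtain ⟨I, u, hu, huO⟩ := isOpen_pi_iff.mp hO x.1 hxO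
    obtain ⟨n, hn⟩ : ∃ n : ℕ, ∀ k ∈ I, k.natAbs ≤ n := ⟨I.sup Int.natAbs, fun k hk =>
      Finset.le_sup (f := Int.natAbs) hk⟩
    refine Set.mem_iUnion.mpr ⟨n, fun y hy => ?_⟩
    have hyO : y.1 ∈ O := by
      apply huO
      intro k hk
      have h1 := hn k hk
      rw [← hy k (by rw [Finset.mem_Icc]; omega)]
      exact (hu k hk).2
    have : y ∈ g ⁻¹' {g x} := by rw [← hOg]; exact hyO
    exact (Set.mem_singleton_iff.mp this).symm
  obtain ⟨n, hn⟩ := isCompact_univ.elim_directed_cover V hVopen hVcover hVmono.directed_le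
  exact ⟨n, fun x y h => hn (Set.mem_univ x) y h⟩

/-- The Curtis–Hedlund–Lyndon theorem. -/
theorem isCellularAutomaton_of_continuous [Finite A] [DiscreteTopology A] {X : Subshift A ℤ}
    {F : X.carrier → X.carrier} (hc : Continuous F)
    (hF : ∀ g x, F (translate X g x) = translate X g (F x)) : IsCellularAutomaton X F := by
  classical
  obtain ⟨n, hn⟩ := exists_window X (fun x => (F x).1 0)
    ((continuous_apply 0).comp (continuous_subtype_val.comp hc))
  let P : (Set.Icc (-(n : ℤ)) n → A) → X.carrier → Prop := fun w x => ∀ k, x.1 k.1 = w k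
  refine ⟨-(n : ℤ), n, by omega, fun w =>
    if h : ∃ x : X.carrier, P w x then (F h.choose).1 0 else w ⟨0, by simp⟩, fun x i => ?_⟩
  have hx : P (fun k => x.1 (i + k)) (translate X i x) := fun k => rfl
  have hex : ∃ z : X.carrier, P (fun k => x.1 (i + k)) z := ⟨_, hx⟩
  change (F x).1 i = if h : ∃ z : X.carrier, P (fun k => x.1 (i + k)) z then
    (F h.choose).1 0 else _
  rw [dif_pos hex]
  have h1 : (F x).1 i = (F (translate X i x)).1 0 := by rw [hF]; simp
  rw [h1]
  refine hn _ _ fun k hk => ?_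
  have hk' : k ∈ Set.Icc (-(n : ℤ)) n := by simpa using hk
  exact (hx ⟨k, hk'⟩).trans (hex.choose_spec ⟨k, hk'⟩).symm

variable [Finite A] [DiscreteTopology A]

/-- The group `Aut(X)` of automorphisms of `X`, i.e. of the bijective cellular automata on `X`,
under composition. -/
def Aut (X : Subshift A ℤ) : Subgroup (Equiv.Perm X.carrier) where
  carrier := {F | IsCellularAutomaton X F}
  one_mem' := isCellularAutomaton_of_continuous continuous_id fun _ _ => rfl
  mul_mem' := by
    intro F G hF hG
    refine isCellularAutomaton_of_continuous (hF.continuous.comp hG.continuous) fun g x => ?_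
    rw [Equiv.Perm.mul_apply, Equiv.Perm.mul_apply, hG.translate_comm, hF.translate_comm]
  inv_mem' := by
    intro F hF
    have : CompactSpace X.carrier := isCompact_iff_compactSpace.mp X.isClosed.isCompact
    refine isCellularAutomaton_of_continuous
      (hF.continuous.homeoOfEquivCompactToT2 (f := F)).symm.continuous fun g x => ?_
    apply F.injective
    have h : ∀ y, F (F⁻¹ y) = y := F.apply_symm_apply
    rw [hF.translate_comm, h]
    exact congrArg (translate X g) (h x).symm

/-- The shift map `σ(x)[i] = x[i+1]`, as an element of `Aut(X)`. -/
def shiftAut (X : Subshift A ℤ) : Aut X :=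
  ⟨{ toFun := translate X 1
     invFun := translate X (-1)
     left_inv := fun x => Subtype.ext (funext fun i => by simp)
     right_inv := fun x => Subtype.ext (funext fun i => by simp) },
    isCellularAutomaton_translate X 1⟩

/-- `C(S) = ⟨σ⟩`: the centralizer of `S` in `Aut(X)` consists exactly of the powers of `σ`. -/
def CentralizerIsShift (X : Subshift A ℤ) (S : Set (Aut X)) : Prop :=
  Subgroup.centralizer S = Subgroup.zpowers (shiftAut X)

open Classical in
/-- `k(X) ∈ ℕ ∪ {∞, ⊥}`: the minimal cardinality of a set `S ⊆ Aut(X)` with `C(S) = ⟨σ⟩`, and `⊥`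
if there is no such set. -/
noncomputable def kInvariant (X : Subshift A ℤ) : WithBot ℕ∞ :=
  if ∃ S : Set (Aut X), CentralizerIsShift X S then
    ((⨅ S : {S : Set (Aut X) // CentralizerIsShift X S}, S.1.encard : ℕ∞) : WithBot ℕ∞)
  else ⊥

end Automorphisms

end OneDimShift

/-! The upper bound is the real content: a belt map and a swap map are built so that whatever
commutes with both is a power of the shift.

Cells. Regularity of the language gives a synchronizing word; as `X` is infinite and transitive, it
has two distinct first return words. Products of these yield a marker `p` and five words `V o` of
equal length `ℓ` that can be concatenated freely and exchanged in every context, and whose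
occurrences followed by `p` never overlap (`exists_cellSystem`). Four of them are cells carrying two
bits `yz`; `V none` is a filler. The belt map moves the bits `y` to the right and the bits `z` to
the left through every maximal run of cells, turning `z` into `y` at a left end and `y` into `¬y` on
the other track at a right end. The swap map is an involution. It adds `y` to `z` in all cells
outside certain zones. At special places it exchanges a stretch of cells `01` followed by a word `m`
that does not begin with a cell for a longer stretch of cells that spells a code of `m`, followed by
a shorter word with the followers of `m` (`Gadget`). So it can lengthen a run of cells at the cost
of what lies to its right.

Rigidity on cells. Let `h` commute with both maps. The image of the point of empty cells is, up to a
shift, that point again (`exists_const`, `const_eq`). On points made of cells with finitely many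
bits set, the belt separates the tracks and the swap ties them together, so `h` applies one map `α`
of finite sets to both tracks (`exists_action`). The swap then forces `max` and `min` of `α S` to be
those of `S` plus constants, and invertibility makes the constants equal; after a further shift `h`
fixes all these points (`exists_fix`).

Spreading out. If `h` fixes the image of `x` under a belt power followed by the swap, it fixes `x`.
A framed point has a run of cells from the left up to some `e`, then arbitrary symbols, then
fillers, then empty cells. Iterating the belt fills the end of the run with `01`, an exchange
becomes possible and the run grows; by induction everything is reduced to points of cells
(`fix_of_short`, `fix_of_framed`). Every word of the language occurs in a framed point, so `h` is a
shift power on all of `X` (`eq_self`).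

Lower bound. If `S` has at most one element, that element centralizes `S`. If moreover the
centralizer is generated by the shift, the element is a shift power and is therefore central, so
everything centralizes `S`; but the swap map is not a shift power. -/

namespace OneDimShift

open SymbolicDynamics.FullShift

/-! ### Occurrences of words and simultaneous overwriting -/

section Reads

variable {A : Type*}

/-- The word `w` occurs in `x` at position `i`. -/
def Reads (x : ℤ → A) (i : ℤ) (w : List A) : Prop :=
  ∀ (k : ℕ) (h : k < w.length), x (i + k) = w[k]

theorem reads_subword [TopologicalSpace A] (x : ℤ → A) (i : ℤ) (n : ℕ) :
    Reads x i (subword x i n) := by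
  intro k h
  simp [subword]

theorem length_subword [TopologicalSpace A] (x : ℤ → A) (i : ℤ) (n : ℕ) :
    (subword x i n).length = n := by
  simp [subword]

theorem Reads.eq_subword [TopologicalSpace A] {x : ℤ → A} {i : ℤ} {w : List A}
    (h : Reads x i w) : w = subword x i w.length := by
  apply List.ext_getElem
  · simp [subword]
  · intro k h1 h2
    rw [← h k h1, reads_subword x i w.length k h2]

theorem reads_nil (x : ℤ → A) (i : ℤ) : Reads x i [] := fun k h => by simp at h

theorem reads_append {x : ℤ → A} {i : ℤ} {a b : List A} :
    Reads x i (a ++ b) ↔ Reads x i a ∧ Reads x (i + a.length) b := by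
  constructor
  · intro h
    refine ⟨fun k hk => ?_, fun k hk => ?_⟩
    · rw [h k (by simp; omega), List.getElem_append_left hk]
    · have := h (a.length + k) (by simp; omega)
      rw [List.getElem_append_right (by omega)] at this
      simp only [Nat.add_sub_cancel_left] at this
      rw [← this]; congr 1; push_cast; ring
  · rintro ⟨h1, h2⟩ k hk
    by_cases hka : k < a.length
    · rw [List.getElem_append_left hka, h1 k hka]
    · rw [List.getElem_append_right (by omega), ← h2 (k - a.length) (by simp at hk; omega)]
      congr 1
      push_cast [Nat.cast_sub (Nat.le_of_not_lt hka)]; ring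

theorem Reads.left {x : ℤ → A} {i : ℤ} {a b : List A} (h : Reads x i (a ++ b)) : Reads x i a :=
  (reads_append.1 h).1

theorem Reads.right {x : ℤ → A} {i : ℤ} {a b : List A} (h : Reads x i (a ++ b)) :
    Reads x (i + a.length) b :=
  (reads_append.1 h).2

theorem Reads.of_prefix {x : ℤ → A} {i : ℤ} {a b : List A} (h : Reads x i b) (hab : a <+: b) :
    Reads x i a := by
  obtain ⟨c, rfl⟩ := hab
  exact h.left

theorem Reads.unique {x : ℤ → A} {i : ℤ} {a b : List A} (ha : Reads x i a) (hb : Reads x i b)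
    (h : a.length = b.length) : a = b := by
  apply List.ext_getElem h
  intro k h1 h2
  rw [← ha k h1, hb k h2]

theorem Reads.prefix_of_le {x : ℤ → A} {i : ℤ} {a b : List A} (ha : Reads x i a)
    (hb : Reads x i b) (h : a.length ≤ b.length) : a <+: b := by
  rw [List.prefix_iff_eq_take]
  refine ha.unique (hb.of_prefix (List.take_prefix _ _)) (by simp [h])

/-- `x` near `i` looks like `y` near `j`, within radius `R`. -/
def Agree (x y : ℤ → A) (i j : ℤ) (R : ℕ) : Prop :=
  ∀ k : ℤ, -R ≤ k → k ≤ R → x (i + k) = y (j + k)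

theorem Agree.symm {x y : ℤ → A} {i j : ℤ} {R : ℕ} (h : Agree x y i j R) : Agree y x j i R :=
  fun k h1 h2 => (h k h1 h2).symm

theorem Agree.mono {x y : ℤ → A} {i j : ℤ} {R R' : ℕ} (h : Agree x y i j R) (hR : R' ≤ R) :
    Agree x y i j R' :=
  fun k h1 h2 => h k (by omega) (by omega)

theorem Agree.shift {x y : ℤ → A} {i j : ℤ} {R R' : ℕ} (h : Agree x y i j R) (t : ℤ)
    (ht : -((R : ℤ) - R') ≤ t) (ht' : t ≤ (R : ℤ) - R') : Agree x y (i + t) (j + t) R' := by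
  intro k h1 h2
  have := h (t + k) (by omega) (by omega)
  simpa [add_assoc] using this

theorem Agree.reads {x y : ℤ → A} {i j : ℤ} {R : ℕ} (h : Agree x y i j R) {w : List A}
    (hw : w.length ≤ R + 1) (hr : Reads x i w) : Reads y j w := by
  intro k hk
  rw [← hr k hk]
  exact (h k (by omega) (by omega)).symm

theorem Reads.congr {x y : ℤ → A} {i : ℤ} {w : List A} (h : Reads x i w)
    (hxy : ∀ k : ℤ, i ≤ k → k < i + w.length → x k = y k) : Reads y i w := by
  intro k hk
  rw [← h k hk]
  exact (hxy _ (by omega) (by omega)).symm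

theorem Reads.apply {x : ℤ → A} {i : ℤ} {w : List A} (h : Reads x i w) {k : ℤ} (h1 : i ≤ k)
    (h2 : k < i + w.length) : x k = w[(k - i).toNat]'(by omega) := by
  rw [← h (k - i).toNat (by omega)]
  congr 1; omega

theorem Reads.eq_of {x y : ℤ → A} {i : ℤ} {w : List A} (h : Reads x i w) (h' : Reads y i w)
    {k : ℤ} (h1 : i ≤ k) (h2 : k < i + w.length) : x k = y k := by
  rw [h.apply h1 h2, h'.apply h1 h2]

/-- Two writings of words that never cover the same position. -/
def Compatible (P : ℤ → List A → Prop) : Prop :=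
  ∀ i w i' w' (k : ℤ), P i w → P i' w' → i ≤ k → k < i + w.length → i' ≤ k →
    k < i' + w'.length → i = i' ∧ w = w'

open Classical in
/-- Overwrite `x` with the word `w` at position `i`, for all `i, w` with `P i w`. -/
noncomputable def patch (x : ℤ → A) (P : ℤ → List A → Prop) : ℤ → A := fun k =>
  if h : ∃ c : ℤ × List A, P c.1 c.2 ∧ c.1 ≤ k ∧ k < c.1 + c.2.length then
    h.choose.2[(k - h.choose.1).toNat]'(by have := h.choose_spec; omega)
  else x k

theorem patch_of_not {x : ℤ → A} {P : ℤ → List A → Prop} {k : ℤ}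
    (h : ∀ i w, P i w → i ≤ k → ¬ k < i + w.length) : patch x P k = x k := by
  rw [patch, dif_neg]
  rintro ⟨c, h1, h2, h3⟩
  exact h _ _ h1 h2 h3

theorem reads_patch {x : ℤ → A} {P : ℤ → List A → Prop} (hP : Compatible P) {i : ℤ} {w : List A}
    (h : P i w) : Reads (patch x P) i w := by
  intro k hk
  have hex : ∃ c : ℤ × List A, P c.1 c.2 ∧ c.1 ≤ i + k ∧ i + k < c.1 + c.2.length :=
    ⟨(i, w), h, by simp, by simpa using hk⟩
  have hs := hex.choose_spec
  obtain ⟨h1, h2⟩ := hP _ _ _ _ (i + k) h hs.1 (by omega) (by omega) hs.2.1 hs.2.2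
  rw [patch, dif_pos hex]
  have h3 : (i + (k : ℤ) - hex.choose.1).toNat = k := by omega
  simp only [h3]
  simp only [← h2]

/-- Overwriting is a local operation: the letter at `i` is decided by a word covering `i`, and such
a word starts within distance `B`. -/
theorem agree_patch {x y : ℤ → A} {P Q : ℤ → List A → Prop} (hP : Compatible P)
    (hQ : Compatible Q) {R B : ℕ} {i j : ℤ} (hlen : ∀ i w, P i w → w.length ≤ B)
    (hlen' : ∀ i w, Q i w → w.length ≤ B)
    (hloc : ∀ (t : ℤ) w, -B ≤ t → t ≤ B → (P (i + t) w ↔ Q (j + t) w))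
    (h : Agree x y i j R) : patch x P i = patch y Q j := by
  by_cases hc : ∃ c : ℤ × List A, P c.1 c.2 ∧ c.1 ≤ i ∧ i < c.1 + c.2.length
  · obtain ⟨⟨a, w⟩, h1, h2, h3⟩ := hc
    simp only at h1 h2 h3
    have hB := hlen _ _ h1
    have h4 : Q (j + (a - i)) w := by
      rw [← hloc (a - i) w (by omega) (by omega)]
      simpa using h1
    rw [(reads_patch (x := x) hP h1).apply h2 h3,
      (reads_patch (x := y) hQ h4).apply (k := j) (by omega) (by omega)]
    congr 1; omega
  · push Not at hc
    rw [patch_of_not, patch_of_not]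
    · simpa using h 0 (by omega) (by omega)
    · intro a w h1 h2 h3
      have hB := hlen' _ _ h1
      have h4 : P (i + (a - j)) w := by
        rw [hloc (a - j) w (by omega) (by omega)]
        simpa using h1
      have := hc (_, w) h4 (by simp; omega)
      simp at this
      omega
    · intro a w h1 h2 h3
      have := hc (a, w) h1 h2
      simp at this; omega

theorem Compatible.mono {P Q : ℤ → List A → Prop} (h : Compatible Q) (hPQ : ∀ i w, P i w → Q i w) :
    Compatible P :=
  fun i w i' w' k h1 h2 => h i w i' w' k (hPQ _ _ h1) (hPQ _ _ h2)

theorem compatible_single (i : ℤ) (w : List A) : Compatible fun j v => j = i ∧ v = w := by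
  rintro _ _ _ _ k ⟨rfl, rfl⟩ ⟨rfl, rfl⟩ _ _ _ _
  exact ⟨rfl, rfl⟩

/-- Write the word `w` at position `i`. -/
noncomputable def splice (x : ℤ → A) (i : ℤ) (w : List A) : ℤ → A :=
  patch x fun j v => j = i ∧ v = w

theorem reads_splice (x : ℤ → A) (i : ℤ) (w : List A) : Reads (splice x i w) i w :=
  reads_patch (compatible_single i w) ⟨rfl, rfl⟩

theorem splice_of_not {x : ℤ → A} {i k : ℤ} {w : List A} (h : k < i ∨ i + w.length ≤ k) :
    splice x i w k = x k := by
  apply patch_of_not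
  rintro _ _ ⟨rfl, rfl⟩ h1 h2
  omega

end Reads

/-! ### The language and exchangeable words -/

section Lang

variable {A : Type*} [TopologicalSpace A] {X : Subshift A ℤ}

theorem mem_language_iff {w : List A} :
    w ∈ language X ↔ ∃ x ∈ X.carrier, ∃ i, Reads x i w := by
  constructor
  · rintro ⟨x, hx, i, n, rfl⟩
    exact ⟨x, hx, i, reads_subword x i n⟩
  · rintro ⟨x, hx, i, h⟩
    exact ⟨x, hx, i, w.length, h.eq_subword⟩

theorem Reads.mem_language {x : ℤ → A} (hx : x ∈ X.carrier) {i : ℤ} {w : List A}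
    (h : Reads x i w) : w ∈ language X :=
  mem_language_iff.2 ⟨x, hx, i, h⟩

theorem language_left {a b : List A} (h : a ++ b ∈ language X) : a ∈ language X := by
  obtain ⟨x, hx, i, h⟩ := mem_language_iff.1 h
  exact h.left.mem_language hx

theorem language_right {a b : List A} (h : a ++ b ∈ language X) : b ∈ language X := by
  obtain ⟨x, hx, i, h⟩ := mem_language_iff.1 h
  exact h.right.mem_language hx

theorem shift_mem {x : ℤ → A} (hx : x ∈ X.carrier) (g : ℤ) :
    (fun k => x (g + k)) ∈ X.carrier :=
  X.mapsTo g hx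

/-- Every word of the language can be read at the position `0`. -/
theorem exists_reads {w : List A} (h : w ∈ language X) (j : ℤ) :
    ∃ x ∈ X.carrier, Reads x j w := by
  obtain ⟨x, hx, i, h⟩ := mem_language_iff.1 h
  refine ⟨_, shift_mem hx (i - j), fun k hk => ?_⟩
  rw [← h k hk]
  congr 1; ring

theorem exists_extend_right {w : List A} (h : w ∈ language X) (n : ℕ) :
    ∃ b, b.length = n ∧ w ++ b ∈ language X := by
  obtain ⟨x, hx, i, h⟩ := mem_language_iff.1 h
  exact ⟨subword x (i + w.length) n, length_subword _ _ _,
    (reads_append.2 ⟨h, reads_subword _ _ _⟩).mem_language hx⟩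

/-- A configuration all of whose central words lie in the language of `X` is a point of `X`. -/
theorem mem_of_windows {x : ℤ → A}
    (h : ∀ n : ℕ, ∃ y ∈ X.carrier, ∀ k : ℤ, -n ≤ k → k ≤ n → x k = y k) : x ∈ X.carrier := by
  rw [← X.isClosed.closure_eq, mem_closure_iff]
  intro O hO hxO
  obtain ⟨I, u, hu, huO⟩ := isOpen_pi_iff.mp hO x hxO
  obtain ⟨n, hn⟩ : ∃ n : ℕ, ∀ k ∈ I, k.natAbs ≤ n := ⟨I.sup Int.natAbs, fun k hk =>
      Finset.le_sup (f := Int.natAbs) hk⟩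
  obtain ⟨y, hy, hxy⟩ := h n
  refine ⟨y, huO fun k hk => ?_, hy⟩
  have h1 := hn k hk
  rw [← hxy k (by omega) (by omega)]
  exact (hu k hk).2

/-- `a` can be replaced by `b` in every word of the language. -/
def Exch (X : Subshift A ℤ) (a b : List A) : Prop :=
  a.length = b.length ∧ ∀ l r, l ++ a ++ r ∈ language X → l ++ b ++ r ∈ language X

theorem splice_mem {x : ℤ → A} (hx : x ∈ X.carrier) {i : ℤ} {a b : List A} (hr : Reads x i a)
    (h : Exch X a b) : splice x i b ∈ X.carrier := by
  refine mem_of_windows fun n => ?_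
  obtain ⟨m, hm⟩ : ∃ m : ℕ, n ≤ m ∧ -m ≤ i ∧ i + a.length ≤ m := by
    exact ⟨n + i.natAbs + a.length, by omega, by omega, by omega⟩
  obtain ⟨hm0, hm1, hm2⟩ := hm
  have hl := h.1
  have key : subword x (-m) (i + m).toNat ++ a ++
      subword x (i + a.length) (m + 1 - (i + a.length)).toNat ∈ language X := by
    refine Reads.mem_language hx (i := -m) 
      (reads_append.2 ⟨reads_append.2 ⟨reads_subword _ _ _, ?_⟩, ?_⟩)
    · rw [length_subword]; convert hr using 1; omega
    · rw [List.length_append, length_subword]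
      have h1 : -(m : ℤ) + (((i + m).toNat + a.length : ℕ) : ℤ) = i + a.length := by omega
      rw [h1]
      exact reads_subword _ _ _
  obtain ⟨y, hy, hy2⟩ := exists_reads (h.2 _ _ key) (-m)
  refine ⟨y, hy, fun k h1 h2 => ?_⟩
  have e1 : (-(m : ℤ) + ((i + m).toNat : ℕ)) = i := by omega
  rcases lt_or_ge k i with hk | hk
  · rw [splice_of_not (Or.inl hk)]
    exact (reads_subword x (-m) (i + m).toNat).eq_of hy2.left.left (by omega)
      (by rw [length_subword]; omega)
  · rcases lt_or_ge k (i + b.length) with hk' | hk'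
    · have := hy2.left.right
      rw [length_subword, e1] at this
      exact (reads_splice x i b).eq_of this hk hk'
    · rw [splice_of_not (Or.inr hk')]
      have := hy2.right
      rw [List.length_append, length_subword] at this
      push_cast at this
      rw [← add_assoc, e1, ← hl] at this
      exact (reads_subword x (i + a.length) _).eq_of this (by omega)
        (by rw [length_subword]; omega)

/-- The words are written one at a time. Compatibility leaves the old word at `i` untouched until it
is replaced, so each step is a single exchange. -/
theorem patch_mem_of_finite {x : ℤ → A} (hx : x ∈ X.carrier) {P : ℤ → List A → Prop}
    (hP : Compatible P) (hex : ∀ i w, P i w → ∃ a, Reads x i a ∧ Exch X a w)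
    (hpos : ∀ i w, P i w → w ≠ []) (s : Finset ℤ) :
    patch x (fun i w => P i w ∧ i ∈ s) ∈ X.carrier := by
  classical
  induction s using Finset.induction_on with
  | empty =>
    have : patch x (fun i w => P i w ∧ i ∈ (∅ : Finset ℤ)) = x := by
      funext k; apply patch_of_not; simp
    rwa [this]
  | insert i s hi ih =>
    by_cases hw : ∃ w, P i w
    · obtain ⟨w, hw⟩ := hw
      obtain ⟨a, ha, haw⟩ := hex i w hw
      have hl := haw.1
      have h1 : Reads (patch x (fun i w => P i w ∧ i ∈ s)) i a := by
        refine ha.congr fun k h1 h2 => (patch_of_not ?_).symm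
        rintro j v ⟨hv, hj⟩ h3 h4
        obtain ⟨rfl, -⟩ := hP _ _ _ _ k hw hv h1 (by omega) h3 h4
        exact hi hj
      have h2 := splice_mem ih h1 haw
      convert h2 using 1
      have hc : Compatible (fun j v => P j v ∧ j ∈ insert i s) := hP.mono fun _ _ h => h.1
      have hc' : Compatible (fun j v => P j v ∧ j ∈ s) := hP.mono fun _ _ h => h.1
      funext k
      by_cases hk : i ≤ k ∧ k < i + w.length
      · exact (reads_patch (x := x) hc ⟨hw, Finset.mem_insert_self _ _⟩).eq_of
          (reads_splice _ i w) hk.1 hk.2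
      · rw [splice_of_not (by omega)]
        by_cases hk2 : ∃ j v, (P j v ∧ j ∈ s) ∧ j ≤ k ∧ k < j + v.length
        · obtain ⟨j, v, hj, h3, h4⟩ := hk2
          exact (reads_patch (x := x) hc ⟨hj.1, Finset.mem_insert_of_mem hj.2⟩).eq_of
            (reads_patch (x := x) hc' hj) h3 h4
        · push Not at hk2
          rw [patch_of_not, patch_of_not]
          · intro j v hj h3; have := hk2 j v hj h3; omega
          · rintro j v ⟨hj, hj2⟩ h3 h4
            rcases Finset.mem_insert.1 hj2 with rfl | hj2
            · by_cases hvw : v = w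
              · subst hvw; exact hk ⟨h3, h4⟩
              · have hp1 := List.length_pos_of_ne_nil (hpos _ _ hw)
                have hp2 := List.length_pos_of_ne_nil (hpos _ _ hj)
                exact hvw (hP _ _ _ _ j hj hw le_rfl (by omega) le_rfl (by omega)).2
            · have := hk2 j v ⟨hj, hj2⟩ h3; omega
    · convert ih using 2
      funext j v
      simp only [eq_iff_iff]
      constructor
      · rintro ⟨h1, h2⟩
        rcases Finset.mem_insert.1 h2 with rfl | h2
        · exact absurd ⟨v, h1⟩ hw
        · exact ⟨h1, h2⟩
      · rintro ⟨h1, h2⟩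
        exact ⟨h1, Finset.mem_insert_of_mem h2⟩

/-- Simultaneous exchange of words at non-overlapping places stays inside `X`. -/
theorem patch_mem {x : ℤ → A} (hx : x ∈ X.carrier) {P : ℤ → List A → Prop}
    (hP : Compatible P) (hex : ∀ i w, P i w → ∃ a, Reads x i a ∧ Exch X a w)
    (hpos : ∀ i w, P i w → w ≠ []) {B : ℕ} (hB : ∀ i w, P i w → w.length ≤ B) :
    patch x P ∈ X.carrier := by
  -- A word of length at most `B` that meets `[-n, n]` starts in `[-n-B, n]`, so in the window a
  -- finite patch suffices.
  refine mem_of_windows fun n => ⟨_, patch_mem_of_finite hx hP hex hpos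
    (Finset.Icc (-(n : ℤ) - B) n), fun k h1 h2 => ?_⟩
  have hc : Compatible (fun j v => P j v ∧ j ∈ Finset.Icc (-(n : ℤ) - B) n) :=
    hP.mono fun _ _ h => h.1
  by_cases hk2 : ∃ j v, P j v ∧ j ≤ k ∧ k < j + v.length
  · obtain ⟨j, v, hj, h3, h4⟩ := hk2
    have := hB _ _ hj
    exact (reads_patch (x := x) hP hj).eq_of
      (reads_patch (x := x) hc ⟨hj, Finset.mem_Icc.2 ⟨by omega, by omega⟩⟩) h3 h4
  · push Not at hk2
    rw [patch_of_not, patch_of_not]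
    · intro j v hj h3; have := hk2 j v hj.1 h3; omega
    · intro j v hj h3; have := hk2 j v hj h3; omega

end Lang

end OneDimShift

namespace OneDimShift

open SymbolicDynamics.FullShift

/-! ### Synchronizing words and follower sets -/

section Sync

variable {A : Type*} [TopologicalSpace A] {X : Subshift A ℤ}

/-- `u` is a synchronizing word of `X`. -/
def IsSync (X : Subshift A ℤ) (u : List A) : Prop :=
  u ∈ language X ∧ ∀ a b, a ++ u ∈ language X → u ++ b ∈ language X → a ++ u ++ b ∈ language X

/-- The follower set of a word. -/
abbrev foll (X : Subshift A ℤ) (w : List A) : Language A := (language X).leftQuotient w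

theorem mem_foll {a b : List A} : b ∈ foll X a ↔ a ++ b ∈ language X := Iff.rfl

/-- Choose `u` with the fewest follower sets of words `a ++ u`. If `u` failed to synchronize on `a`
and `c`, appending `c` would kill the class of `a ++ u`, and `u ++ c` would have fewer. -/
theorem exists_isSync (hX : ([] : List A) ∈ language X) (hs : IsSofic X) : ∃ u, IsSync X u := by
  have hfin := Language.IsRegular.finite_range_leftQuotient hs
  let S : List A → Set (Language A) := fun u => {q | ∃ a, a ++ u ∈ language X ∧ q = foll X (a ++ u)}
  have hS : ∀ u, (S u).Finite := fun u => hfin.subset (by rintro _ ⟨a, -, rfl⟩; exact ⟨_, rfl⟩)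
  obtain ⟨u, hu, hmin⟩ : ∃ u ∈ language X, ∀ v ∈ language X, (S u).ncard ≤ (S v).ncard := by
    have hex : ∃ n, ∃ u ∈ language X, (S u).ncard = n := ⟨_, [], hX, rfl⟩
    classical
    obtain ⟨u, hu, h⟩ := Nat.find_spec hex
    exact ⟨u, hu, fun v hv => h ▸ Nat.find_min' hex ⟨v, hv, rfl⟩⟩
  refine ⟨u, hu, fun a c ha hc => ?_⟩
  by_contra hac
  have hsub : S (u ++ c) ⊆ (fun q : Language A => q.leftQuotient c) '' (S u \ {foll X (a ++ u)}) := by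
    rintro _ ⟨a', ha', rfl⟩
    rw [← List.append_assoc] at ha' ⊢
    refine ⟨foll X (a' ++ u), ⟨⟨a', language_left ha', rfl⟩, fun h => hac ?_⟩, ?_⟩
    · have h' : foll X (a' ++ u) = foll X (a ++ u) := h
      rw [← mem_foll, ← h']
      exact ha'
    · exact (Language.leftQuotient_append _ _ _).symm
  have h1 := Set.ncard_le_ncard hsub (((hS u).subset Set.sdiff_subset).image _)
  have h2 := Set.ncard_image_le (f := fun q : Language A => q.leftQuotient c)
    ((hS u).subset (Set.sdiff_subset (t := {foll X (a ++ u)})))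
  have h3 := Set.ncard_sdiff_singleton_lt_of_mem (s := S u) (a := foll X (a ++ u)) ⟨a, ha, rfl⟩ (hS u)
  have h4 := hmin _ hc
  omega

theorem IsSync.extend {u : List A} (h : IsSync X u) {c d : List A} (hcd : c ++ u ++ d ∈ language X) :
    IsSync X (c ++ u ++ d) := by
  refine ⟨hcd, fun a b ha hb => ?_⟩
  have h1 := h.2 (a ++ c) (d ++ b) (by
    have : a ++ c ++ u ++ d ∈ language X := by simpa using ha
    exact language_left this) (by
    have : c ++ (u ++ (d ++ b)) ∈ language X := by simpa using hb
    exact language_right this)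
  simpa using h1

theorem IsSync.append_mem {p a b : List A} (h : IsSync X p) (ha : a ++ p ∈ language X)
    (hb : b ∈ language X) (hpb : p <+: b) : a ++ b ∈ language X := by
  obtain ⟨c, rfl⟩ := hpb
  simpa using h.2 a c ha hb

/-- A synchronizing prefix makes the past irrelevant for the future. -/
theorem IsSync.foll_append {p a m : List A} (h : IsSync X p) (hpm : p <+: m)
    (ham : a ++ m ∈ language X) : foll X (a ++ m) = foll X m := by
  ext b
  simp only [mem_foll]
  constructor
  · intro hb
    rw [List.append_assoc] at hb
    exact language_right hb
  · intro hb
    rw [List.append_assoc]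
    refine h.append_mem ?_ hb (hpm.trans (List.prefix_append _ _))
    obtain ⟨c, rfl⟩ := hpm
    rw [← List.append_assoc] at ham
    exact language_left ham

theorem IsSync.exch {p a b : List A} (h : IsSync X p) (ha : p <+: a) (hb : p <+: b)
    (hlen : a.length = b.length) (hf : foll X a = foll X b) : Exch X a b := by
  refine ⟨hlen, fun l r hl => ?_⟩
  have h1 : l ++ p ∈ language X := by
    obtain ⟨c, rfl⟩ := ha
    have : l ++ p ++ (c ++ r) ∈ language X := by simpa using hl
    exact language_left this
  have h2 : r ∈ foll X b := by
    rw [← hf, mem_foll]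
    rw [List.append_assoc] at hl
    exact language_right hl
  rw [List.append_assoc]
  exact h.append_mem h1 h2 (hb.trans (List.prefix_append _ _))

end Sync

/-! ### First return words -/

section Return

variable {A : Type*} [TopologicalSpace A] {X : Subshift A ℤ} {p : List A}

/-- `r` is a first return word to `p`. -/
structure IsReturn (X : Subshift A ℤ) (p r : List A) : Prop where
  ne_nil : r ≠ []
  mem : r ++ p ∈ language X
  pre : p <+: r ++ p
  first : ∀ k, 0 < k → k < r.length → ¬ p <+: (r ++ p).drop k

theorem exists_return {v : List A} (hv : v ≠ []) (hm : v ++ p ∈ language X) (hp : p <+: v ++ p) :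
    ∃ r v', v = r ++ v' ∧ IsReturn X p r ∧ p <+: v' ++ p := by
  classical
  have hpos := List.length_pos_of_ne_nil hv
  have hex : ∃ k, 0 < k ∧ k ≤ v.length ∧ p <+: (v ++ p).drop k :=
    ⟨v.length, hpos, le_rfl, by simp⟩
  obtain ⟨h0, h1, h2⟩ := Nat.find_spec hex
  set k := Nat.find hex with hk
  have hmin : ∀ j, 0 < j → j < k → ¬ p <+: (v ++ p).drop j := fun j hj hjk h =>
    Nat.find_min hex (by rw [← hk]; exact hjk) ⟨hj, by omega, h⟩
  have h2' : p <+: v.drop k ++ p := by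
    rwa [List.drop_append_of_le_length h1] at h2
  have hpre : v.take k ++ p <+: v ++ p := by
    obtain ⟨c, hc⟩ := h2'
    refine ⟨c, ?_⟩
    rw [List.append_assoc, hc, ← List.append_assoc, List.take_append_drop]
  have hlen : (v.take k).length = k := by simp [h1]
  refine ⟨v.take k, v.drop k, (List.take_append_drop _ _).symm, ⟨?_, ?_, ?_, ?_⟩, h2'⟩
  · intro h; rw [h] at hlen; simp at hlen; omega
  · obtain ⟨c, hc⟩ := hpre
    rw [← hc] at hm
    exact language_left hm
  · exact List.prefix_of_prefix_length_le hp hpre (by simp)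
  · intro j hj hjk h
    refine hmin j hj (by omega) (h.trans ?_)
    exact hpre.drop j

omit [TopologicalSpace A] in
theorem replicate_flatten_period (r : List A) (n k : ℕ)
    (hk : k + r.length < (List.replicate n r).flatten.length) :
    (List.replicate n r).flatten[k]? = (List.replicate n r).flatten[k + r.length]? := by
  cases n with
  | zero => simp at hk
  | succ n =>
    have h1 : (List.replicate (n + 1) r).flatten = r ++ (List.replicate n r).flatten := by
      simp [List.replicate_succ]
    have h2 : (List.replicate (n + 1) r).flatten = (List.replicate n r).flatten ++ r := by
      simp [List.replicate_succ']
    have h3 : k < (List.replicate n r).flatten.length := by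
      rw [h1] at hk; rw [List.length_append] at hk; omega
    conv_rhs => rw [h1]
    rw [h2, List.getElem?_append_left h3, List.getElem?_append_right (by omega)]
    simp

theorem eq_replicate_of_unique {r : List A} (hu : ∀ s, IsReturn X p s → s = r) (n : ℕ) :
    ∀ v : List A, v.length ≤ n → v ++ p ∈ language X → p <+: v ++ p →
      ∃ m, v = (List.replicate m r).flatten := by
  induction n with
  | zero => intro v hv _ _; exact ⟨0, by simpa using hv⟩
  | succ n ih =>
    intro v hv hm hp
    by_cases hv0 : v = []
    · exact ⟨0, by simpa using hv0⟩
    · obtain ⟨s, v', rfl, hs, hp'⟩ := exists_return hv0 hm hp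
      have hs0 := List.length_pos_of_ne_nil hs.ne_nil
      obtain ⟨m, hm'⟩ := ih v' (by simp at hv; omega)
        (by rw [List.append_assoc] at hm; exact language_right hm) hp'
      refine ⟨m + 1, ?_⟩
      rw [hu s hs] at *
      simp [List.replicate_succ, hm']

/-- With only one return word `r`, every word that starts with `p` and returns to `p` is a power of
`r`. By transitivity every word of the language lies inside such a power, so all points have period
`r.length` and `X` is finite. -/
theorem exists_two_returns [Finite A] (hinf : X.carrier.Infinite) (ht : IsTransitive X)
    (hp : p ∈ language X) (hp0 : p ≠ []) :
    ∃ r s, IsReturn X p r ∧ IsReturn X p s ∧ r ≠ s := by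
  by_contra hcon
  push Not at hcon
  obtain ⟨w, -, hw⟩ := ht p hp p hp
  obtain ⟨r, -, -, hr, -⟩ := exists_return (v := p ++ w) (by simp [hp0]) hw
    (by rw [List.append_assoc]; exact List.prefix_append _ _)
  have hu : ∀ s, IsReturn X p s → s = r := fun s hs => hcon s r hs hr
  have hper : ∀ x ∈ X.carrier, ∀ i : ℤ, x (i + r.length) = x i := by
    intro x hx i
    -- The length is `r.length + 1` so that the first and the last letter are one period apart.
    have hm := (reads_subword x i (r.length + 1)).mem_language hx
    obtain ⟨w1, -, hw1⟩ := ht p hp _ hm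
    obtain ⟨w2, -, hw2⟩ := ht _ hw1 p hp
    obtain ⟨m, hm⟩ := eq_replicate_of_unique hu _ _ le_rfl hw2 (by simp)
    have hP := replicate_flatten_period r m (p ++ w1).length (by rw [← hm]; simp [subword]; omega)
    have hmid : ∀ k < (subword x i (r.length + 1)).length,
        (p ++ w1 ++ subword x i (r.length + 1) ++ w2)[(p ++ w1).length + k]? =
          (subword x i (r.length + 1))[k]? := by
      intro k hk
      rw [List.append_assoc, List.getElem?_append_right (by omega), Nat.add_sub_cancel_left,
        List.getElem?_append_left hk]
    have hl := length_subword x i (r.length + 1)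
    rw [← hm] at hP
    replace hP := (hmid 0 (by omega)).symm.trans (hP.trans (hmid r.length (by omega)))
    rw [List.getElem?_eq_getElem (by omega), List.getElem?_eq_getElem (by omega)] at hP
    have h0 := reads_subword x i (r.length + 1) 0 (by simp [subword])
    have h1 := reads_subword x i (r.length + 1) r.length (by simp [subword])
    rw [h1, ← Option.some.inj hP, ← h0]
    simp
  have hr0 := List.length_pos_of_ne_nil hr.ne_nil
  have hper2 : ∀ x ∈ X.carrier, ∀ (n : ℕ) (i : ℤ), x (i + n * r.length) = x i := by
    intro x hx n
    induction n with
    | zero => simp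
    | succ n ih =>
      intro i
      rw [← ih i, ← hper x hx (i + n * r.length)]
      congr 1; push_cast; ring
  refine hinf ?_
  let φ : (ℤ → A) → (Fin r.length → A) := fun x k => x (k : ℕ)
  refine Set.Finite.of_finite_image (f := φ) (Set.toFinite _) ?_
  intro x hx y hy hxy
  have hall : ∀ z ∈ X.carrier, ∀ i : ℤ, z i = z (i % r.length) := by
    intro z hz i
    rcases le_or_gt 0 (i / r.length) with h | h
    · rw [← hper2 z hz (i / r.length).toNat (i % r.length)]
      congr 1
      rw [Int.toNat_of_nonneg h]
      have := Int.emod_add_mul_ediv i r.length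
      linarith
    · rw [← hper2 z hz (-(i / r.length)).toNat i]
      congr 1
      rw [Int.toNat_of_nonneg (by omega)]
      have := Int.emod_add_mul_ediv i r.length
      linarith
  funext i
  rw [hall x hx, hall y hy]
  have h1 := Int.emod_nonneg i (b := (r.length : ℤ)) (by omega)
  have h2 := Int.emod_lt_of_pos i (b := (r.length : ℤ)) (by omega)
  have := congrFun hxy ⟨(i % r.length).toNat, by omega⟩
  simp only [φ, Int.toNat_of_nonneg h1] at this
  exact this

end Return

/-! ### Coding with two return words, and the cell system -/

section Blocks

variable {A : Type*} [TopologicalSpace A] {X : Subshift A ℤ} {p : List A} {blk : Bool → List A}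

/-- Concatenation of blocks. -/
def blocks (blk : Bool → List A) (bs : List Bool) : List A := (bs.map blk).flatten

omit [TopologicalSpace A] in
theorem blocks_append (bs cs : List Bool) :
    blocks blk (bs ++ cs) = blocks blk bs ++ blocks blk cs := by simp [blocks]

omit [TopologicalSpace A] in
theorem blocks_cons (b : Bool) (cs : List Bool) :
    blocks blk (b :: cs) = blk b ++ blocks blk cs := by simp [blocks]

theorem prefix_blocks (h : ∀ b, IsReturn X p (blk b)) (bs : List Bool) :
    p <+: blocks blk bs ++ p := by
  induction bs with
  | nil => simp [blocks]
  | cons b bs ih =>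
    rw [blocks_cons, List.append_assoc]
    refine (h b).pre.trans ?_
    exact (List.prefix_append_right_inj _).2 ih

theorem blocks_mem (hs : IsSync X p) (h : ∀ b, IsReturn X p (blk b)) (bs : List Bool) :
    blocks blk bs ++ p ∈ language X := by
  induction bs with
  | nil => simpa [blocks] using hs.1
  | cons b bs ih =>
    rw [blocks_cons, List.append_assoc]
    exact hs.append_mem (h b).mem ih (prefix_blocks h bs)

/-- Since the blocks are first returns, `p` cannot occur strictly inside a block: block boundaries
are visible. -/
theorem blocks_occ (hp0 : p ≠ []) (h : ∀ b, IsReturn X p (blk b)) (bs : List Bool) :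
    ∀ k, p <+: (blocks blk bs ++ p).drop k → ∃ j ≤ bs.length, k = (blocks blk (bs.take j)).length := by
  induction bs with
  | nil =>
    intro k hk
    have := hk.length_le
    have hp := List.length_pos_of_ne_nil hp0
    simp [blocks] at this ⊢
    omega
  | cons b bs ih =>
    intro k hk
    rcases Nat.eq_zero_or_pos k with rfl | hk0
    · exact ⟨0, by simp, by simp [blocks]⟩
    rw [blocks_cons, List.append_assoc] at hk
    rcases lt_or_ge k (blk b).length with hlt | hge
    · exfalso
      refine (h b).first k hk0 hlt ?_
      have h1 : (blk b ++ p).drop k <+: (blk b ++ (blocks blk bs ++ p)).drop k :=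
        ((List.prefix_append_right_inj _).2 (prefix_blocks h bs)).drop k
      refine List.prefix_of_prefix_length_le hk h1 ?_
      simp; omega
    · rw [List.drop_append, List.drop_eq_nil_of_le hge, List.nil_append] at hk
      obtain ⟨j, hj, hj2⟩ := ih _ hk
      refine ⟨j + 1, by simpa using hj, ?_⟩
      rw [List.take_succ_cons, blocks_cons, List.length_append]
      omega

/-- Unique decoding: if two blocks of different lengths could both be read first, the `p` after the
shorter one would be an early return inside the longer one. -/
theorem blocks_prefix (h : ∀ b, IsReturn X p (blk b)) (hne : blk true ≠ blk false)
    (cs : List Bool) : ∀ bs, blocks blk cs ++ p <+: blocks blk bs ++ p → cs <+: bs := by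
  induction cs with
  | nil => intro bs _; simp
  | cons c cs ih =>
    intro bs hb
    cases bs with
    | nil =>
      exfalso
      have h1 := hb.length_le
      have := List.length_pos_of_ne_nil (h c).ne_nil
      simp [blocks] at h1
      omega
    | cons b bs =>
      have hpc : ∀ d ds, blk d ++ p <+: blocks blk (d :: ds) ++ p := fun d ds => by
        rw [blocks_cons, List.append_assoc]
        exact (List.prefix_append_right_inj _).2 (prefix_blocks h ds)
      have hcb : ∀ d e : Bool, ∀ W, blk d ++ p <+: W → blk e ++ p <+: W →
          ¬ (blk d).length < (blk e).length := by
        intro d e W h1 h2 hlt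
        refine (h e).first _ (List.length_pos_of_ne_nil (h d).ne_nil) hlt ?_
        have h3 := List.prefix_of_prefix_length_le h1 h2 (by simp; omega)
        have := h3.drop (blk d).length
        simpa using this
      have h1 := (hpc c cs).trans hb
      have h2 := hpc b bs
      have hlen : (blk c).length = (blk b).length :=
        le_antisymm (not_lt.1 (hcb _ _ _ h2 h1)) (not_lt.1 (hcb _ _ _ h1 h2))
      have heq : blk c = blk b := by
        have := List.prefix_of_prefix_length_le h1 h2 (by simp; omega)
        have := this.eq_of_length (by simp; omega)
        exact List.append_cancel_right this
      have hcb' : c = b := by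
        cases c <;> cases b
        · rfl
        · exact absurd heq.symm hne
        · exact absurd heq hne
        · rfl
      subst hcb'
      rw [blocks_cons, blocks_cons, List.append_assoc, List.append_assoc,
        List.prefix_append_right_inj] at hb
      simpa using ih bs hb

/-- The code words for the cells. -/
def cellCode : Option (Bool × Bool) → List Bool
  | none => [false, true, false, true, false, true]
  | some (false, false) => [false, true, false, true, true, false]
  | some (false, true) => [false, true, true, false, false, true]
  | some (true, false) => [false, true, true, false, true, false]
  | some (true, true) => [true, false, false, true, false, true]

/-- `j` repetitions of `01`. -/
def altTail (j : ℕ) : List Bool := (List.replicate j [false, true]).flatten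

theorem altTail_succ (j : ℕ) : altTail (j + 1) = false :: true :: altTail j := by
  simp [altTail, List.replicate_succ]

theorem altTail_occ (j : ℕ) : ∀ k, [false, false, false] <+:
    (altTail j ++ [false, false, false]).drop k → k = 2 * j := by
  induction j with
  | zero =>
    intro k hk
    have := hk.length_le
    simp [altTail] at this
    omega
  | succ j ih =>
    intro k hk
    rw [altTail_succ] at hk
    match k with
    | 0 => simp at hk
    | 1 => simp at hk
    | k + 2 =>
      have := ih k (by simpa using hk)
      omega

/-- `000` serves as a comma: the codes never produce it, whether inside or across their borders with
the header `00010` and the tail of `01`s. All codes have three `0`s and three `1`s, so the resulting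
words have equal length although the two blocks need not. Up to position 12 this is a finite check;
afterwards only the tail remains. -/
theorem cellCode_occ (o : Option (Bool × Bool)) (j k : ℕ) (h : [false, false, false] <+:
    (([false, false, false, true, false] ++ cellCode o ++ altTail (j + 1)) ++
      [false, false, false]).drop k) : k = 0 ∨ k = 11 + 2 * (j + 1) := by
  rcases lt_or_ge k 13 with hk | hk
  · left
    rcases o with _ | ⟨_ | _, _ | _⟩ <;> interval_cases k <;>
      simp [cellCode, altTail_succ] at h ⊢
  · right
    obtain ⟨k, rfl⟩ := Nat.exists_eq_add_of_le hk
    have h2 : [false, false, false] <+: (altTail j ++ [false, false, false]).drop k := by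
      rw [add_comm] at h
      rcases o with _ | ⟨_ | _, _ | _⟩ <;>
        simpa [cellCode, altTail_succ] using h
    have := altTail_occ j k h2
    omega

end Blocks

/-- A marker word `p` and five words `V o` of the same length `ℓ` that can be freely exchanged and
concatenated, in such a way that occurrences of `V o ++ p` never overlap. -/
structure CellSystem {A : Type*} [TopologicalSpace A] (X : Subshift A ℤ) where
  /-- the marker -/
  p : List A
  /-- the common length -/
  ℓ : ℕ
  /-- the words -/
  V : Option (Bool × Bool) → List A
  p_ne : p ≠ []
  len_V : ∀ o, (V o).length = ℓ
  V_inj : Function.Injective V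
  pre : ∀ o, p <+: V o
  ret : ∀ o k, 0 < k → k < ℓ → ¬ p <+: (V o ++ p).drop k
  sync : IsSync X p
  mem : ∀ o, V o ++ p ∈ language X
  foll_V : ∀ o o', foll X (V o) = foll X (V o')

/-- The marker is `rrr` followed by the synchronizing word `p1`; each `V o` spells the comma, a code
and a common tail. The tail is long enough to begin with `p1`, which makes all follower sets equal.
-/
theorem exists_cellSystem {A : Type*} [Finite A] [TopologicalSpace A]
    {X : Subshift A ℤ} (hinf : X.carrier.Infinite) (ht : IsTransitive X) (hs : IsSofic X) :
    Nonempty (CellSystem X) := by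
  obtain ⟨x0, hx0⟩ := hinf.nonempty
  obtain ⟨u, hu⟩ := exists_isSync ((reads_nil x0 0).mem_language hx0) hs
  -- The synchronizing word found may be empty; one extra letter repairs this.
  obtain ⟨b, hb1, hb2⟩ := exists_extend_right hu.1 1
  set p1 := u ++ b with hp1
  have hs1 : IsSync X p1 := by simpa using hu.extend (c := []) (d := b) (by simpa using hb2)
  have hp0 : p1 ≠ [] := by
    intro h; rw [h] at hp1; have := congrArg List.length hp1; simp at this; omega
  obtain ⟨r, s, hr, hs, hrs⟩ := exists_two_returns hinf ht hs1.1 hp0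
  let blk : Bool → List A := fun b => cond b s r
  have hret : ∀ b, IsReturn X p1 (blk b) := by rintro (_ | _); exacts [hr, hs]
  have hne : blk true ≠ blk false := fun h => hrs h.symm
  let j := p1.length
  let code : Option (Bool × Bool) → List Bool := fun o =>
    [false, false, false, true, false] ++ cellCode o ++ altTail (j + 1)
  let V : Option (Bool × Bool) → List A := fun o => blocks blk (code o)
  have hr0 := List.length_pos_of_ne_nil hr.ne_nil
  have hs0 := List.length_pos_of_ne_nil hs.ne_nil
  have hfff : blocks blk [false, false, false] = r ++ (r ++ r) := by simp [blocks, blk]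
  have hlen : ∀ o, (V o).length = (V none).length := by
    rintro (_ | ⟨_ | _, _ | _⟩) <;>
      simp [V, code, cellCode, blocks_append, blocks_cons, blk] <;> simp [blocks] <;> omega
  have htail : ∀ n, n ≤ (blocks blk (altTail n)).length := by
    intro n
    induction n with
    | zero => simp
    | succ n ih =>
      rw [altTail_succ, blocks_cons, blocks_cons]
      simp only [List.length_append, blk, cond_true, cond_false] at ih ⊢
      omega
  have htailp : p1 <+: blocks blk (altTail (j + 1)) :=
    List.prefix_of_prefix_length_le (prefix_blocks hret (altTail (j + 1)))
      (List.prefix_append _ _) (by have := htail (j + 1); omega)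
  have hVtail : ∀ o, foll X (V o) = foll X (blocks blk (altTail (j + 1))) := by
    intro o
    have h1 : V o = blocks blk ([false, false, false, true, false] ++ cellCode o) ++
      blocks blk (altTail (j + 1)) := blocks_append _ _
    rw [h1]
    refine hs1.foll_append htailp ?_
    rw [← h1]
    exact language_left (blocks_mem hs1 hret (code o))
  have hVp : ∀ o, V o ++ (r ++ (r ++ r) ++ p1) = blocks blk (code o ++ [false, false, false]) ++ p1 := by
    intro o
    rw [blocks_append, hfff]; simp [V]
  have hpre : ∀ o, r ++ (r ++ r) ++ p1 <+: V o := by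
    intro o
    have h1 : V o = r ++ (r ++ r) ++ (blocks blk (true :: false :: cellCode o) ++
        blocks blk (altTail (j + 1))) := by
      simp [V, code, blocks_append, blocks_cons, blk]
    have h2 : p1 <+: blocks blk (true :: false :: cellCode o) ++ blocks blk (altTail (j + 1)) := by
      rw [← blocks_append]
      refine List.prefix_of_prefix_length_le (prefix_blocks hret _) (List.prefix_append _ _) ?_
      rw [blocks_append]
      have := htail (j + 1)
      simp; omega
    rw [h1]
    exact (List.prefix_append_right_inj _).2 h2
  have hp' : IsSync X (r ++ (r ++ r) ++ p1) := by
    have h1 := blocks_mem hs1 hret [false, false, false]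
    rw [hfff] at h1
    simpa using hs1.extend (c := r ++ (r ++ r)) (d := []) (by simpa using h1)
  refine ⟨⟨r ++ (r ++ r) ++ p1, (V none).length, V, by simp [hp0], hlen, ?_, hpre, ?_, hp', ?_, ?_⟩⟩
  · intro o o' h
    have h1 : blocks blk (code o) = blocks blk (code o') := h
    have h2 := blocks_prefix hret hne (code o) (code o') (by rw [h1])
    have h3 := blocks_prefix hret hne (code o') (code o) (by rw [h1])
    have h4 := h2.eq_of_length (le_antisymm h2.length_le h3.length_le)
    have h5 : cellCode o = cellCode o' := by
      simpa [code] using h4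
    revert h5
    rcases o with _ | ⟨_ | _, _ | _⟩ <;> rcases o' with _ | ⟨_ | _, _ | _⟩ <;> simp [cellCode]
  · intro o k hk0 hk h
    rw [← hlen o] at hk
    rw [hVp] at h
    have h1 : p1 <+: (blocks blk (code o ++ [false, false, false]) ++ p1).drop k := by
      refine List.IsPrefix.trans ?_ h
      exact (by simpa [hfff] using prefix_blocks hret [false, false, false])
    obtain ⟨i, hi, hi2⟩ := blocks_occ hp0 hret _ k h1
    have h2 : blocks blk (code o ++ [false, false, false]) =
        blocks blk ((code o ++ [false, false, false]).take i) ++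
        blocks blk ((code o ++ [false, false, false]).drop i) := by
      rw [← blocks_append, List.take_append_drop]
    rw [h2, hi2, List.append_assoc (blocks blk _) (blocks blk _) p1, List.drop_left, ← hfff] at h
    have h3 := blocks_prefix hret hne _ _ h
    have hl : (code o).length = 11 + 2 * (j + 1) := by
      have : ∀ n, (altTail n).length = 2 * n := by
        intro n; simp [altTail]; omega
      rcases o with _ | ⟨_ | _, _ | _⟩ <;> simp [code, cellCode, this] <;> omega
    rcases cellCode_occ o j i h3 with rfl | rfl
    · simp [blocks] at hi2; omega
    · rw [← hl, List.take_left'  rfl] at hi2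
      simp only [V] at hk
      omega
  · intro o
    rw [hVp]
    exact blocks_mem hs1 hret _
  · intro o o'
    rw [hVtail o, hVtail o']

end OneDimShift

namespace OneDimShift

open SymbolicDynamics.FullShift

/-! ### Local functions on configurations -/

section Local

variable {A β γ δ : Type*}

/-- The value `f x i` only depends on a window of `x` around `i`, in a translation invariant
way. -/
def LocalFn (f : (ℤ → A) → ℤ → β) : Prop :=
  ∃ R : ℕ, ∀ x y i j, Agree x y i j R → f x i = f y j

theorem LocalFn.const (b : β) : LocalFn (fun (_ : ℤ → A) (_ : ℤ) => b) := ⟨0, fun _ _ _ _ _ => rfl⟩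

theorem LocalFn.map {f : (ℤ → A) → ℤ → β} (hf : LocalFn f) (h : β → δ) :
    LocalFn fun x i => h (f x i) := by
  obtain ⟨R, hR⟩ := hf
  exact ⟨R, fun x y i j hxy => congrArg h (hR x y i j hxy)⟩

theorem LocalFn.map₂ {f : (ℤ → A) → ℤ → β} {g : (ℤ → A) → ℤ → γ} (hf : LocalFn f)
    (hg : LocalFn g) (h : β → γ → δ) : LocalFn fun x i => h (f x i) (g x i) := by
  obtain ⟨R, hR⟩ := hf
  obtain ⟨S, hS⟩ := hg
  exact ⟨max R S, fun x y i j hxy => congrArg₂ h (hR x y i j (hxy.mono (le_max_left _ _)))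
    (hS x y i j (hxy.mono (le_max_right _ _)))⟩

theorem LocalFn.translate {f : (ℤ → A) → ℤ → β} (hf : LocalFn f) (t : ℤ) :
    LocalFn fun x i => f x (i + t) := by
  obtain ⟨R, hR⟩ := hf
  refine ⟨R + t.natAbs, fun x y i j hxy => hR _ _ _ _ (hxy.shift t ?_ ?_)⟩ <;>
    rw [Nat.cast_add] <;> omega

theorem LocalFn.pi {ι : Type*} [Finite ι] {f : ι → (ℤ → A) → ℤ → β} (hf : ∀ k, LocalFn (f k)) :
    LocalFn fun x i k => f k x i := by
  choose R hR using hf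
  have := Fintype.ofFinite ι
  exact ⟨Finset.univ.sup R, fun x y i j hxy => funext fun k =>
    hR k _ _ _ _ (hxy.mono (Finset.le_sup (Finset.mem_univ k)))⟩

theorem LocalFn.forall_fin {ι : Type*} [Finite ι] {f : ι → (ℤ → A) → ℤ → Prop}
    (hf : ∀ k, LocalFn (f k)) : LocalFn fun x i => ∀ k, f k x i :=
  (LocalFn.pi hf).map fun P => ∀ k, P k

theorem LocalFn.and {f g : (ℤ → A) → ℤ → Prop} (hf : LocalFn f) (hg : LocalFn g) :
    LocalFn fun x i => f x i ∧ g x i := hf.map₂ hg And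

theorem LocalFn.or {f g : (ℤ → A) → ℤ → Prop} (hf : LocalFn f) (hg : LocalFn g) :
    LocalFn fun x i => f x i ∨ g x i := hf.map₂ hg Or

theorem LocalFn.not {f : (ℤ → A) → ℤ → Prop} (hf : LocalFn f) :
    LocalFn fun x i => ¬ f x i := hf.map Not

theorem localFn_reads (w : List A) : LocalFn fun x i => Reads x i w :=
  ⟨w.length, fun _ _ _ _ h => propext ⟨h.reads (by omega), h.symm.reads (by omega)⟩⟩

theorem Agree.splice {x y : ℤ → A} {i j : ℤ} {R : ℕ} (h : Agree x y i j R) (t : ℤ) (w : List A) :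
    Agree (splice x (i + t) w) (splice y (j + t) w) i j R := by
  intro k h1 h2
  by_cases hk : t ≤ k ∧ k < t + w.length
  · rw [(reads_splice x (i + t) w).apply (k := i + k) (by omega) (by omega),
      (reads_splice y (j + t) w).apply (k := j + k) (by omega) (by omega)]
    congr 1; omega
  · rw [splice_of_not (by omega), splice_of_not (by omega)]
    exact h k h1 h2

theorem LocalFn.splice {f : (ℤ → A) → ℤ → β} (hf : LocalFn f) (t : ℤ) (w : List A) :
    LocalFn fun x i => f (splice x (i + t) w) i := by
  obtain ⟨R, hR⟩ := hf
  exact ⟨R, fun x y i j hxy => hR _ _ _ _ (hxy.splice t w)⟩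

theorem LocalFn.patch {P : (ℤ → A) → ℤ → List A → Prop} (hP : LocalFn P)
    (hc : ∀ x, Compatible (P x)) {B : ℕ} (hB : ∀ x i w, P x i w → w.length ≤ B) :
    LocalFn fun x i => patch x (P x) i := by
  obtain ⟨R, hR⟩ := hP
  refine ⟨R + B, fun x y i j hxy => ?_⟩
  refine agree_patch (hc x) (hc y) (B := B) (hB x) (hB y) (fun t w h1 h2 => ?_) hxy
  rw [hR x y (i + t) (j + t) (hxy.shift t (by rw [Nat.cast_add]; omega) (by rw [Nat.cast_add]; omega))]

theorem splice_self {x : ℤ → A} {i : ℤ} {w : List A} (h : Reads x i w) : splice x i w = x := by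
  funext k
  by_cases hk : i ≤ k ∧ k < i + w.length
  · exact (reads_splice x i w).eq_of h hk.1 hk.2
  · exact splice_of_not (by omega)

end Local

/-! ### Cells, and changes that respect them -/

namespace CellSystem

variable {A : Type*} [TopologicalSpace A] {X : Subshift A ℤ} (c : CellSystem X)

theorem length_p : c.p.length ≤ c.ℓ := by
  rw [← c.len_V none]; exact (c.pre none).length_le

theorem length_p_pos : 0 < c.p.length := List.length_pos_of_ne_nil c.p_ne

theorem ℓ_pos : 0 < c.ℓ := lt_of_lt_of_le c.length_p_pos c.length_p

/-- The word `V o` followed by the marker occurs in `x` at `i`. -/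
def vcell (x : ℤ → A) (i : ℤ) (o : Option (Bool × Bool)) : Prop := Reads x i (c.V o ++ c.p)

variable {c} {x x' : ℤ → A} {i j : ℤ} {o o' : Option (Bool × Bool)}

theorem vcell.reads (h : c.vcell x i o) : Reads x i (c.V o) := Reads.left h

theorem vcell.reads_p (h : c.vcell x i o) : Reads x i c.p := h.reads.of_prefix (c.pre o)

theorem vcell.reads_next (h : c.vcell x i o) : Reads x (i + c.ℓ) c.p := by
  have := Reads.right h
  rwa [c.len_V] at this

theorem vcell_iff : c.vcell x i o ↔ Reads x i (c.V o) ∧ Reads x (i + c.ℓ) c.p := by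
  rw [vcell, reads_append, c.len_V]

theorem reads_V_unique (h : Reads x i (c.V o)) (h' : Reads x i (c.V o')) : o = o' :=
  c.V_inj (h.unique h' (by rw [c.len_V, c.len_V]))

theorem vcell.unique (h : c.vcell x i o) (h' : c.vcell x i o') : o = o' :=
  reads_V_unique h.reads h'.reads

/-- A marker strictly inside would contradict `ret`. Every disjointness statement about cells rests
on this. -/
theorem vcell.le_of_lt (h : c.vcell x i o) (hp : Reads x j c.p) (hij : i < j) : i + c.ℓ ≤ j := by
  by_contra hcon
  refine c.ret o (j - i).toNat (by omega) (by omega) ?_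
  have h1 : c.V o ++ c.p = (c.V o ++ c.p).take (j - i).toNat ++ (c.V o ++ c.p).drop (j - i).toNat :=
    (List.take_append_drop _ _).symm
  rw [vcell, h1] at h
  have h2 := h.right
  have hl : ((c.V o ++ c.p).take (j - i).toNat).length = (j - i).toNat := by
    rw [List.length_take, List.length_append, c.len_V]; omega
  rw [hl] at h2
  have h3 : i + ((j - i).toNat : ℕ) = j := by omega
  rw [h3] at h2
  refine hp.prefix_of_le h2 ?_
  rw [List.length_drop, List.length_append, c.len_V]
  omega

theorem vcell.eq_of_overlap (h : c.vcell x i o) (h' : c.vcell x j o') {k : ℤ} (h1 : i ≤ k)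
    (h2 : k < i + c.ℓ) (h3 : j ≤ k) (h4 : k < j + c.ℓ) : i = j := by
  rcases lt_trichotomy i j with hij | hij | hij
  · have := h.le_of_lt h'.reads_p hij; omega
  · exact hij
  · have := h'.le_of_lt h.reads_p hij; omega

variable (c)

open Classical in
/-- The content of the cell at `i`, if there is a cell. -/
noncomputable def ct (x : ℤ → A) (i : ℤ) : Option (Bool × Bool) :=
  if h : ∃ b, c.vcell x i (some b) then some h.choose else none

variable {c}

theorem ct_eq_some {b : Bool × Bool} : c.ct x i = some b ↔ c.vcell x i (some b) := by
  rw [ct]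
  split_ifs with h
  · have := h.choose_spec
    constructor
    · intro hb; rw [← Option.some.inj hb]; exact this
    · intro hb; exact this.unique hb
  · simp only [false_iff]
    exact fun hb => h ⟨b, hb⟩

theorem ct_eq_none : c.ct x i = none ↔ ∀ b, ¬ c.vcell x i (some b) := by
  rw [Option.eq_none_iff_forall_ne_some]
  simp only [ne_eq, ct_eq_some]

theorem ct_eq_iff {i' : ℤ} (h : ∀ b, c.vcell x i (some b) ↔ c.vcell x' i' (some b)) :
    c.ct x i = c.ct x' i' := by
  ext b
  rw [ct_eq_some, ct_eq_some, h]

theorem vcell.ct_none (h : c.vcell x i none) : c.ct x i = none :=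
  ct_eq_none.2 fun _ hb => by cases h.unique hb

theorem localFn_vcell (o : Option (Bool × Bool)) : LocalFn fun x i => c.vcell x i o :=
  localFn_reads _

theorem localFn_ct : LocalFn fun x i => c.ct x i := by
  obtain ⟨R, hR⟩ := LocalFn.pi (fun b : Bool × Bool => localFn_vcell (c := c) (some b))
  refine ⟨R, fun x y i j h => ct_eq_iff fun b => ?_⟩
  exact iff_of_eq (congrFun (hR x y i j h) b)

/-- `x'` arises from `x` by changing words of length `n` starting with `p` at the positions in
`Q`, and contents of cells according to `C`, the latter being away from the former. -/
structure Rel (c : CellSystem X) (n : ℕ) (x x' : ℤ → A) (Q : ℤ → Prop)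
    (C : ℤ → Bool × Bool → Bool × Bool → Prop) : Prop where
  mid : ∀ t, Q t → Reads x t c.p ∧ Reads x' t c.p
  cell : ∀ j b b', C j b b' → c.vcell x j (some b) ∧ Reads x' j (c.V (some b'))
  free : ∀ j b b' t, C j b b' → Q t → j < t ∨ t + n ≤ j
  same : ∀ k, (∀ t, Q t → k < t ∨ t + n ≤ k) → (∀ j b b', C j b b' → k < j ∨ j + c.ℓ ≤ k) →
    x k = x' k

variable {n : ℕ} {Q : ℤ → Prop} {C : ℤ → Bool × Bool → Bool × Bool → Prop}

/-- Old and new words both begin with `p`. A marker that starts at or before such a word meets only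
its first `p.length` letters, which do not change. -/
theorem Rel.reads_p (h : c.Rel n x x' Q C) {s : ℤ} (hs : Reads x s c.p)
    (hQ : ∀ t, Q t → s ≤ t ∨ t + n ≤ s) (hC : ∀ j b b', C j b b' → s ≤ j ∨ j + c.ℓ ≤ s) :
    Reads x' s c.p := by
  have hl := c.length_p
  refine hs.congr fun k h1 h2 => ?_
  by_cases hq : ∀ t, Q t → k < t ∨ t + n ≤ k
  · by_cases hc : ∀ j b b', C j b b' → k < j ∨ j + c.ℓ ≤ k
    · exact h.same k hq hc
    · push Not at hc
      obtain ⟨j, b, b', hj, h3, h4⟩ := hc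
      have h5 := h.cell j b b' hj
      have := hC j b b' hj
      exact h5.1.reads_p.eq_of (h5.2.of_prefix (c.pre _)) h3 (by omega)
  · push Not at hq
    obtain ⟨t, ht, h3, h4⟩ := hq
    have := hQ t ht
    exact (h.mid t ht).1.eq_of (h.mid t ht).2 h3 (by omega)

theorem Rel.vcell' (h : c.Rel n x x' Q C) {j b b'} (hC : C j b b') : c.vcell x' j (some b') := by
  obtain ⟨h1, h2⟩ := h.cell j b b' hC
  refine vcell_iff.2 ⟨h2, h.reads_p h1.reads_next (fun t ht => ?_) fun j' d d' hd => ?_⟩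
  · rcases h.free j b b' t hC ht with h3 | h3
    · exact Or.inl (h1.le_of_lt (h.mid t ht).1 h3)
    · right; omega
  · have h3 := (h.cell j' d d' hd).1
    rcases lt_trichotomy j j' with hj | hj | hj
    · exact Or.inl (h1.le_of_lt h3.reads_p hj)
    · right; omega
    · have := h3.le_of_lt h1.reads_p hj; right; omega

/-- Symmetry lets each transfer statement be proved in one direction only. -/
theorem Rel.symm (h : c.Rel n x x' Q C) : c.Rel n x' x Q (fun j b b' => C j b' b) where
  mid t ht := (h.mid t ht).symm
  cell j b b' hC := ⟨h.vcell' hC, (h.cell j b' b hC).1.reads⟩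
  free j b b' t := h.free j b' b t
  same k h1 h2 := (h.same k h1 fun j b b' => h2 j b' b).symm

theorem Rel.vcell_of_not (h : c.Rel n x x' Q C) (hv : c.vcell x i o)
    (hQ : ∀ t, Q t → i < t ∨ t + n ≤ i) (hC : ∀ b b', ¬ C i b b') : c.vcell x' i o := by
  have hQ' : ∀ t, Q t → i + c.ℓ ≤ t ∨ t + n ≤ i := fun t ht =>
    (hQ t ht).imp_left fun h3 => hv.le_of_lt (h.mid t ht).1 h3
  have hC' : ∀ j b b', C j b b' → i + c.ℓ ≤ j ∨ j + c.ℓ ≤ i := fun j b b' hj => by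
    have h3 := (h.cell j b b' hj).1
    rcases lt_trichotomy i j with hij | rfl | hij
    · exact Or.inl (hv.le_of_lt h3.reads_p hij)
    · exact absurd hj (hC b b')
    · exact Or.inr (h3.le_of_lt hv.reads_p hij)
  refine vcell_iff.2 ⟨hv.reads.congr fun k h1 h2 => ?_, h.reads_p hv.reads_next ?_ ?_⟩
  · rw [c.len_V] at h2
    refine h.same k (fun t ht => ?_) fun j b b' hj => ?_
    · have := hQ' t ht; omega
    · have := hC' j b b' hj; omega
  · intro t ht; have := hQ' t ht; omega
  · intro j b b' hj; have := hC' j b b' hj; omega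

theorem Rel.ct_of_not (h : c.Rel n x x' Q C)
    (hQ : ∀ t, Q t → i < t ∨ t + n ≤ i) (hC : ∀ b b', ¬ C i b b') : c.ct x' i = c.ct x i :=
  ct_eq_iff fun _ => ⟨fun hv => h.symm.vcell_of_not hv hQ fun b b' => hC b' b,
    fun hv => h.vcell_of_not hv hQ hC⟩

theorem Rel.ct_of_mem (h : c.Rel n x x' Q C) {b b'} (hC : C i b b') :
    c.ct x i = some b ∧ c.ct x' i = some b' :=
  ⟨ct_eq_some.2 (h.cell i b b' hC).1, ct_eq_some.2 (h.vcell' hC)⟩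

/-- Writing the same word into both points erases their difference at `t0`. This is needed because
activity of a place is tested on both possible replacements. -/
theorem Rel.splice (h : c.Rel n x x' Q C) {t0 : ℤ} {w : List A} (hx : Reads x t0 c.p)
    (hx' : Reads x' t0 c.p) (hw : c.p <+: w) (hwn : w.length = n)
    (hQ : ∀ t, Q t → t ≠ t0 → t + n ≤ t0 ∨ t0 + n ≤ t)
    (hC : ∀ j b b', C j b b' → j + c.ℓ ≤ t0 ∨ t0 + n ≤ j) (hn : c.ℓ ≤ n) :
    c.Rel n (splice x t0 w) (splice x' t0 w) (fun t => Q t ∧ t ≠ t0) C := by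
  have hl := c.length_p
  have key : c.Rel n x (OneDimShift.splice x t0 w) (fun t => t = t0) (fun _ _ _ => False) :=
    { mid := by rintro t rfl; exact ⟨hx, (reads_splice x t w).of_prefix hw⟩
      cell := by rintro _ _ _ ⟨⟩
      free := by rintro _ _ _ _ ⟨⟩
      same := fun k hk _ => (splice_of_not (by have := hk t0 rfl; omega)).symm }
  refine ⟨?_, ?_, ?_, ?_⟩
  · rintro t ⟨ht, hne⟩
    have h1 := hQ t ht hne
    refine ⟨(h.mid t ht).1.congr fun k h2 h3 => ?_, (h.mid t ht).2.congr fun k h2 h3 => ?_⟩ <;>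
      exact (splice_of_not (by omega)).symm
  · intro j b b' hj
    have h1 := hC j b b' hj
    refine ⟨key.vcell_of_not (h.cell j b b' hj).1 ?_ fun _ _ => id,
      (h.cell j b b' hj).2.congr fun k h2 h3 => ?_⟩
    · rintro t rfl
      have := c.ℓ_pos
      omega
    · rw [c.len_V] at h3
      exact (splice_of_not (by omega)).symm
  · rintro j b b' t hj ⟨ht, -⟩
    exact h.free j b b' t hj ht
  · intro k h1 h2
    by_cases hk : t0 ≤ k ∧ k < t0 + w.length
    · exact (reads_splice _ _ _).eq_of (reads_splice _ _ _) hk.1 hk.2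
    · rw [splice_of_not (by omega), splice_of_not (by omega)]
      refine h.same k (fun t ht => ?_) h2
      by_cases htt : t = t0
      · omega
      · exact h1 t ⟨ht, htt⟩

theorem exch_V (o o' : Option (Bool × Bool)) : Exch X (c.V o) (c.V o') :=
  c.sync.exch (c.pre o) (c.pre o') (by rw [c.len_V, c.len_V]) (c.foll_V o o')

theorem V_ne_nil (o : Option (Bool × Bool)) : c.V o ≠ [] := by
  have h1 := c.len_V o
  have h2 := c.ℓ_pos
  exact List.ne_nil_of_length_pos (by omega)

/-! ### Cellwise rules and the belt map -/

section CellMap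

/-- A rule for the new content of a cell, given the contents of its neighbours. -/
abbrev Rule := Option (Bool × Bool) → Bool × Bool → Option (Bool × Bool) → Bool × Bool

variable (c)

/-- The new content of the cell at `i`. -/
noncomputable def newCt (s : Rule) (x : ℤ → A) (i : ℤ) (b : Bool × Bool) : Bool × Bool :=
  s (c.ct x (i - c.ℓ)) b (c.ct x (i + c.ℓ))

/-- Apply the rule `s` to all cells. -/
noncomputable def cellMap (s : Rule) (x : ℤ → A) : ℤ → A :=
  patch x fun i w => ∃ b, c.vcell x i (some b) ∧ w = c.V (some (c.newCt s x i b))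

variable {c}

theorem compatible_cells (f : ℤ → Bool × Bool → List A) (hf : ∀ i b, (f i b).length = c.ℓ) :
    Compatible fun i w => ∃ b, c.vcell x i (some b) ∧ w = f i b := by
  rintro i w i' w' k ⟨b, hb, rfl⟩ ⟨b', hb', rfl⟩ h1 h2 h3 h4
  rw [hf] at h2 h4
  obtain rfl := hb.eq_of_overlap hb' h1 h2 h3 h4
  obtain rfl : b = b' := Option.some.inj (hb.unique hb')
  exact ⟨rfl, rfl⟩

theorem rel_cellMap (s : Rule) (x : ℤ → A) : c.Rel 0 x (c.cellMap s x) (fun _ => False)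
    (fun j b b' => c.vcell x j (some b) ∧ b' = c.newCt s x j b) where
  mid _ := False.elim
  cell := by
    rintro j b b' ⟨h, rfl⟩
    exact ⟨h, reads_patch (compatible_cells _ fun _ _ => c.len_V _) ⟨b, h, rfl⟩⟩
  free _ _ _ _ _ := False.elim
  same := by
    intro k _ h
    refine (patch_of_not ?_).symm
    rintro i w ⟨b, hb, rfl⟩ h1 h2
    rw [c.len_V] at h2
    have := h i b _ ⟨hb, rfl⟩
    omega

theorem ct_cellMap (s : Rule) (x : ℤ → A) (i : ℤ) :
    c.ct (c.cellMap s x) i = (c.ct x i).map (c.newCt s x i) := by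
  have hr := rel_cellMap (c := c) s x
  cases h : c.ct x i with
  | none =>
    rw [hr.ct_of_not (by simp), h]
    · rfl
    · rintro b b' ⟨hb, -⟩
      exact ct_eq_none.1 h b hb
  | some b => exact (hr.ct_of_mem (b := b) ⟨ct_eq_some.1 h, rfl⟩).2

theorem cellMap_of_not (s : Rule) {k : ℤ}
    (h : ∀ j b, c.vcell x j (some b) → k < j ∨ j + c.ℓ ≤ k) : c.cellMap s x k = x k :=
  ((rel_cellMap s x).same k (by simp) fun j b _ hj => h j b hj.1).symm

theorem vcell_none_cellMap (s : Rule) (h : c.vcell x i none) : c.vcell (c.cellMap s x) i none :=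
  (rel_cellMap s x).vcell_of_not h (by simp) fun b _ hb => by cases h.unique hb.1

/-- Points with the same cell contents that agree off the cells are equal. -/
theorem eq_of_ct (hct : ∀ i, c.ct x i = c.ct x' i)
    (h : ∀ k, (∀ j b, c.vcell x j (some b) → k < j ∨ j + c.ℓ ≤ k) → x k = x' k) : x = x' := by
  funext k
  by_cases hk : ∀ j b, c.vcell x j (some b) → k < j ∨ j + c.ℓ ≤ k
  · exact h k hk
  · push Not at hk
    obtain ⟨j, b, hj, h1, h2⟩ := hk
    have hj' : c.vcell x' j (some b) := by rw [← ct_eq_some, ← hct, ct_eq_some]; exact hj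
    exact hj.reads.eq_of hj'.reads h1 (by rw [c.len_V]; exact h2)

/-- Rules change contents but never create, move or destroy cells, so inverses can be verified on
contents alone. -/
theorem cellMap_cellMap {s s' : Rule}
    (h : ∀ (x : ℤ → A) i b, c.ct x i = some b →
      c.newCt s' (c.cellMap s x) i (c.newCt s x i b) = b) (x : ℤ → A) :
    c.cellMap s' (c.cellMap s x) = x := by
  have hct : ∀ i, c.ct (c.cellMap s' (c.cellMap s x)) i = c.ct x i := by
    intro i
    rw [ct_cellMap, ct_cellMap]
    cases hi : c.ct x i with
    | none => rfl
    | some b => simp only [Option.map_some]; rw [h x i b hi]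
  refine (eq_of_ct (fun i => (hct i).symm) fun k hk => ?_).symm
  rw [cellMap_of_not, cellMap_of_not _ hk]
  intro j b hj
  have h1 := ct_eq_some.2 hj
  rw [ct_cellMap] at h1
  obtain ⟨b', h2, -⟩ := Option.map_eq_some_iff.1 h1
  exact hk j b' (ct_eq_some.1 h2)

theorem cellMap_mem (s : Rule) (hx : x ∈ X.carrier) : c.cellMap s x ∈ X.carrier := by
  refine patch_mem hx (compatible_cells _ fun _ _ => c.len_V _) ?_ ?_ (B := c.ℓ) ?_
  · rintro i w ⟨b, hb, rfl⟩
    exact ⟨_, hb.reads, exch_V _ _⟩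
  · rintro i w ⟨b, hb, rfl⟩
    exact V_ne_nil _
  · rintro i w ⟨b, hb, rfl⟩
    rw [c.len_V]

theorem localFn_cellMap (s : Rule) : LocalFn (c.cellMap s) := by
  refine LocalFn.patch (P := fun x i w => ∃ b, c.vcell x i (some b) ∧
    w = c.V (some (c.newCt s x i b))) ?_
    (fun x => compatible_cells _ fun _ _ => c.len_V _) (B := c.ℓ) ?_
  · have h := (localFn_ct (c := c)).map₂ (((localFn_ct (c := c)).translate (-c.ℓ)).map₂
      ((localFn_ct (c := c)).translate c.ℓ) Prod.mk) (fun o p (w : List A) => ∃ b, o = some b ∧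
        w = c.V (some (s p.1 b p.2)))
    simpa only [ct_eq_some, newCt, ← sub_eq_add_neg] using h
  · rintro x i w ⟨b, hb, rfl⟩
    rw [c.len_V]

end CellMap

/-- Left contents move along one belt, right contents along the other; `y` is turned into `z` at the
left end of a run of cells and `z` into the negated `y` at the right end. -/
def beltRule : Rule := fun l b r => (l.elim b.2 Prod.fst, r.elim (!b.1) Prod.snd)

/-- The inverse rule. -/
def beltRuleInv : Rule := fun l b r => (r.elim (!b.2) Prod.fst, l.elim b.1 Prod.snd)

variable (c) in
/-- The belt map. -/
noncomputable def belt (x : ℤ → A) : ℤ → A := c.cellMap beltRule x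

variable (c) in
/-- The inverse of the belt map. -/
noncomputable def beltInv (x : ℤ → A) : ℤ → A := c.cellMap beltRuleInv x

/-- In a finite run the two tracks form one closed loop that is rotated by one step, with one
negation; the inverse rule turns it back. Runs with fewer ends are covered by the same four cases of
neighbours. -/
theorem beltInv_belt (x : ℤ → A) : c.beltInv (c.belt x) = x := by
  refine cellMap_cellMap (fun x i b hb => ?_) x
  simp only [newCt, ct_cellMap, beltRuleInv, beltRule]
  have e1 : i + (c.ℓ : ℤ) - c.ℓ = i := by ring
  have e2 : i - (c.ℓ : ℤ) + c.ℓ = i := by ring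
  cases h1 : c.ct x (i - c.ℓ) <;> cases h2 : c.ct x (i + c.ℓ) <;> simp [newCt, beltRule, hb, e1, e2]

theorem belt_beltInv (x : ℤ → A) : c.belt (c.beltInv x) = x := by
  refine cellMap_cellMap (fun x i b hb => ?_) x
  simp only [newCt, ct_cellMap, beltRuleInv, beltRule]
  have e1 : i + (c.ℓ : ℤ) - c.ℓ = i := by ring
  have e2 : i - (c.ℓ : ℤ) + c.ℓ = i := by ring
  cases h1 : c.ct x (i - c.ℓ) <;> cases h2 : c.ct x (i + c.ℓ) <;> simp [newCt, beltRuleInv, hb, e1, e2]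

end CellSystem

end OneDimShift

namespace OneDimShift

open SymbolicDynamics.FullShift

/-! ### The exchange gadget -/

namespace CellSystem

variable {A : Type*} [TopologicalSpace A] {X : Subshift A ℤ} (c : CellSystem X)

/-- Concatenation of the words `V o`. -/
def word (os : List (Option (Bool × Bool))) : List A := (os.map c.V).flatten

theorem word_cons (o : Option (Bool × Bool)) (os : List (Option (Bool × Bool))) :
    c.word (o :: os) = c.V o ++ c.word os := by simp [word]

theorem word_append (os os' : List (Option (Bool × Bool))) :
    c.word (os ++ os') = c.word os ++ c.word os' := by simp [word]

theorem length_word (os : List (Option (Bool × Bool))) :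
    (c.word os).length = os.length * c.ℓ := by
  induction os with
  | nil => simp [word]
  | cons o os ih =>
    rw [word_cons, List.length_append, c.len_V, ih, List.length_cons]; ring

theorem pre_word_p (os : List (Option (Bool × Bool))) : c.p <+: c.word os ++ c.p := by
  cases os with
  | nil => simp [word]
  | cons o os =>
    rw [word_cons, List.append_assoc]
    exact (c.pre o).trans (List.prefix_append _ _)

theorem pre_word {os : List (Option (Bool × Bool))} (h : os ≠ []) : c.p <+: c.word os := by
  cases os with
  | nil => exact absurd rfl h
  | cons o os =>
    rw [word_cons]
    exact (c.pre o).trans (List.prefix_append _ _)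

theorem word_mem (os : List (Option (Bool × Bool))) : c.word os ++ c.p ∈ language X := by
  induction os with
  | nil => simpa [word] using c.sync.1
  | cons o os ih =>
    rw [word_cons, List.append_assoc]
    exact c.sync.append_mem (c.mem o) ih (c.pre_word_p os)

theorem word_append_mem (os : List (Option (Bool × Bool))) {m : List A} (hm : m ∈ language X)
    (hp : c.p <+: m) : c.word os ++ m ∈ language X :=
  c.sync.append_mem (c.word_mem os) hm hp

theorem foll_word {os : List (Option (Bool × Bool))} (h : os ≠ []) :
    foll X (c.word os) = foll X (c.V none) := by
  obtain ⟨os, o, rfl⟩ := List.eq_nil_or_concat'  os |>.resolve_left h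
  have h1 : c.word (os ++ [o]) = c.word os ++ c.V o := by rw [word_append]; simp [word]
  rw [h1, c.sync.foll_append (c.pre o), c.foll_V]
  rw [← h1]
  exact language_left (c.word_mem _)

variable {c} {x x' : ℤ → A} {i : ℤ}

theorem reads_word {os : List (Option (Bool × Bool))} (h : Reads x i (c.word os ++ c.p)) (j : ℕ)
    (hj : j < os.length) : c.vcell x (i + j * c.ℓ) os[j] := by
  induction os generalizing i j with
  | nil => simp at hj
  | cons o os ih =>
    rw [word_cons, List.append_assoc] at h
    cases j with
    | zero =>
      rw [Nat.cast_zero, zero_mul, add_zero]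
      exact h.of_prefix ((List.prefix_append_right_inj _).2 (c.pre_word_p os))
    | succ j =>
      have h1 := h.right
      rw [c.len_V] at h1
      have h2 := ih h1 j (by simpa using hj)
      have h3 : i + ((j + 1 : ℕ) : ℤ) * c.ℓ = i + c.ℓ + j * c.ℓ := by push_cast; ring
      rw [h3]
      simpa using h2

theorem reads_word_of {os : List (Option (Bool × Bool))} (hp : Reads x (i + os.length * c.ℓ) c.p)
    (h : ∀ (j : ℕ) (hj : j < os.length), Reads x (i + j * c.ℓ) (c.V os[j])) :
    Reads x i (c.word os ++ c.p) := by
  induction os generalizing i with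
  | nil => simpa [word] using hp
  | cons o os ih =>
    rw [word_cons, List.append_assoc, reads_append, c.len_V]
    have h0 := h 0 (by simp)
    rw [Nat.cast_zero, zero_mul, add_zero] at h0
    refine ⟨h0, ih ?_ fun j hj => ?_⟩
    · convert hp using 1; simp only [List.length_cons]; push_cast; ring
    · have := h (j + 1) (by simpa using hj)
      rw [show i + ((j + 1 : ℕ) : ℤ) * c.ℓ = i + c.ℓ + j * c.ℓ by push_cast; ring] at this
      exact this

/-- A marker in a run of cells is at the start of one of them. -/
theorem exists_of_run {q s : ℤ} {n : ℕ} (h : ∀ j < n, ∃ o, c.vcell x (q + (j : ℕ) * c.ℓ) o)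
    (hs : Reads x s c.p) (h1 : q ≤ s) (h2 : s < q + n * c.ℓ) : ∃ j < n, s = q + (j : ℕ) * c.ℓ := by
  induction n generalizing q with
  | zero => simp at h2; omega
  | succ n ih =>
    rcases eq_or_lt_of_le h1 with rfl | h1
    · exact ⟨0, by omega, by simp⟩
    · obtain ⟨o, ho⟩ := h 0 (by omega)
      have h3 := ho.le_of_lt hs (by simpa using h1)
      obtain ⟨j, hj, hj2⟩ := ih (q := q + c.ℓ) (fun j hj => by
        obtain ⟨o, ho⟩ := h (j + 1) (by omega)
        refine ⟨o, ?_⟩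
        convert ho using 1; push_cast; ring) (by simpa using h3) (by push_cast at h2; linarith)
      exact ⟨j + 1, by omega, by rw [hj2]; push_cast; ring⟩

variable (c)

/-- The words of length `d ℓ` that start with the marker but not with a cell. -/
def noCellWords (d : ℕ) : Set (List A) :=
  {m | m ∈ language X ∧ m.length = d * c.ℓ ∧ c.p <+: m ∧ ∀ b, ¬ c.V (some b) ++ c.p <+: m}

/-- The data needed to exchange a word without a cell at its start by another one. -/
structure Gadget where
  /-- number of initial cells -/
  K0 : ℕ
  /-- number of intermediate cells -/
  K1 : ℕ
  /-- length of the final word -/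
  d : ℕ
  /-- final word after the exchange -/
  T : List A → List A
  /-- the word that codes a final word -/
  code : List A → List Bool
  two_le : 2 ≤ d
  K1_pos : 1 ≤ K1
  -- A base must be longer than two exchanged words: it then outreaches the final part next to it,
  -- and a gap of at most `2 * (K1 + d)` cell lengths has no room for one.
  le_K0 : 2 * (K1 + d) + 2 ≤ K0
  -- The outer `0`s give cells `00` at both ends of the coded part, which no base of cells `01` can
  -- contain.
  code_eq : ∀ m, ∃ l : List Bool, l.length = K1 - 1 ∧ code m = [false] ++ l ++ [false]
  code_inj : ∀ m ∈ c.noCellWords d, ∀ m' ∈ c.noCellWords d, code m = code m' → m = m'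
  T_len : ∀ m ∈ c.noCellWords d, (T m).length = (d - 1) * c.ℓ
  T_mem : ∀ m ∈ c.noCellWords d, T m ∈ language X
  T_pre : ∀ m ∈ c.noCellWords d, c.p <+: T m
  T_foll : ∀ m ∈ c.noCellWords d, foll X (T m) = foll X m
  -- For the followers of `V none` the new final word consists of cells, so the run swallows all of
  -- `m`; their content `10` cannot occur in a run whose left track is `0`.
  T_eq : ∀ m ∈ c.noCellWords d, foll X m = foll X (c.V none) →
    T m = c.word (List.replicate (d - 1) (some (true, false)))

/-- The follower sets of words of length `j * ℓ` starting with `p` increase with `j`, as `V none`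
may be put in front. There are finitely many follower sets, so the sequence is constant from some
`n` on. -/
theorem exists_shorten (hs : IsSofic X) : ∃ d, 2 ≤ d ∧ ∀ m ∈ language X, m.length = d * c.ℓ →
    c.p <+: m → ∃ t ∈ language X, t.length = (d - 1) * c.ℓ ∧ c.p <+: t ∧ foll X t = foll X m := by
  let E : ℕ → Set (Language A) := fun j =>
    {q | ∃ m ∈ language X, m.length = j * c.ℓ ∧ c.p <+: m ∧ foll X m = q}
  have hmono : Monotone E := by
    refine monotone_nat_of_le_succ fun j => ?_
    rintro _ ⟨m, hm, hl, hp, rfl⟩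
    have h1 := c.sync.append_mem (c.mem none) hm hp
    exact ⟨c.V none ++ m, h1, by rw [List.length_append, c.len_V, hl]; ring,
      (c.pre none).trans (List.prefix_append _ _), c.sync.foll_append hp h1⟩
  have hfin : (⋃ j, E j).Finite := by
    refine (Language.IsRegular.finite_range_leftQuotient hs).subset ?_
    intro q hq
    obtain ⟨j, m, -, -, -, rfl⟩ := Set.mem_iUnion.1 hq
    exact ⟨m, rfl⟩
  obtain ⟨n, hn⟩ : ∃ n, ∀ q ∈ ⋃ j, E j, q ∈ E n := by
    have h1 : ∀ q : Language A, ∃ j, q ∈ (⋃ j, E j) → q ∈ E j := fun q => by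
      by_cases hq : q ∈ ⋃ j, E j
      · obtain ⟨j, hj⟩ := Set.mem_iUnion.1 hq
        exact ⟨j, fun _ => hj⟩
      · exact ⟨0, fun h => absurd h hq⟩
    choose f hf using h1
    refine ⟨hfin.toFinset.sup f, fun q hq => hmono ?_ (hf q hq)⟩
    exact Finset.le_sup (f := f) (hfin.mem_toFinset.2 hq)
  refine ⟨n + 2, by omega, fun m hm hl hp => ?_⟩
  have h1 : foll X m ∈ E (n + 1) :=
    hmono (Nat.le_succ n) (hn _ (Set.mem_iUnion.2 ⟨n + 2, m, hm, hl, hp, rfl⟩))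
  obtain ⟨t, h2, h3, h4, h5⟩ := h1
  exact ⟨t, h2, h3, h4, h5⟩

/-- The code of `m` is its indicator function in a list of all admissible words, framed by two `0`s.
-/
theorem exists_gadget [Finite A] (hs : IsSofic X) : Nonempty c.Gadget := by
  classical
  obtain ⟨d, hd, hT⟩ := c.exists_shorten hs
  have hfin : (c.noCellWords d).Finite :=
    (List.finite_length_eq A (d * c.ℓ)).subset fun m hm => hm.2.1
  let e := hfin.toFinset.toList
  have he : ∀ m ∈ c.noCellWords d, m ∈ e := fun m hm => by simpa [e] using hm
  have hTw : ∀ m ∈ c.noCellWords d, ∃ t ∈ language X, t.length = (d - 1) * c.ℓ ∧ c.p <+: t ∧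
      foll X t = foll X m ∧ (foll X m = foll X (c.V none) →
        t = c.word (List.replicate (d - 1) (some (true, false)))) := by
    intro m hm
    by_cases hf : foll X m = foll X (c.V none)
    · have hne : List.replicate (d - 1) (some (true, false)) ≠ [] := by
        simp; omega
      exact ⟨_, language_left (c.word_mem (List.replicate (d - 1) (some (true, false)))),
        by rw [length_word, List.length_replicate], c.pre_word hne, by rw [c.foll_word hne, hf],
        fun _ => rfl⟩
    · obtain ⟨t, h1, h2, h3, h4⟩ := hT m hm.1 hm.2.1 hm.2.2.1
      exact ⟨t, h1, h2, h3, h4, fun h => absurd h hf⟩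
  choose! T hT1 hT2 hT3 hT4 hT5 using hTw
  refine ⟨⟨2 * (e.length + 1 + d) + 2, e.length + 1, d, T,
    fun m => [false] ++ e.map (fun m' => decide (m' = m)) ++ [false], hd, by omega, le_rfl,
    fun m => ⟨_, by simp, rfl⟩, ?_, hT2, hT1, hT3, hT4, hT5⟩⟩
  intro m hm m' hm' h
  simp only [List.append_cancel_left_eq, List.append_cancel_right_eq] at h
  have := List.map_inj_left.1 h m (he m hm)
  simpa using this

namespace Gadget

variable {c} (g : c.Gadget)

/-- The initial part of the exchanged words. -/
def hd (m : List A) (b : Bool) : List (Option (Bool × Bool)) :=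
  cond b ((g.code m).map fun z => some (false, z)) (List.replicate g.K1 (some (false, true)))

/-- The final part of the exchanged words. -/
def tl (m : List A) (b : Bool) : List A := cond b (g.T m) m

/-- The exchanged words. -/
def mid (m : List A) (b : Bool) : List A := c.word (g.hd m b) ++ g.tl m b

/-- The words that are exchanged. -/
abbrev M : Set (List A) := c.noCellWords g.d

variable {g} {m m' : List A} {b b' : Bool} {q t : ℤ}

theorem length_code (m : List A) : (g.code m).length = g.K1 + 1 := by
  obtain ⟨l, hl, h⟩ := g.code_eq m
  have := g.K1_pos
  rw [h]; simp; omega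

theorem length_hd : (g.hd m b).length = if b then g.K1 + 1 else g.K1 := by
  cases b <;> simp [hd, length_code]

theorem length_mid (hm : m ∈ g.M) : (g.mid m b).length = (g.K1 + g.d) * c.ℓ := by
  have := g.two_le
  obtain ⟨e, he⟩ := Nat.exists_eq_add_of_le this
  cases b
  · simp only [mid, List.length_append, length_word, length_hd, tl, cond_false, hm.2.1]
    simp; ring
  · simp only [mid, List.length_append, length_word, length_hd, tl, cond_true, g.T_len m hm]
    simp only [if_true, he]
    rw [show 2 + e - 1 = e + 1 by omega]
    ring

theorem pre_tl (hm : m ∈ g.M) : c.p <+: g.tl m b := by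
  cases b
  · exact hm.2.2.1
  · exact g.T_pre m hm

theorem tl_mem (hm : m ∈ g.M) : g.tl m b ∈ language X := by
  cases b
  · exact hm.1
  · exact g.T_mem m hm

theorem word_hd_pre (hm : m ∈ g.M) : c.word (g.hd m b) ++ c.p <+: g.mid m b :=
  (List.prefix_append_right_inj _).2 (pre_tl hm)

theorem pre_mid (hm : m ∈ g.M) : c.p <+: g.mid m b :=
  (c.pre_word_p _).trans (word_hd_pre hm)

theorem mid_mem (hm : m ∈ g.M) : g.mid m b ∈ language X :=
  c.word_append_mem _ (tl_mem hm) (pre_tl hm)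

theorem foll_mid (hm : m ∈ g.M) : foll X (g.mid m b) = foll X m := by
  rw [mid, c.sync.foll_append (pre_tl hm) (mid_mem hm)]
  cases b
  · rfl
  · exact g.T_foll m hm

theorem exch_mid (hm : m ∈ g.M) : Exch X (g.mid m b) (g.mid m b') :=
  c.sync.exch (pre_mid hm) (pre_mid hm) (by rw [length_mid hm, length_mid hm])
    (by rw [foll_mid hm, foll_mid hm])

theorem mid_false_ct (hm : m ∈ g.M) (h : Reads x t (g.mid m false)) {j : ℕ} (hj : j < g.K1) :
    c.ct x (t + j * c.ℓ) = some (false, true) := by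
  have := reads_word (h.of_prefix (word_hd_pre hm)) j (by simpa [length_hd] using hj)
  rw [ct_eq_some]
  simpa [hd] using this

theorem mid_true_ct (hm : m ∈ g.M) (h : Reads x t (g.mid m true)) {j : ℕ} (hj : j < g.K1 + 1) :
    c.ct x (t + j * c.ℓ) = some (false, (g.code m)[j]'(by rw [length_code]; exact hj)) := by
  have := reads_word (h.of_prefix (word_hd_pre hm)) j (by simpa [length_hd] using hj)
  rw [ct_eq_some]
  simpa [hd] using this

theorem mid_true_ct_zero (hm : m ∈ g.M) (h : Reads x t (g.mid m true)) :
    c.ct x t = some (false, false) := by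
  obtain ⟨l, hl, hc⟩ := g.code_eq m
  have := mid_true_ct hm h (j := 0) (by omega)
  simpa [hc] using this

theorem mid_true_ct_last (hm : m ∈ g.M) (h : Reads x t (g.mid m true)) :
    c.ct x (t + g.K1 * c.ℓ) = some (false, false) := by
  obtain ⟨l, hl, hc⟩ := g.code_eq m
  have hK := g.K1_pos
  have h1 := mid_true_ct hm h (j := g.K1) (by omega)
  rw [h1]
  simp only [hc]
  rw [List.getElem_append_right (by simp; omega)]
  simp

theorem mid_false_ct_end (hm : m ∈ g.M) (h : Reads x t (g.mid m false)) :
    c.ct x (t + g.K1 * c.ℓ) = none := by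
  rw [ct_eq_none]
  intro b hb
  have h1 : Reads x (t + g.K1 * c.ℓ) m := by
    have := Reads.right h
    rw [length_word, length_hd] at this
    simpa [tl] using this
  -- As `d ≥ 2`, the word `m` is long enough to contain a cell together with its marker.
  refine hm.2.2.2 b (Reads.prefix_of_le hb h1 ?_)
  rw [List.length_append, c.len_V, hm.2.1]
  have h2 := c.length_p
  nlinarith [g.two_le]

/-- The first cell, `01` or `00`, reveals the state `b`; the rest determines `m`, by injectivity of
the code in the coded state. -/
theorem mid_unique (hm : m ∈ g.M) (hm' : m' ∈ g.M) (h : Reads x t (g.mid m b))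
    (h' : Reads x t (g.mid m' b')) : m = m' ∧ b = b' := by
  have hK := g.K1_pos
  have hlen : (g.mid m b).length = (g.mid m' b').length := by rw [length_mid hm, length_mid hm']
  cases b <;> cases b'
  · have := h.unique h' hlen
    exact ⟨List.append_cancel_left this, rfl⟩
  · have h1 := mid_false_ct hm h (j := 0) (by omega)
    have h2 := mid_true_ct_zero hm' h'
    simp [h2] at h1
  · have h1 := mid_false_ct hm' h' (j := 0) (by omega)
    have h2 := mid_true_ct_zero hm h
    simp [h2] at h1
  · refine ⟨g.code_inj m hm m' hm' ?_, rfl⟩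
    refine List.ext_getElem (by rw [length_code, length_code]) fun j h1 h2 => ?_
    rw [length_code] at h1
    have h3 := mid_true_ct hm h h1
    have h4 := mid_true_ct hm' h' h1
    rw [h3] at h4
    simpa using h4

variable (g)

/-- `K0` cells with content `01` starting at `q`. -/
def Base (x : ℤ → A) (q : ℤ) : Prop := ∀ j < g.K0, c.ct x (q + (j : ℕ) * c.ℓ) = some (false, true)

/-- The place where the exchange is made. -/
abbrev mpos (q : ℤ) : ℤ := q + g.K0 * c.ℓ

/-- The length of the exchanged words. -/
abbrev mlen : ℕ := (g.K1 + g.d) * c.ℓ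

/-- The beginning of the final word. -/
abbrev zpos (q : ℤ) : ℤ := q + (g.K0 + g.K1) * c.ℓ

/-- The end of the zone controlled by `q`. -/
abbrev epos (q : ℤ) : ℤ := q + (g.K0 + g.K1 + g.d) * c.ℓ

/-- `q` is a potential place for an exchange. -/
def Key (x : ℤ → A) (q : ℤ) : Prop :=
  g.Base x q ∧ (c.ct x (g.mpos q) = some (false, false) ∨
    ((∀ j < g.K1, c.ct x (g.mpos q + (j : ℕ) * c.ℓ) = some (false, true)) ∧
      c.ct x (g.zpos q) = none))

/-- No base starts in the final part. -/
def NoBase (x : ℤ → A) (q : ℤ) : Prop := ∀ s, g.zpos q ≤ s → s < g.epos q → ¬ g.Base x s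

/-- An exchange is to be made at `q`. -/
def Active (x : ℤ → A) (q : ℤ) (m : List A) (b : Bool) : Prop :=
  g.Base x q ∧ m ∈ g.M ∧ Reads x (g.mpos q) (g.mid m b) ∧
    ∀ b', g.NoBase (splice x (g.mpos q) (g.mid m b')) q

/-- `i` is not in the zone of a key. -/
def Unblocked (x : ℤ → A) (i : ℤ) : Prop := ∀ q, g.Key x q → i + c.ℓ ≤ q ∨ g.epos q ≤ i

variable {g}

theorem Active.key (h : g.Active x q m b) : g.Key x q := by
  refine ⟨h.1, ?_⟩
  cases b
  · refine Or.inr ⟨fun j hj => mid_false_ct h.2.1 h.2.2.1 hj, ?_⟩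
    have := mid_false_ct_end h.2.1 h.2.2.1
    convert this using 2; simp only [zpos, mpos]; ring
  · exact Or.inl (mid_true_ct_zero h.2.1 h.2.2.1)

theorem Active.unique (h : g.Active x q m b) (h' : g.Active x q m' b') : m = m' ∧ b = b' :=
  mid_unique h.2.1 h'.2.1 h.2.2.1 h'.2.2.1

theorem exists_vcell_of_ct {b : Bool × Bool} (h : c.ct x i = some b) : ∃ o, c.vcell x i o :=
  ⟨_, ct_eq_some.1 h⟩

theorem Base.reads_p (h : g.Base x q) : Reads x q c.p := by
  have := g.le_K0
  have := ct_eq_some.1 (h 0 (by omega))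
  simpa using this.reads_p

theorem Active.noBase (h : g.Active x q m b) : g.NoBase x q := by
  have := h.2.2.2 b
  rwa [splice_self h.2.2.1] at this

/-- Keys are well separated to the right of active places. -/
theorem Active.le_of_lt (h : g.Active x q m b) {q' : ℤ} (h' : g.Key x q') (hq : q < q') :
    g.epos q ≤ q' := by
  by_contra hcon
  have hℓ : (0 : ℤ) < c.ℓ := by have := c.ℓ_pos; omega
  have hK0 := g.le_K0
  have hd := g.two_le
  have h1 : q' < g.zpos q := by
    by_contra h1
    exact h.noBase q' (by omega) (by omega) h'.1
  have hb := h.1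
  have hr := h.2.2.1
  have hrun : ∀ j < g.K0 + g.K1, ∃ o, c.vcell x (q + (j : ℕ) * c.ℓ) o := by
    intro j hj
    by_cases hj0 : j < g.K0
    · exact exists_vcell_of_ct (hb j hj0)
    · have e : q + (j : ℕ) * (c.ℓ : ℤ) = g.mpos q + ((j - g.K0 : ℕ) : ℤ) * c.ℓ := by
        rw [Nat.cast_sub (by omega)]; simp only [mpos]; ring
      rw [e]
      cases b
      · exact exists_vcell_of_ct (mid_false_ct h.2.1 hr (by omega))
      · exact exists_vcell_of_ct (mid_true_ct h.2.1 hr (by omega))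
  obtain ⟨j, hj, rfl⟩ := exists_of_run hrun h'.1.reads_p hq.le (by simpa [zpos] using h1)
  have hj0 : 0 < j := by
    rcases Nat.eq_zero_or_pos j with rfl | h0
    · simp at hq
    · exact h0
  have cell : ∀ k, k < g.K0 → c.ct x (q + ((j + k : ℕ) : ℤ) * c.ℓ) = some (false, true) := by
    intro k hk
    have := h'.1 k hk
    rw [← this]; congr 1; push_cast; ring
  cases b
  -- Uncoded state: there is no cell at `zpos q`, so the base of `q'` ends there at the latest. What
  -- the key then asks for, a `00` or a further `K1` cells `01`, collides with the cells `01` or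
  -- with the missing cell.
  · have hnone : c.ct x (q + ((g.K0 + g.K1 : ℕ) : ℤ) * c.ℓ) = none := by
      rw [← mid_false_ct_end h.2.1 hr]; congr 1; simp only [mpos]; push_cast; ring
    by_cases hjK : g.K0 + g.K1 < j + g.K0
    · have := cell (g.K0 + g.K1 - j) (by omega)
      rw [show j + (g.K0 + g.K1 - j) = g.K0 + g.K1 by omega, hnone] at this
      simp at this
    · rcases h'.2 with h2 | ⟨h2, h3⟩
      · have e : g.mpos (q + (j : ℤ) * c.ℓ) = g.mpos q + (j : ℤ) * c.ℓ := by
          simp only [mpos]; ring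
        rw [e] at h2
        by_cases hjK' : j < g.K1
        · rw [mid_false_ct h.2.1 hr hjK'] at h2; simp at h2
        · rw [show j = g.K1 by omega, mid_false_ct_end h.2.1 hr] at h2; simp at h2
      · have := h2 (g.K1 - j) (by omega)
        rw [Nat.cast_sub (by omega)] at this
        have e : g.mpos (q + (j : ℤ) * c.ℓ) + ((g.K1 : ℤ) - j) * c.ℓ =
            g.mpos q + (g.K1 : ℤ) * c.ℓ := by simp only [mpos]; ring
        rw [e, mid_false_ct_end h.2.1 hr] at this
        simp at this
  -- Coded state: the base at `q'` would contain the first or the last cell of the code, both of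
  -- which are `00`.
  · by_cases hjK : j ≤ g.K0
    · have := cell (g.K0 - j) (by omega)
      rw [show j + (g.K0 - j) = g.K0 by omega, mid_true_ct_zero h.2.1 hr] at this
      simp at this
    · have := cell (g.K0 + g.K1 - j) (by omega)
      rw [show j + (g.K0 + g.K1 - j) = g.K0 + g.K1 by omega] at this
      have e : q + ((g.K0 + g.K1 : ℕ) : ℤ) * (c.ℓ : ℤ) = g.mpos q + (g.K1 : ℤ) * c.ℓ := by
        simp only [mpos]; push_cast; ring
      rw [e, mid_true_ct_last h.2.1 hr] at this
      simp at this

/-- The cells that a key to the left of an active place refers to do not meet the exchanged word of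
the latter. -/
theorem Active.lt_of_key (h : g.Active x q m b) {q' : ℤ} (h' : g.Key x q') (hq : q' < q) :
    (c.ct x (g.mpos q') = some (false, false) ∧ g.mpos q' < g.mpos q) ∨
    ((∀ j < g.K1, c.ct x (g.mpos q' + (j : ℕ) * c.ℓ) = some (false, true)) ∧
      c.ct x (g.zpos q') = none ∧ g.zpos q' < g.mpos q) := by
  have hℓ : (0 : ℤ) < c.ℓ := by have := c.ℓ_pos; omega
  have hK0 := g.le_K0
  refine h'.2.imp (fun h2 => ⟨h2, by simp only [mpos]; omega⟩) fun ⟨h2, h3⟩ => ⟨h2, h3, ?_⟩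
  by_contra hcon
  have hrun : ∀ j < g.K0 + g.K1, c.ct x (q' + (j : ℕ) * c.ℓ) = some (false, true) := by
    intro j hj
    by_cases hj0 : j < g.K0
    · exact h'.1 j hj0
    · rw [← h2 (j - g.K0) (by omega)]
      congr 1
      rw [Nat.cast_sub (by omega)]; simp only [mpos]; ring
  obtain ⟨j, hj, rfl⟩ := exists_of_run (fun j hj => exists_vcell_of_ct (hrun j hj))
    h.1.reads_p hq.le (by
      simp only [mpos, zpos, not_lt] at hcon
      push_cast
      nlinarith)
  have hj1 : j ≤ g.K1 := by
    simp only [mpos, zpos, not_lt] at hcon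
    have : (j : ℤ) * c.ℓ ≤ g.K1 * c.ℓ := by nlinarith
    exact_mod_cast le_of_mul_le_mul_right this hℓ
  have hj0 : 0 < j := by
    rcases Nat.eq_zero_or_pos j with rfl | h0
    · simp at hq
    · exact h0
  have e : g.mpos (q' + (j : ℤ) * c.ℓ) = q' + ((g.K0 + j : ℕ) : ℤ) * c.ℓ := by
    simp only [mpos]; push_cast; ring
  -- The key at `q'` has cells `01` up to `zpos q'` and no cell there. If `q` is `j` cells further
  -- on with `1 ≤ j ≤ K1`, its exchanged word needs a cell `01` at `zpos q'` or a `00` at `mpos q`,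
  -- and has neither.
  cases b
  · have := mid_false_ct h.2.1 h.2.2.1 (j := g.K1 - j) (by omega)
    rw [e, Nat.cast_sub (by omega)] at this
    have e2 : q' + ((g.K0 + j : ℕ) : ℤ) * (c.ℓ : ℤ) + ((g.K1 : ℤ) - j) * c.ℓ = g.zpos q' := by
      simp only [zpos]; push_cast; ring
    rw [e2, h3] at this
    simp at this
  · have := mid_true_ct_zero h.2.1 h.2.2.1
    rw [e] at this
    by_cases hjK : j < g.K1
    · rw [hrun _ (by omega)] at this; simp at this
    · rw [show j = g.K1 by omega] at this
      have e2 : q' + ((g.K0 + g.K1 : ℕ) : ℤ) * (c.ℓ : ℤ) = g.zpos q' := by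
        simp only [zpos]; push_cast; ring
      rw [e2, h3] at this
      simp at this

end Gadget

end CellSystem

end OneDimShift

namespace OneDimShift

open SymbolicDynamics.FullShift

/-! ### The swap map is a local involution -/

namespace CellSystem

variable {A : Type*} [TopologicalSpace A] {X : Subshift A ℤ} {c : CellSystem X}

/-- Add the left track of a cell to the right track. -/
def addTrack (b : Bool × Bool) : Bool × Bool := (b.1, xor b.2 b.1)

theorem addTrack_addTrack (b : Bool × Bool) : addTrack (addTrack b) = b := by
  rcases b with ⟨_ | _, _ | _⟩ <;> rfl

/-- Cells with `y = 0` are fixed by `addTrack`. Bases and keys refer only to such cells and to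
missing cells, hence survive the addition of tracks. -/
theorem Rel.ct_fix {x x' : ℤ → A} {i : ℤ} {n : ℕ} {Q : ℤ → Prop}
    {C : ℤ → Bool × Bool → Bool × Bool → Prop} (h : c.Rel n x x' Q C)
    (hC : ∀ j b b', C j b b' → b' = addTrack b) (hQ : ∀ t, Q t → i < t ∨ t + n ≤ i)
    (hb : ∀ b, c.ct x i = some b → addTrack b = b) : c.ct x' i = c.ct x i := by
  by_cases hi : ∃ b b', C i b b'
  · obtain ⟨b, b', hi⟩ := hi
    obtain ⟨h1, h2⟩ := h.ct_of_mem hi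
    rw [h1, h2, hC i b b' hi, hb b h1]
  · exact h.ct_of_not hQ fun b b' hbb => hi ⟨b, b', hbb⟩

theorem Rel.ct_01 {x x' : ℤ → A} {i : ℤ} {n : ℕ} {Q : ℤ → Prop}
    {C : ℤ → Bool × Bool → Bool × Bool → Prop} (h : c.Rel n x x' Q C)
    (hC : ∀ j b b', C j b b' → b' = addTrack b) (hQ : ∀ t, Q t → i < t ∨ t + n ≤ i) {z : Bool}
    (hb : c.ct x i = some (false, z)) : c.ct x' i = some (false, z) := by
  rw [h.ct_fix hC hQ, hb]
  intro b h1
  rw [hb] at h1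
  rw [← Option.some.inj h1]
  cases z <;> rfl

theorem Rel.symm_addTrack {C : ℤ → Bool × Bool → Bool × Bool → Prop}
    (hC : ∀ j b b', C j b b' → b' = addTrack b) :
    ∀ j b b', C j b' b → b' = addTrack b := by
  intro j b b' h
  rw [hC j b' b h, addTrack_addTrack]

namespace Gadget

variable {g : c.Gadget} {x x' : ℤ → A} {q t i : ℤ} {m : List A} {b : Bool}

theorem epos_eq (q : ℤ) : g.epos q = g.mpos q + g.mlen := by
  simp only [epos, mpos, mlen]; push_cast; ring

theorem ℓ_le_mlen : c.ℓ ≤ g.mlen := by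
  have := g.K1_pos
  exact Nat.le_mul_of_pos_left _ (by omega)

theorem le_mpos (q : ℤ) : q + c.ℓ ≤ g.mpos q := by
  have := g.le_K0
  have h1 : (1 : ℤ) ≤ g.K0 := by omega
  have : (0 : ℤ) ≤ c.ℓ := by omega
  simp only [mpos]; nlinarith

theorem mpos_le_zpos (q : ℤ) : g.mpos q ≤ g.zpos q := by
  simp only [mpos, zpos]; nlinarith

theorem cell_lt_mpos (q : ℤ) {j : ℕ} (hj : j < g.K0) : q + (j : ℤ) * c.ℓ + c.ℓ ≤ g.mpos q := by
  have h1 : (j : ℤ) + 1 ≤ g.K0 := by omega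
  have : (0 : ℤ) ≤ c.ℓ := by omega
  simp only [mpos]; nlinarith

theorem mcell_lt_zpos (q : ℤ) {j : ℕ} (hj : j < g.K1) :
    g.mpos q + (j : ℤ) * c.ℓ + c.ℓ ≤ g.zpos q := by
  have h1 : (j : ℤ) + 1 ≤ g.K1 := by omega
  have : (0 : ℤ) ≤ c.ℓ := by omega
  simp only [mpos, zpos]; nlinarith

theorem reads_mid_p (h : g.Active x q m b) : Reads x (g.mpos q) c.p :=
  h.2.2.1.of_prefix (pre_mid h.2.1)

variable (g) in
/-- The positions of the words to be exchanged. -/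
def mids (x : ℤ → A) (t : ℤ) : Prop := ∃ q m b, g.Active x q m b ∧ t = g.mpos q

variable (g) in
/-- The cells to be changed. -/
def openCells (x : ℤ → A) (j : ℤ) (b b' : Bool × Bool) : Prop :=
  c.vcell x j (some b) ∧ g.Unblocked x j ∧ b' = addTrack b

variable (g) in
/-- The words to be written. -/
def writes (x : ℤ → A) (i : ℤ) (w : List A) : Prop :=
  (∃ q m b, g.Active x q m b ∧ i = g.mpos q ∧ w = g.mid m !b) ∨
    ∃ b b', g.openCells x i b b' ∧ w = c.V (some b')

variable (g) in
/-- Make all exchanges, and add the left track to the right one on the cells that are not in the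
zone of a key. -/
noncomputable def swap (x : ℤ → A) : ℤ → A := patch x (g.writes x)

theorem Active.mid_le (h : g.Active x q m b) {q' : ℤ} {m' b'} (h' : g.Active x q' m' b')
    (hq : q < q') : g.mpos q + g.mlen ≤ q' := by
  rw [← epos_eq]; exact h.le_of_lt h'.key hq

/-- Active places have disjoint zones by `Active.le_of_lt`, and the cells to be changed lie outside
all zones of keys. -/
theorem compatible_writes (x : ℤ → A) : Compatible (g.writes x) := by
  have hℓ := g.le_mpos
  have key : ∀ q m b j d d' k, g.Active x q m b → g.openCells x j d d' → g.mpos q ≤ k →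
      k < g.mpos q + g.mlen → j ≤ k → k < j + c.ℓ → False := by
    intro q m b j d d' k h h' h1 h2 h3 h4
    have h5 := h'.2.1 q h.key
    have := hℓ q
    rw [epos_eq] at h5
    omega
  rintro i w i' w' k (⟨q, m, b, h, rfl, rfl⟩ | ⟨b, b', h, rfl⟩)
    (⟨q', m', b', h', rfl, rfl⟩ | ⟨d, d', h', rfl⟩) h1 h2 h3 h4
  · rw [length_mid h.2.1] at h2
    rw [length_mid h'.2.1] at h4
    change k < g.mpos q + g.mlen at h2
    change k < g.mpos q' + g.mlen at h4
    rcases lt_trichotomy q q' with hq | rfl | hq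
    · have h5 := h.mid_le h' hq
      have := hℓ q'
      exfalso; omega
    · obtain ⟨rfl, rfl⟩ := h.unique h'
      exact ⟨rfl, rfl⟩
    · have h5 := h'.mid_le h hq
      have := hℓ q
      exfalso; omega
  · rw [length_mid h.2.1] at h2
    rw [c.len_V] at h4
    exact (key _ _ _ _ _ _ k h h' h1 h2 h3 h4).elim
  · rw [length_mid h'.2.1] at h4
    rw [c.len_V] at h2
    exact (key _ _ _ _ _ _ k h' h h3 h4 h1 h2).elim
  · rw [c.len_V] at h2 h4
    obtain rfl := h.1.eq_of_overlap h'.1 h1 h2 h3 h4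
    obtain rfl : b = d := Option.some.inj (h.1.unique h'.1)
    rw [h.2.2, h'.2.2]
    exact ⟨rfl, rfl⟩

theorem Active.reads_swap (h : g.Active x q m b) : Reads (g.swap x) (g.mpos q) (g.mid m !b) :=
  reads_patch (compatible_writes x) (Or.inl ⟨q, m, b, h, rfl, rfl⟩)

theorem reads_swap_cell {b b'} (h : g.openCells x i b b') : Reads (g.swap x) i (c.V (some b')) :=
  reads_patch (compatible_writes x) (Or.inr ⟨b, b', h, rfl⟩)

theorem rel_swap (x : ℤ → A) : c.Rel g.mlen x (g.swap x) (g.mids x) (g.openCells x) where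
  mid := by
    rintro t ⟨q, m, b, h, rfl⟩
    exact ⟨reads_mid_p h, h.reads_swap.of_prefix (pre_mid h.2.1)⟩
  cell j b b' h := ⟨h.1, reads_swap_cell h⟩
  free := by
    rintro j b b' t h ⟨q, m, d, h', rfl⟩
    have h1 := h.2.1 q h'.key
    have h2 := g.le_mpos q
    have := c.ℓ_pos
    rw [epos_eq] at h1
    omega
  same := by
    intro k h1 h2
    refine (patch_of_not ?_).symm
    rintro i w (⟨q, m, b, h, rfl, rfl⟩ | ⟨b, b', h, rfl⟩) h3 h4
    · rw [length_mid h.2.1] at h4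
      have := h1 _ ⟨q, m, b, h, rfl⟩
      simp only [mlen] at this
      omega
    · rw [c.len_V] at h4
      have := h2 i b b' h
      omega

theorem openCells_addTrack : ∀ j b b', g.openCells x j b b' → b' = addTrack b :=
  fun _ _ _ h => h.2.2

section Transfer

variable {Q : ℤ → Prop} {C : ℤ → Bool × Bool → Bool × Bool → Prop}

theorem base_transfer (h : c.Rel g.mlen x x' Q C) (hC : ∀ j b b', C j b b' → b' = addTrack b)
    {s : ℤ} (hQ : ∀ t, Q t → g.mpos s ≤ t ∨ t + g.mlen ≤ s) (hs : g.Base x s) : g.Base x' s := by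
  intro j hj
  refine h.ct_01 hC (fun t ht => ?_) (hs j hj)
  have h1 := hQ t ht
  have h2 := g.cell_lt_mpos s hj
  have h3 : (0 : ℤ) ≤ (j : ℤ) * c.ℓ := by positivity
  have := c.ℓ_pos
  omega

theorem noBase_transfer (h : c.Rel g.mlen x x' Q C) (hC : ∀ j b b', C j b b' → b' = addTrack b)
    (hQ : ∀ t, Q t → ∃ q', t = g.mpos q' ∧ (g.epos q' ≤ q ∨ g.epos q ≤ q')) (hq : g.NoBase x q) :
    g.NoBase x' q := by
  intro s h1 h2 hs
  refine hq s h1 h2 (base_transfer h.symm (Rel.symm_addTrack hC) (fun t ht => ?_) hs)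
  obtain ⟨q', rfl, h3⟩ := hQ t ht
  have h4 := g.mpos_le_zpos q
  have h5 := g.le_mpos q
  rw [epos_eq q'] at h3
  rcases h3 with h3 | h3
  · right; omega
  · left; simp only [mpos]; omega

/-- Exchanges on the left end before the key begins, by `Active.le_of_lt`; exchanges on the right
start after everything the key looks at, by `Active.lt_of_key`. -/
theorem key_transfer (h : c.Rel g.mlen x x' Q C) (hC : ∀ j b b', C j b b' → b' = addTrack b)
    (hQ : ∀ t, Q t → ∃ q' m b, g.Active x q' m b ∧ t = g.mpos q' ∧ q' ≠ q) (hq : g.Key x q) :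
    g.Key x' q := by
  have hℓ := c.ℓ_pos
  have hm := g.le_mpos q
  have hmz := g.mpos_le_zpos q
  refine ⟨base_transfer h hC (fun t ht => ?_) hq.1, ?_⟩
  · obtain ⟨q', m, b, h1, rfl, hne⟩ := hQ t ht
    rcases lt_or_gt_of_ne hne with h2 | h2
    · have := h1.le_of_lt hq h2
      rw [epos_eq] at this; right; omega
    · left; simp only [mpos]; omega
  · rcases hq.2 with h1 | ⟨h1, h2⟩
    · left
      refine h.ct_01 hC (fun t ht => ?_) h1
      obtain ⟨q', m, b, h1, rfl, hne⟩ := hQ t ht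
      rcases lt_or_gt_of_ne hne with h2 | h2
      · have := h1.le_of_lt hq h2
        rw [epos_eq] at this; right; omega
      · left; simp only [mpos]; omega
    · right
      have hz : ∀ t, Q t → g.zpos q < t ∨ t + g.mlen ≤ q := by
        intro t ht
        obtain ⟨q', m, b, h3, rfl, hne⟩ := hQ t ht
        rcases lt_or_gt_of_ne hne with h4 | h4
        · have := h3.le_of_lt hq h4
          rw [epos_eq] at this; right; omega
        · left
          rcases h3.lt_of_key hq h4 with ⟨h5, -⟩ | ⟨-, -, h5⟩
          · have := h1 0 g.K1_pos
            simp only [Nat.cast_zero, zero_mul, add_zero] at this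
            rw [h5] at this
            simp at this
          · exact h5
      refine ⟨fun j hj => h.ct_01 hC (fun t ht => ?_) (h1 j hj), ?_⟩
      · have h3 := hz t ht
        have h4 := g.mcell_lt_zpos q hj
        have h5 : (0 : ℤ) ≤ (j : ℤ) * c.ℓ := by positivity
        omega
      · rw [h.ct_fix hC (fun t ht => ?_) (by simp [h2]), h2]
        have h3 := hz t ht
        omega

end Transfer

/-- The absence of bases is required for both replacement words and is therefore unaffected by the
exchange at `q`. Other exchanges do not meet a base starting in the final part: one further right
begins `K0` cells after a place at or beyond `epos q`. -/
theorem Active.swap (h : g.Active x q m b) : g.Active (g.swap x) q m (!b) := by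
  have hℓ := c.ℓ_pos
  have hsep : ∀ t, g.mids x t → t ≠ g.mpos q →
      ∃ q', t = g.mpos q' ∧ (g.epos q' ≤ q ∨ g.epos q ≤ q') := by
    rintro t ⟨q', m', b', h', rfl⟩ hne
    refine ⟨q', rfl, ?_⟩
    rcases lt_trichotomy q' q with h2 | rfl | h2
    · exact Or.inl (h'.le_of_lt h.key h2)
    · exact absurd rfl hne
    · exact Or.inr (h.le_of_lt h'.key h2)
  refine ⟨fun j hj => ?_, h.2.1, h.reads_swap, fun b' => ?_⟩
  · refine (rel_swap x).ct_01 openCells_addTrack (fun t ht => ?_) (h.1 j hj)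
    have h2 := g.cell_lt_mpos q hj
    have h3 : (0 : ℤ) ≤ (j : ℤ) * c.ℓ := by positivity
    by_cases hne : t = g.mpos q
    · omega
    · obtain ⟨q', rfl, h4⟩ := hsep t ht hne
      have := g.le_mpos q'
      rw [epos_eq, epos_eq] at h4
      omega
  · have hr := (rel_swap x).splice (t0 := g.mpos q) (w := g.mid m b') (reads_mid_p h)
      (h.reads_swap.of_prefix (pre_mid h.2.1)) (pre_mid h.2.1) (length_mid h.2.1) ?_ ?_ g.ℓ_le_mlen
    · refine noBase_transfer hr openCells_addTrack ?_ (h.2.2.2 b')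
      rintro t ⟨ht, hne⟩
      exact hsep t ht hne
    · intro t ht hne
      obtain ⟨q', rfl, h4⟩ := hsep t ht hne
      have := g.le_mpos q'
      have := g.le_mpos q
      rw [epos_eq, epos_eq] at h4
      omega
    · intro j d d' hj
      have h1 := hj.2.1 q h.key
      have := g.le_mpos q
      rw [epos_eq] at h1
      omega

theorem Key.swap (h : g.Key x q) : g.Key (g.swap x) q := by
  by_cases ha : ∃ m b, g.Active x q m b
  · obtain ⟨m, b, ha⟩ := ha
    exact ha.swap.key
  · refine key_transfer (rel_swap x) openCells_addTrack ?_ h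
    rintro t ⟨q', m, b, h', rfl⟩
    exact ⟨q', m, b, h', rfl, by rintro rfl; exact ha ⟨m, b, h'⟩⟩

theorem key_of_swap (h : g.Key (g.swap x) q) : g.Key x q := by
  by_cases ha : ∃ m b, g.Active x q m b
  · obtain ⟨m, b, ha⟩ := ha
    exact ha.key
  · refine key_transfer (rel_swap x).symm (Rel.symm_addTrack openCells_addTrack) ?_ h
    rintro t ⟨q', m, b, h', rfl⟩
    exact ⟨q', m, !b, h'.swap, rfl, by rintro rfl; exact ha ⟨m, b, h'⟩⟩

theorem key_swap_iff : g.Key (g.swap x) q ↔ g.Key x q := ⟨key_of_swap, Key.swap⟩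

theorem unblocked_swap_iff : g.Unblocked (g.swap x) i ↔ g.Unblocked x i := by
  simp only [Unblocked, key_swap_iff]

/-- No new active places arise: if nothing were exchanged at `q`, the word there would be unchanged
and `q` would have been active already. -/
theorem active_of_swap (h : g.Active (g.swap x) q m b) : g.Active x q m (!b) := by
  have hℓ := c.ℓ_pos
  by_cases ha : ∃ m b, g.Active x q m b
  · obtain ⟨m', b', ha⟩ := ha
    obtain ⟨rfl, rfl⟩ := ha.swap.unique h
    simpa using ha
  · exfalso
    have hk := key_of_swap h.key
    have hsep : ∀ t, g.mids x t → ∃ q', t = g.mpos q' ∧ (g.epos q' ≤ q ∨ g.epos q ≤ q') := by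
      rintro t ⟨q', m', b', h', rfl⟩
      refine ⟨q', rfl, ?_⟩
      rcases lt_trichotomy q' q with h2 | rfl | h2
      · exact Or.inl (h'.le_of_lt hk h2)
      · exact absurd ⟨_, _, h'⟩ ha
      · exact Or.inr (h.le_of_lt h'.swap.key h2)
    have hreads : Reads x (g.mpos q) (g.mid m b) := by
      refine h.2.2.1.congr fun k h1 h2 => ?_
      rw [length_mid h.2.1] at h2
      refine ((rel_swap x).same k (fun t ht => ?_) fun j d d' hj => ?_).symm
      · obtain ⟨q', rfl, h4⟩ := hsep t ht
        have := g.le_mpos q'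
        have := g.le_mpos q
        rw [epos_eq, epos_eq] at h4
        simp only [mlen] at *
        omega
      · have h3 := hj.2.1 q hk
        have := g.le_mpos q
        rw [epos_eq] at h3
        simp only [mlen] at *
        omega
    have hact : g.Active x q m b := by
      refine ⟨hk.1, h.2.1, hreads, fun b' => ?_⟩
      have hr := (rel_swap x).symm.splice (t0 := g.mpos q) (w := g.mid m b') (reads_mid_p h)
        (hreads.of_prefix (pre_mid h.2.1)) (pre_mid h.2.1) (length_mid h.2.1) ?_ ?_ g.ℓ_le_mlen
      · refine noBase_transfer hr (Rel.symm_addTrack openCells_addTrack) ?_ (h.2.2.2 b')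
        rintro t ⟨ht, -⟩
        exact hsep t ht
      · intro t ht hne
        obtain ⟨q', rfl, h4⟩ := hsep t ht
        have := g.le_mpos q'
        have := g.le_mpos q
        rw [epos_eq, epos_eq] at h4
        omega
      · intro j d d' hj
        have h1 := hj.2.1 q hk
        have := g.le_mpos q
        rw [epos_eq] at h1
        omega
    exact ha ⟨m, b, hact⟩

theorem openCells_swap {b b'} (h : g.openCells x i b b') : g.openCells (g.swap x) i b' b :=
  ⟨(rel_swap x).vcell' h, unblocked_swap_iff.2 h.2.1, by rw [h.2.2, addTrack_addTrack]⟩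

theorem openCells_of_swap {b b'} (h : g.openCells (g.swap x) i b b') : g.openCells x i b' b := by
  have hu := unblocked_swap_iff.1 h.2.1
  have hℓ := c.ℓ_pos
  by_cases hi : ∃ d d', g.openCells x i d d'
  · obtain ⟨d, d', hd⟩ := hi
    obtain rfl : d' = b := Option.some.inj (((rel_swap x).vcell' hd).unique h.1)
    rw [h.2.2, hd.2.2, addTrack_addTrack]
    rw [hd.2.2] at hd
    exact hd
  · exfalso
    have := (rel_swap x).symm.vcell_of_not h.1 (by
      rintro t ⟨q, m, d, h', rfl⟩
      have h1 := hu q h'.key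
      have := g.le_mpos q
      rw [epos_eq] at h1
      omega) fun d d' hd => hi ⟨d', d, hd⟩
    exact hi ⟨b, addTrack b, this, hu, rfl⟩

/-- The places of exchange and the cells to be changed are the same for both applications, and each
local change is an involution. -/
theorem swap_swap (x : ℤ → A) : g.swap (g.swap x) = x := by
  funext k
  by_cases h1 : ∃ q m b, g.Active x q m b ∧ g.mpos q ≤ k ∧ k < g.mpos q + g.mlen
  · obtain ⟨q, m, b, h, h1, h2⟩ := h1
    have h3 := h.swap.reads_swap
    rw [Bool.not_not] at h3
    exact h3.eq_of h.2.2.1 h1 (by rw [length_mid h.2.1]; exact h2)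
  · by_cases h2 : ∃ j b b', g.openCells x j b b' ∧ j ≤ k ∧ k < j + c.ℓ
    · obtain ⟨j, b, b', h, h2, h3⟩ := h2
      exact (reads_swap_cell (openCells_swap h)).eq_of h.1.reads h2 (by rw [c.len_V]; exact h3)
    · push Not at h1 h2
      rw [← (rel_swap (g.swap x)).same k, ← (rel_swap x).same k]
      · rintro t ⟨q, m, b, h, rfl⟩
        have := h1 q m b h; omega
      · intro j b b' h
        have := h2 j b b' h; omega
      · rintro t ⟨q, m, b, h, rfl⟩
        have := h1 q m _ (active_of_swap h); omega
      · intro j b b' h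
        have := h2 j b' b (openCells_of_swap h); omega

theorem swap_mem (hx : x ∈ X.carrier) : g.swap x ∈ X.carrier := by
  refine patch_mem hx (compatible_writes x) ?_ ?_ (B := g.mlen) ?_
  · rintro i w (⟨q, m, b, h, rfl, rfl⟩ | ⟨b, b', h, rfl⟩)
    · exact ⟨_, h.2.2.1, exch_mid h.2.1⟩
    · exact ⟨_, h.1.reads, exch_V _ _⟩
  · rintro i w (⟨q, m, b, h, rfl, rfl⟩ | ⟨b, b', h, rfl⟩)
    · have h1 := length_mid (b := !b) h.2.1
      have := g.ℓ_le_mlen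
      have := c.ℓ_pos
      exact List.ne_nil_of_length_pos (by rw [h1]; simp only [mlen] at *; omega)
    · exact V_ne_nil _
  · rintro i w (⟨q, m, b, h, rfl, rfl⟩ | ⟨b, b', h, rfl⟩)
    · exact (length_mid h.2.1).le
    · rw [c.len_V]; exact g.ℓ_le_mlen

theorem localFn_base : LocalFn (g.Base) := by
  have : LocalFn fun (x : ℤ → A) i => ∀ j : Fin g.K0,
      c.ct x (i + ((j : ℕ) : ℤ) * c.ℓ) = some (false, true) :=
    LocalFn.forall_fin fun j => (localFn_ct.translate _).map fun o => o = some (false, true)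
  simp only [Fin.forall_iff] at this
  exact this

theorem localFn_key : LocalFn (g.Key) := by
  have h1 : LocalFn fun (x : ℤ → A) i => ∀ j : Fin g.K1,
      c.ct x (i + g.K0 * c.ℓ + ((j : ℕ) : ℤ) * c.ℓ) = some (false, true) :=
    LocalFn.forall_fin fun j => by
      simpa only [add_assoc] using (localFn_ct (c := c).translate _).map
        fun o => o = some (false, true)
  have h2 := (localFn_ct (c := c).translate (g.K0 * c.ℓ)).map fun o => o = some (false, false)
  have h3 := (localFn_ct (c := c).translate ((g.K0 + g.K1) * c.ℓ)).map fun o => o = none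
  have := (localFn_base (g := g)).and (h2.or (h1.and h3))
  simp only [Fin.forall_iff] at this
  exact this

theorem localFn_noBase : LocalFn (g.NoBase) := by
  have h1 : LocalFn fun (x : ℤ → A) i => ∀ j : Fin (g.d * c.ℓ),
      ¬ g.Base x (i + ((g.K0 + g.K1) * c.ℓ + ((j : ℕ) : ℤ))) :=
    LocalFn.forall_fin fun j => (localFn_base.translate _).not
  convert h1 using 3 with x i
  simp only [NoBase]
  constructor
  · rintro h ⟨j, hj⟩
    rw [← add_assoc]
    refine h _ (by simp [zpos]) ?_
    simp only [epos]
    have : (j : ℤ) < g.d * c.ℓ := by exact_mod_cast hj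
    linarith
  · intro h s h2 h3
    have h4 : ((s - g.zpos i).toNat : ℤ) = s - g.zpos i := Int.toNat_of_nonneg (by omega)
    have := h ⟨(s - g.zpos i).toNat, by
      zify; rw [h4]; simp only [zpos, epos] at *; linarith⟩
    rwa [h4, show i + ((g.K0 + g.K1) * c.ℓ + (s - g.zpos i)) = s by simp only [zpos]; ring] at this

theorem finite_M [Finite A] : g.M.Finite :=
  (List.finite_length_eq A (g.d * c.ℓ)).subset fun _ hm => hm.2.1

theorem localFn_active (m : List A) (b : Bool) : LocalFn fun x q => g.Active x q m b := by
  have h1 := (localFn_reads (g.mid m b)).translate (g.K0 * c.ℓ)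
  have h2 : LocalFn fun x q => ∀ b', g.NoBase (splice x (g.mpos q) (g.mid m b')) q :=
    LocalFn.forall_fin fun b' => localFn_noBase.splice _ _
  exact localFn_base.and (((LocalFn.const (m ∈ g.M)).and (h1.and h2)))

theorem localFn_unblocked : LocalFn (g.Unblocked) := by
  -- The keys that can block `i` satisfy `i - (K0 + K1 + d) * ℓ < q < i + ℓ`; they are listed as `q
  -- = i + ℓ - 1 - j`.
  have h1 : LocalFn fun (x : ℤ → A) i => ∀ j : Fin ((g.K0 + g.K1 + g.d) * c.ℓ + c.ℓ - 1),
      ¬ g.Key x (i + (c.ℓ - 1 - ((j : ℕ) : ℤ))) :=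
    LocalFn.forall_fin fun j => (localFn_key.translate _).not
  convert h1 using 3 with x i
  simp only [Unblocked]
  constructor
  · rintro h ⟨j, hj⟩ hk
    have := h _ hk
    have hj0 : j + 1 < (g.K0 + g.K1 + g.d) * c.ℓ + c.ℓ := by omega
    have hj' : (j : ℤ) + 1 < (g.K0 + g.K1 + g.d) * c.ℓ + c.ℓ := by exact_mod_cast hj0
    simp only [epos] at this
    rcases this with h1 | h1 <;> linarith [Int.natCast_nonneg j]
  · intro h q hq
    by_contra hcon
    push Not at hcon
    have h4 : ((i + c.ℓ - 1 - q).toNat : ℤ) = i + c.ℓ - 1 - q := Int.toNat_of_nonneg (by omega)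
    refine h ⟨(i + c.ℓ - 1 - q).toNat, ?_⟩ ?_
    · refine Nat.lt_sub_of_add_lt ?_
      zify; rw [h4]; simp only [epos] at *; linarith
    · simp only [h4]
      convert hq using 1; ring

theorem localFn_swap [Finite A] : LocalFn (g.swap) := by
  have : Finite g.M := g.finite_M
  refine LocalFn.patch (P := g.writes) ?_ compatible_writes (B := g.mlen) ?_
  · have h1 : LocalFn fun (x : ℤ → A) i (mb : g.M × Bool) =>
        g.Active x (i + (-(g.K0 * c.ℓ))) mb.1 mb.2 :=
      LocalFn.pi fun mb => (localFn_active _ _).translate _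
    have h2 := (localFn_ct (c := c)).map₂ (localFn_unblocked (g := g)) Prod.mk
    have h3 := h1.map₂ h2 fun f p (w : List A) => (∃ mb : g.M × Bool, f mb ∧ w = g.mid mb.1 !mb.2) ∨
      ∃ b b', (p.1 = some b ∧ p.2 ∧ b' = addTrack b) ∧ w = c.V (some b')
    convert h3 using 3 with x i
    funext w
    simp only [ct_eq_some, writes, openCells]
    refine congrArg₂ Or (propext ⟨?_, ?_⟩) rfl
    · rintro ⟨q, m, b, h, rfl, rfl⟩
      refine ⟨(⟨m, h.2.1⟩, b), ?_, rfl⟩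
      convert h using 1; simp only [mpos]; ring
    · rintro ⟨⟨⟨m, hm⟩, b⟩, h, rfl⟩
      exact ⟨_, m, b, h, by simp only [mpos]; ring, rfl⟩
  · rintro x i w (⟨q, m, b, h, rfl, rfl⟩ | ⟨b, b', h, rfl⟩)
    · exact (length_mid h.2.1).le
    · rw [c.len_V]; exact g.ℓ_le_mlen

end Gadget

end CellSystem

end OneDimShift

/-! ### Shifts, points made of cells, and commuting maps -/

namespace OneDimShift

open SymbolicDynamics.FullShift

/-- Translation of configurations. -/
def sh {A : Type*} (n : ℤ) (x : ℤ → A) : ℤ → A := fun k => x (n + k)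

section Sh

variable {A β : Type*}

theorem LocalFn.sh {f : (ℤ → A) → ℤ → β} (hf : LocalFn f) (n : ℤ) (x : ℤ → A) (i : ℤ) :
    f (sh n x) i = f x (n + i) := by
  obtain ⟨R, hR⟩ := hf
  refine hR _ _ _ _ fun k _ _ => ?_
  simp [OneDimShift.sh, add_assoc]

theorem LocalFn.comm_sh {f : (ℤ → A) → (ℤ → A)} (hf : LocalFn f) (n : ℤ) (x : ℤ → A) :
    f (OneDimShift.sh n x) = OneDimShift.sh n (f x) := funext fun i => hf.sh n x i

theorem sh_sh (m n : ℤ) (x : ℤ → A) : sh m (sh n x) = sh (n + m) x := by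
  funext k; simp [sh, add_assoc]

theorem sh_zero (x : ℤ → A) : sh 0 x = x := by
  funext k; simp [sh]

theorem sh_mem [TopologicalSpace A] {X : Subshift A ℤ} {x : ℤ → A} (hx : x ∈ X.carrier) (n : ℤ) :
    sh n x ∈ X.carrier := shift_mem hx n

end Sh

section Aut

variable {A : Type*} [TopologicalSpace A] [Finite A] [DiscreteTopology A] {X : Subshift A ℤ}

omit [Finite A] [DiscreteTopology A] in
theorem isCellularAutomaton_of_localFn {f : (ℤ → A) → (ℤ → A)} (hf : LocalFn f)
    (F : X.carrier → X.carrier) (h : ∀ x, (F x).1 = f x.1) : IsCellularAutomaton X F := by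
  classical
  obtain ⟨R, hR⟩ := hf
  refine ⟨-R, R, by omega, fun w => f (fun k => if hk : k ∈ Set.Icc (-(R : ℤ)) R then w ⟨k, hk⟩
    else w ⟨0, by simp⟩) 0, fun x i => ?_⟩
  rw [h]
  refine hR _ _ _ _ fun k h1 h2 => ?_
  rw [zero_add, dif_pos ⟨h1, h2⟩]

/-- The automorphism given by mutually inverse local maps. -/
def autOfLocal (f f' : (ℤ → A) → (ℤ → A)) (hf : LocalFn f)
    (hm : ∀ x ∈ X.carrier, f x ∈ X.carrier) (hm' : ∀ x ∈ X.carrier, f' x ∈ X.carrier)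
    (h1 : ∀ x, f' (f x) = x) (h2 : ∀ x, f (f' x) = x) : Aut X :=
  ⟨{ toFun := fun x => ⟨f x.1, hm _ x.2⟩
     invFun := fun x => ⟨f' x.1, hm' _ x.2⟩
     left_inv := fun x => Subtype.ext (h1 x.1)
     right_inv := fun x => Subtype.ext (h2 x.1) },
    isCellularAutomaton_of_localFn hf _ fun _ => rfl⟩

end Aut

namespace CellSystem

variable {A : Type*} [TopologicalSpace A] {X : Subshift A ℤ} (c : CellSystem X)

/-- The point consisting of the words `V (f j)`. -/
def ptf (f : ℤ → Option (Bool × Bool)) : ℤ → A := fun k =>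
  (c.V (f (k / c.ℓ)))[(k % c.ℓ).toNat]'(by
    have := c.ℓ_pos
    have h1 := Int.emod_nonneg k (b := (c.ℓ : ℤ)) (by omega)
    have h2 := Int.emod_lt_of_pos k (b := (c.ℓ : ℤ)) (by omega)
    rw [c.len_V]; omega)

/-- The point consisting of cells with given contents. -/
abbrev pt (y z : ℤ → Bool) : ℤ → A := c.ptf fun j => some (y j, z j)

variable {c} {f f' : ℤ → Option (Bool × Bool)} {x x' : ℤ → A}

theorem ptf_congr {k : ℤ} (h : f (k / c.ℓ) = f' (k / c.ℓ)) : c.ptf f k = c.ptf f' k := by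
  simp only [ptf, h]

theorem div_of_cell {j k : ℤ} (h1 : j * c.ℓ ≤ k) (h2 : k < j * c.ℓ + c.ℓ) : k / c.ℓ = j := by
  have := c.ℓ_pos
  rw [Int.ediv_eq_iff_of_pos (by omega)]
  constructor <;> linarith

theorem reads_ptf (f : ℤ → Option (Bool × Bool)) (j : ℤ) : Reads (c.ptf f) (j * c.ℓ) (c.V (f j)) := by
  intro k hk
  rw [c.len_V] at hk
  have h1 : (j * c.ℓ + k) / c.ℓ = j := div_of_cell (by omega) (by omega)
  have h2 : (j * c.ℓ + (k : ℤ)) % c.ℓ = k := by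
    have := Int.emod_add_mul_ediv (j * c.ℓ + (k : ℤ)) c.ℓ
    rw [h1] at this; linarith
  simp only [ptf, h1, h2]
  simp

theorem vcell_ptf (f : ℤ → Option (Bool × Bool)) (j : ℤ) : c.vcell (c.ptf f) (j * c.ℓ) (f j) := by
  refine vcell_iff.2 ⟨reads_ptf f j, ?_⟩
  have := (reads_ptf (c := c) f (j + 1)).of_prefix (c.pre _)
  rwa [add_mul, one_mul] at this

theorem eq_ptf (h : ∀ j : ℤ, Reads x (j * c.ℓ) (c.V (f j))) : x = c.ptf f := by
  funext k
  have hℓ := c.ℓ_pos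
  have h1 := Int.emod_nonneg k (b := (c.ℓ : ℤ)) (by omega)
  have h2 := Int.emod_lt_of_pos k (b := (c.ℓ : ℤ)) (by omega)
  have h3 := Int.emod_add_mul_ediv k c.ℓ
  refine (h (k / c.ℓ)).eq_of (reads_ptf f (k / c.ℓ)) ?_ ?_
  · linarith
  · rw [c.len_V]; linarith

theorem eq_pt_of_ct {y z : ℤ → Bool} (h : ∀ j : ℤ, c.ct x (j * c.ℓ) = some (y j, z j)) :
    x = c.pt y z := eq_ptf fun j => (ct_eq_some.1 (h j)).reads

theorem ct_ptf (f : ℤ → Option (Bool × Bool)) (j : ℤ) : c.ct (c.ptf f) (j * c.ℓ) = f j := by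
  have h := vcell_ptf (c := c) f j
  cases hf : f j with
  | none => rw [hf] at h; exact h.ct_none
  | some b => rw [hf] at h; exact ct_eq_some.2 h

theorem exists_of_vcell_ptf {i : ℤ} {o : Option (Bool × Bool)} (h : c.vcell (c.ptf f) i o) :
    ∃ j : ℤ, i = j * c.ℓ := by
  have hℓ := c.ℓ_pos
  have h1 := Int.emod_nonneg i (b := (c.ℓ : ℤ)) (by omega)
  have h2 := Int.emod_lt_of_pos i (b := (c.ℓ : ℤ)) (by omega)
  have h3 := Int.emod_add_mul_ediv i c.ℓ
  refine ⟨i / c.ℓ, h.eq_of_overlap (vcell_ptf f (i / c.ℓ)) (k := i) le_rfl (by omega) ?_ ?_⟩ <;>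
    linarith

theorem ct_ptf_none {i : ℤ} (h : ∀ j : ℤ, i ≠ j * c.ℓ) : c.ct (c.ptf f) i = none := by
  rw [ct_eq_none]
  intro b hb
  obtain ⟨j, hj⟩ := exists_of_vcell_ptf hb
  exact h j hj

theorem pt_inj {y z y' z' : ℤ → Bool} (h : c.pt y z = c.pt y' z') : y = y' ∧ z = z' := by
  have h1 : ∀ j, (y j, z j) = (y' j, z' j) := fun j => by
    have h2 := ct_ptf (c := c) (fun j => some (y j, z j)) j
    have h3 := ct_ptf (c := c) (fun j => some (y' j, z' j)) j
    change c.ct (c.pt y z) _ = _ at h2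
    rw [h, h3] at h2
    exact (Option.some.inj h2).symm
  exact ⟨funext fun j => congrArg Prod.fst (h1 j), funext fun j => congrArg Prod.snd (h1 j)⟩

theorem ptf_mem (f : ℤ → Option (Bool × Bool)) : c.ptf f ∈ X.carrier := by
  refine mem_of_windows fun n => ?_
  let os : List (Option (Bool × Bool)) := List.ofFn fun k : Fin (2 * n + 1) => f (-n + (k : ℕ))
  have hl : os.length = 2 * n + 1 := by simp [os]
  have hr : Reads (c.ptf f) (-n * c.ℓ) (c.word os ++ c.p) := by
    refine reads_word_of ?_ fun j hj => ?_
    · rw [← add_mul]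
      exact (reads_ptf f _).of_prefix (c.pre _)
    · rw [← add_mul]
      simp only [os, List.getElem_ofFn]
      exact reads_ptf f (-n + j)
  obtain ⟨y, hy, hy2⟩ := exists_reads (c.word_mem os) (-n * c.ℓ)
  have hℓ : (1 : ℤ) ≤ c.ℓ := by have := c.ℓ_pos; omega
  refine ⟨y, hy, fun k h1 h2 => hr.left.eq_of hy2.left ?_ ?_⟩
  · nlinarith
  · rw [length_word, hl]; push_cast; nlinarith

theorem sh_ptf (n : ℤ) (f : ℤ → Option (Bool × Bool)) :
    sh (n * c.ℓ) (c.ptf f) = c.ptf fun j => f (n + j) := by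
  refine eq_ptf fun j k hk => ?_
  rw [← reads_ptf f (n + j) k hk, sh]
  congr 1; ring

theorem ct_sh (n : ℤ) (x : ℤ → A) (i : ℤ) : c.ct (sh n x) i = c.ct x (n + i) := localFn_ct.sh n x i

theorem belt_sh (n : ℤ) (x : ℤ → A) : c.belt (sh n x) = sh n (c.belt x) :=
  (localFn_cellMap beltRule).comm_sh n x

theorem ct_belt (x : ℤ → A) (i : ℤ) : c.ct (c.belt x) i = (c.ct x i).map fun b =>
    ((c.ct x (i - c.ℓ)).elim b.2 Prod.fst, (c.ct x (i + c.ℓ)).elim (!b.1) Prod.snd) :=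
  ct_cellMap beltRule x i

theorem belt_mem (hx : x ∈ X.carrier) : c.belt x ∈ X.carrier := cellMap_mem _ hx

theorem belt_injective : Function.Injective c.belt :=
  Function.LeftInverse.injective beltInv_belt

theorem belt_iter_mem (hx : x ∈ X.carrier) (n : ℕ) : c.belt^[n] x ∈ X.carrier := by
  induction n with
  | zero => exact hx
  | succ n ih => rw [Function.iterate_succ_apply']; exact belt_mem ih

/-- A bi-infinite run has no ends, so the tracks just move in opposite directions. -/
theorem belt_pt (y z : ℤ → Bool) : c.belt (c.pt y z) = c.pt (fun j => y (j - 1)) fun j => z (j + 1) := by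
  refine eq_pt_of_ct fun j => ?_
  have e1 : j * (c.ℓ : ℤ) - c.ℓ = (j - 1) * c.ℓ := by ring
  have e2 : j * (c.ℓ : ℤ) + c.ℓ = (j + 1) * c.ℓ := by ring
  rw [ct_belt, e1, e2, ct_ptf, ct_ptf, ct_ptf]
  rfl

theorem belt_iter_pt (n : ℕ) (y z : ℤ → Bool) :
    c.belt^[n] (c.pt y z) = c.pt (fun j => y (j - n)) fun j => z (j + n) := by
  induction n with
  | zero => simp
  | succ n ih =>
    rw [Function.iterate_succ_apply', ih, belt_pt]
    have e1 : ∀ j : ℤ, j - 1 - (n : ℤ) = j - (n + 1 : ℕ) := fun j => by push_cast; ring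
    have e2 : ∀ j : ℤ, j + 1 + (n : ℤ) = j + (n + 1 : ℕ) := fun j => by push_cast; ring
    simp only [e1, e2]

theorem ct_congr {i i' : ℤ} (h : ∀ k : ℤ, 0 ≤ k → k < 2 * c.ℓ → x (i + k) = x' (i' + k)) :
    c.ct x i = c.ct x' i' := by
  have hp := c.length_p
  refine ct_eq_iff fun b => ⟨fun hb k hk => ?_, fun hb k hk => ?_⟩
  · rw [← hb k hk]
    rw [List.length_append, c.len_V] at hk
    exact (h k (by omega) (by omega)).symm
  · rw [← hb k hk]
    rw [List.length_append, c.len_V] at hk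
    exact h k (by omega) (by omega)

theorem belt_of_no_cell (h : ∀ i, c.ct x i = none) : c.belt x = x := by
  funext k
  exact cellMap_of_not _ fun j b hj => absurd (ct_eq_some.2 hj) (by simp [h j])

namespace Gadget

variable {g : c.Gadget}

theorem ct_swap_of_no_active (h : ∀ q m b, ¬ g.Active x q m b) (i : ℤ) :
    c.ct (g.swap x) i = c.ct x i ∨ c.ct (g.swap x) i = (c.ct x i).map addTrack := by
  by_cases hi : ∃ b b', g.openCells x i b b'
  · obtain ⟨b, b', hi⟩ := hi
    obtain ⟨h1, h2⟩ := (rel_swap x).ct_of_mem hi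
    right
    rw [h1, h2, hi.2.2]; rfl
  · left
    refine (rel_swap x).ct_of_not ?_ fun b b' hb => hi ⟨b, b', hb⟩
    rintro t ⟨q, m, b, hq, -⟩
    exact absurd hq (h q m b)

theorem ct_swap_of_no_key (h : ∀ q, ¬ g.Key x q) (i : ℤ) :
    c.ct (g.swap x) i = (c.ct x i).map addTrack := by
  cases hi : c.ct x i with
  | none =>
    rcases ct_swap_of_no_active (g := g) (x := x) (fun q m b hq => h q hq.key) i with h1 | h1
    · rw [h1, hi]; rfl
    · rw [h1, hi]
  | some b =>
    have ho : g.openCells x i b (addTrack b) :=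
      ⟨ct_eq_some.1 hi, fun q hq => absurd hq (h q), rfl⟩
    exact ((rel_swap x).ct_of_mem ho).2

theorem swap_pt_of_no_key {y z : ℤ → Bool} (h : ∀ q, ¬ g.Key (c.pt y z) q) :
    g.swap (c.pt y z) = c.pt y fun j => xor (z j) (y j) := by
  refine eq_pt_of_ct fun j => ?_
  rw [ct_swap_of_no_key h, ct_ptf]; rfl

/-- A base contains at least two adjacent cells `01`. -/
theorem no_key_pt {y z : ℤ → Bool} (h : ∀ j, z j = true → y j = false → z (j + 1) = true →
    y (j + 1) = true) (q : ℤ) : ¬ g.Key (c.pt y z) q := by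
  intro hq
  have hK := g.le_K0
  have h0 := hq.1 0 (by omega)
  have h1 := hq.1 1 (by omega)
  rw [Nat.cast_zero, zero_mul, add_zero] at h0
  obtain ⟨j, rfl⟩ := exists_of_vcell_ptf (ct_eq_some.1 h0)
  rw [show j * (c.ℓ : ℤ) + ((1 : ℕ) : ℤ) * c.ℓ = (j + 1) * c.ℓ by push_cast; ring] at h1
  rw [ct_ptf] at h0 h1
  simp only [Option.some.injEq, Prod.mk.injEq] at h0 h1
  have := h j h0.2 h0.1 h1.2
  rw [h1.1] at this
  simp at this

end Gadget

/-- `h` restricts to an endomorphism of `X` that commutes with the belt map and the swap map. -/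
structure Commuting (g : c.Gadget) (h : (ℤ → A) → (ℤ → A)) : Prop where
  mem : ∀ x ∈ X.carrier, h x ∈ X.carrier
  loc : ∃ R : ℕ, ∀ x ∈ X.carrier, ∀ y ∈ X.carrier, ∀ i : ℤ,
    (∀ k, i - R ≤ k → k ≤ i + R → x k = y k) → h x i = h y i
  map_sh : ∀ x ∈ X.carrier, ∀ n, h (sh n x) = sh n (h x)
  map_belt : ∀ x ∈ X.carrier, h (c.belt x) = c.belt (h x)
  map_swap : ∀ x ∈ X.carrier, h (g.swap x) = g.swap (h x)

/-- An automorphism that commutes with the belt map and the swap map, and its inverse. -/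
structure CommPair (g : c.Gadget) (h h' : (ℤ → A) → (ℤ → A)) : Prop where
  fst : Commuting g h
  snd : Commuting g h'
  left_inv : ∀ x ∈ X.carrier, h' (h x) = x
  right_inv : ∀ x ∈ X.carrier, h (h' x) = x

variable {g : c.Gadget} {h h' : (ℤ → A) → (ℤ → A)}

theorem Commuting.belt_iter (hh : Commuting g h) (hx : x ∈ X.carrier) (n : ℕ) :
    h (c.belt^[n] x) = c.belt^[n] (h x) := by
  induction n with
  | zero => rfl
  | succ n ih =>
    rw [Function.iterate_succ_apply', Function.iterate_succ_apply',
      hh.map_belt _ (belt_iter_mem hx n), ih]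

theorem CommPair.injOn (hh : CommPair g h h') (hx : x ∈ X.carrier) (hx' : x' ∈ X.carrier)
    (he : h x = h x') : x = x' := by
  rw [← hh.left_inv x hx, he, hh.left_inv x' hx']

end CellSystem

end OneDimShift

/-! ### The image of the point of empty cells -/

namespace OneDimShift

open SymbolicDynamics.FullShift

namespace CellSystem

variable {A : Type*} [TopologicalSpace A] {X : Subshift A ℤ} {c : CellSystem X}
  {g : c.Gadget} {h h' : (ℤ → A) → (ℤ → A)} {x x' : ℤ → A}

variable (c) in
/-- The point all of whose cells are empty. -/
abbrev zero : ℤ → A := c.pt (fun _ => false) fun _ => false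

theorem zero_mem : c.zero ∈ X.carrier := ptf_mem _

theorem pt_mem (y z : ℤ → Bool) : c.pt y z ∈ X.carrier := ptf_mem _

theorem le_div {j k : ℤ} {R : ℕ} (h : j * c.ℓ - R ≤ k) : j - R ≤ k / c.ℓ := by
  have hℓ : (1 : ℤ) ≤ c.ℓ := by have := c.ℓ_pos; omega
  rw [Int.le_ediv_iff_mul_le (by omega)]
  nlinarith

theorem div_lt {j k : ℤ} {R : ℕ} (h : k < j * c.ℓ + R) : k / c.ℓ < j + R := by
  have hℓ : (1 : ℤ) ≤ c.ℓ := by have := c.ℓ_pos; omega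
  rw [Int.ediv_lt_iff_lt_mul (by omega)]
  nlinarith

theorem sh_pt (n : ℤ) (y z : ℤ → Bool) :
    sh (n * c.ℓ) (c.pt y z) = c.pt (fun j => y (n + j)) fun j => z (n + j) := sh_ptf n _

theorem sh_cell_zero (n : ℤ) : sh (n * c.ℓ) c.zero = c.zero := sh_pt n _ _

/-- Images of points that are `0` far out look like the image of `0` far out. -/
theorem Commuting.exists_far (hh : Commuting g h) {y z : ℤ → Bool} {B : ℕ}
    (hB : ∀ j : ℤ, (j < -B ∨ B < j) → y j = false ∧ z j = false) :
    ∃ J : ℕ, ∀ k : ℤ, (k < -J * c.ℓ ∨ J * c.ℓ ≤ k) → h (c.pt y z) k = h c.zero k := by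
  obtain ⟨R, hR⟩ := hh.loc
  refine ⟨B + R + 1, fun k hk => hR _ (pt_mem _ _) _ zero_mem k fun k' h1 h2 => ?_⟩
  refine ptf_congr ?_
  have h3 : k' / c.ℓ < -B ∨ (B : ℤ) < k' / c.ℓ := by
    rcases hk with hk | hk
    · left
      have := div_lt (c := c) (j := -((B + R + 1 : ℕ) : ℤ)) (k := k') (R := R) (by linarith)
      push_cast at this; omega
    · right
      have := le_div (c := c) (j := ((B + R + 1 : ℕ) : ℤ)) (k := k') (R := R) (by linarith)
      push_cast at this; omega
  obtain ⟨h4, h5⟩ := hB _ h3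
  rw [h4, h5]

/-- Let `a` have a single left bit; on `a` the belt acts as a shift. A cell of `h a` persists under
the belt, hence would recur arbitrarily far to the left, where `h a` looks like `h c.zero`. If the
latter has no cells, neither has `h a`, so the belt fixes `h a` and then `a`, which it does not. -/
theorem CommPair.exists_cell (hh : CommPair g h h') : ∃ i b, c.vcell (h c.zero) i (some b) := by
  by_contra hcon
  push Not at hcon
  have hw : ∀ i, c.ct (h c.zero) i = none := fun i => ct_eq_none.2 (hcon i)
  set y : ℤ → Bool := fun j => decide (j = 0) with hy
  obtain ⟨J, hJ⟩ := hh.fst.exists_far (y := y) (z := fun _ => false) (B := 0) (by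
    intro j hj; simp [hy]; omega)
  set a := c.pt y fun _ => false with ha
  have hℓ : (1 : ℤ) ≤ c.ℓ := by have := c.ℓ_pos; omega
  have hv : ∀ i, c.ct (h a) i = none := by
    intro i
    by_contra hi
    have h1 : ∀ n : ℕ, c.ct (c.belt^[n] (h a)) i ≠ none := by
      intro n
      induction n with
      | zero => exact hi
      | succ n ih =>
        rw [Function.iterate_succ_apply', ct_belt]
        simpa using ih
    obtain ⟨n, hn⟩ : ∃ n : ℕ, i + 2 * c.ℓ - n * c.ℓ < -J * c.ℓ := by
      refine ⟨(i.natAbs + 3 + J), ?_⟩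
      push_cast
      have : i ≤ |i| * c.ℓ := by nlinarith [le_abs_self i, abs_nonneg i]
      nlinarith
    refine h1 n ?_
    have h2 : c.belt^[n] a = sh (-(n : ℤ) * c.ℓ) a := by
      rw [ha, belt_iter_pt, sh_pt]
      simp only [neg_add_eq_sub]
    rw [← hh.fst.belt_iter (pt_mem _ _), h2, hh.fst.map_sh _ (pt_mem _ _), ct_sh, ← hw (-(n : ℤ) * c.ℓ + i)]
    exact ct_congr fun k h3 h4 => hJ _ (Or.inl (by linarith))
  have h1 := belt_of_no_cell hv
  rw [← hh.fst.map_belt _ (pt_mem _ _)] at h1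
  have h2 := hh.injOn (belt_mem (pt_mem _ _)) (pt_mem _ _) h1
  rw [belt_pt] at h2
  have h3 := congrFun (pt_inj h2).1 0
  simp [hy] at h3

theorem Gadget.swap_sh [Finite A] (g : c.Gadget) (n : ℤ) (x : ℤ → A) :
    g.swap (OneDimShift.sh n x) = OneDimShift.sh n (g.swap x) :=
  localFn_swap.comm_sh n x

theorem CommPair.comp_sh [Finite A] (hh : CommPair g h h') (n : ℤ) :
    CommPair g (fun x => sh n (h x)) fun x => h' (sh (-n) x) where
  fst :=
    { mem := fun x hx => sh_mem (hh.fst.mem x hx) n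
      loc := by
        obtain ⟨R, hR⟩ := hh.fst.loc
        refine ⟨R + n.natAbs, fun x hx y hy i hxy => ?_⟩
        refine hR x hx y hy (n + i) fun k h1 h2 => hxy k ?_ ?_ <;>
          rw [Nat.cast_add] <;> omega
      map_sh := fun x hx m => by rw [hh.fst.map_sh x hx, sh_sh, sh_sh, add_comm]
      map_belt := fun x hx => by rw [hh.fst.map_belt x hx, belt_sh]
      map_swap := fun x hx => by rw [hh.fst.map_swap x hx]; exact (g.swap_sh n _).symm }
  snd :=
    { mem := fun x hx => hh.snd.mem _ (sh_mem hx _)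
      loc := by
        obtain ⟨R, hR⟩ := hh.snd.loc
        refine ⟨R + n.natAbs, fun x hx y hy i hxy => ?_⟩
        refine hR _ (sh_mem hx _) _ (sh_mem hy _) i fun k h1 h2 => hxy _ ?_ ?_ <;>
          rw [Nat.cast_add] <;> omega
      map_sh := fun x hx m => by
        rw [← hh.snd.map_sh _ (sh_mem hx _), sh_sh, sh_sh, add_comm]
      map_belt := fun x hx => by rw [← belt_sh, hh.snd.map_belt _ (sh_mem hx _)]
      map_swap := fun x hx => by
        rw [← hh.snd.map_swap _ (sh_mem hx _)]; exact congrArg h' (g.swap_sh _ _).symm }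
  left_inv x hx := by rw [sh_sh, add_neg_cancel, sh_zero, hh.left_inv x hx]
  right_inv x hx := by rw [hh.right_inv _ (sh_mem hx _), sh_sh, neg_add_cancel, sh_zero]

/-- The image of `c.zero` has period `ℓ`, so one cell determines it. -/
theorem CommPair.exists_const (hh : CommPair g h h') :
    ∃ n y z, sh n (h c.zero) = c.pt (fun _ => y) fun _ => z := by
  obtain ⟨i, b, hi⟩ := hh.exists_cell
  refine ⟨i, b.1, b.2, eq_pt_of_ct fun j => ?_⟩
  have h1 : h c.zero = sh (j * c.ℓ) (h c.zero) := by
    rw [← hh.fst.map_sh _ zero_mem, sh_cell_zero]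
  rw [ct_sh, ← ct_eq_some.2 hi]
  conv_rhs => rw [h1, ct_sh]
  rw [add_comm]

/-- Cells `01` up to the origin, `V none` after it. -/
theorem belt_halfPt : c.belt (c.ptf fun j => if j < 0 then some (false, true) else none) =
    c.ptf fun j => if j < 0 then some (false, true) else none := by
  set f : ℤ → Option (Bool × Bool) := fun j => if j < 0 then some (false, true) else none
  refine (eq_of_ct (x' := c.belt (c.ptf f)) (fun i => ?_) fun k hk =>
    (cellMap_of_not _ hk).symm).symm
  rw [ct_belt]
  by_cases hi : ∃ j : ℤ, i = j * c.ℓ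
  · obtain ⟨j, rfl⟩ := hi
    have e1 : j * (c.ℓ : ℤ) - c.ℓ = (j - 1) * c.ℓ := by ring
    have e2 : j * (c.ℓ : ℤ) + c.ℓ = (j + 1) * c.ℓ := by ring
    rw [e1, e2, ct_ptf, ct_ptf, ct_ptf]
    by_cases hj : j < 0
    · have hj1 : j - 1 < 0 := by omega
      by_cases hj2 : j + 1 < 0 <;> simp [f, hj, hj1, hj2]
    · simp [f, hj]
  · push Not at hi
    rw [ct_ptf_none hi]; rfl

/-- The left bit is `0` because the swap fixes `c.zero` but not constant points with `y = 1`. The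
right bit is detected by the negation at right ends: a run of `01` with a right end is fixed by the
belt, whereas a run of `00` fixed by the belt can have no right end. -/
theorem CommPair.const_eq (hh : CommPair g h h') {y z : Bool}
    (hz : h c.zero = c.pt (fun _ => y) fun _ => z) : h c.zero = c.zero := by
  have hy : y = false := by
    have h1 : g.swap c.zero = c.zero := by
      rw [Gadget.swap_pt_of_no_key (Gadget.no_key_pt (by simp))]; rfl
    have h2 := hh.fst.map_swap _ (zero_mem (c := c))
    rw [h1, hz] at h2
    by_contra hy
    have hy : y = true := by simpa using hy
    subst hy
    rw [Gadget.swap_pt_of_no_key (Gadget.no_key_pt (by simp))] at h2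
    have h3 := congrFun (pt_inj h2).2 0
    cases z <;> simp at h3
  subst hy
  have hz' : z = false := by
    by_contra hz1
    have hz1 : z = true := by simpa using hz1
    subst hz1
    set f : ℤ → Option (Bool × Bool) := fun j => if j < 0 then some (false, true) else none with hf
    have hxm : c.ptf f ∈ X.carrier := ptf_mem _
    set v := h' (c.ptf f) with hvdef
    have hbv : c.belt v = v := by rw [hvdef, ← hh.snd.map_belt _ hxm, belt_halfPt]
    have hz0 : h' (c.pt (fun _ => false) fun _ => true) = c.zero := by
      rw [← hz, hh.left_inv _ zero_mem]
    obtain ⟨R, hR⟩ := hh.snd.loc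
    have hℓ : (1 : ℤ) ≤ c.ℓ := by have := c.ℓ_pos; omega
    have hfar : ∀ k : ℤ, k < -R → v k = c.zero k := by
      intro k hk
      rw [← hz0]
      refine hR _ hxm _ (pt_mem _ _) k fun k' h1 h2 => ptf_congr ?_
      have : k' / (c.ℓ : ℤ) < 0 := Int.ediv_neg_of_neg_of_pos (by omega) (by omega)
      simp [hf, this]
    have hfar2 : ∀ j : ℤ, j ≤ -R - 2 → c.ct v (j * c.ℓ) = some (false, false) := by
      intro j hj
      have h1 := ct_ptf (c := c) (fun _ => some (false, false)) j
      rw [← h1]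
      refine ct_congr fun k h2 h3 => hfar _ ?_
      nlinarith
    -- In a point fixed by the belt, a cell `00` with a left neighbour `00` is followed by another
    -- `00`: a right end would produce `z = 1`.
    have hall : ∀ n : ℕ, c.ct v ((-R - 3 + n) * c.ℓ) = some (false, false) ∧
        c.ct v ((-R - 3 + n + 1) * c.ℓ) = some (false, false) := by
      intro n
      induction n with
      | zero => exact ⟨hfar2 _ (by rw [Nat.cast_zero]; omega), hfar2 _ (by rw [Nat.cast_zero]; omega)⟩
      | succ n ih =>
        have e : -(R : ℤ) - 3 + (n + 1 : ℕ) = -R - 3 + n + 1 := by push_cast; ring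
        rw [e]
        refine ⟨ih.2, ?_⟩
        set t : ℤ := -R - 3 + n + 1
        have h1 := ct_belt (c := c) v (t * c.ℓ)
        have h2 := ct_belt (c := c) v ((t + 1) * c.ℓ)
        rw [hbv, ih.2] at h1
        rw [hbv, show (t + 1) * (c.ℓ : ℤ) - c.ℓ = t * c.ℓ by ring, ih.2] at h2
        rw [show t * (c.ℓ : ℤ) + c.ℓ = (t + 1) * c.ℓ by ring] at h1
        rcases hr : c.ct v ((t + 1) * c.ℓ) with _ | ⟨r1, r2⟩
        · rw [hr] at h1
          simp at h1
        · rw [hr] at h1 h2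
          simp at h1 h2
          rw [h1.2, h2.1]
    have hv0 : v = c.zero := by
      refine eq_pt_of_ct fun j => ?_
      by_cases hj : j ≤ -R - 2
      · exact hfar2 j hj
      · have := (hall (j + R + 3).toNat).1
        rwa [show -(R : ℤ) - 3 + ((j + R + 3).toNat : ℕ) = j by omega] at this
    have h1 := hh.right_inv _ hxm
    rw [← hvdef, hv0, hz] at h1
    have h2 := ct_ptf (c := c) f 0
    rw [← h1, ct_ptf] at h2
    simp [hf] at h2
  subst hz'
  exact hz

end CellSystem

end OneDimShift

/-! ### The action on cells with finitely many bits -/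

namespace OneDimShift

open SymbolicDynamics.FullShift

namespace CellSystem

variable {A : Type*} [TopologicalSpace A] {X : Subshift A ℤ} {c : CellSystem X}
  {g : c.Gadget} {h h' : (ℤ → A) → (ℤ → A)} {x x' : ℤ → A}

/-- The indicator function of a finite set. -/
def chi (S : Finset ℤ) (j : ℤ) : Bool := decide (j ∈ S)

theorem chi_inj {S T : Finset ℤ} (h : chi S = chi T) : S = T := by
  ext j
  simpa [chi] using congrFun h j

theorem chi_empty : chi ∅ = fun _ => false := by
  funext j; simp [chi]

theorem exists_chi {y : ℤ → Bool} {B : ℕ} (h : ∀ j : ℤ, (j < -B ∨ B < j) → y j = false) :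
    ∃ S, y = chi S := by
  refine ⟨(Finset.Icc (-(B : ℤ)) B).filter fun j => y j = true, funext fun j => ?_⟩
  rw [chi, Bool.eq_iff_iff, decide_eq_true_iff, Finset.mem_filter, Finset.mem_Icc]
  refine ⟨fun hj => ⟨?_, hj⟩, fun hj => hj.2⟩
  by_contra hcon
  rw [h j (by omega)] at hj
  simp at hj

theorem exists_bound (S : Finset ℤ) : ∃ B : ℕ, ∀ j : ℤ, (j < -B ∨ B < j) → chi S j = false := by
  refine ⟨S.sup Int.natAbs, fun j hj => ?_⟩
  rw [chi, decide_eq_false_iff_not]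
  intro hjS
  have := Finset.le_sup (f := Int.natAbs) hjS
  omega

/-- A point that is empty far out and all of whose positions `j ℓ` carry cells. -/
theorem Commuting.exists_pt (hh : Commuting g h) (h0 : h c.zero = c.zero) {y z : ℤ → Bool} {B : ℕ}
    (hB : ∀ j : ℤ, (j < -B ∨ B < j) → y j = false ∧ z j = false)
    (hcell : ∀ j : ℤ, (c.ct (h (c.pt y z)) (j * c.ℓ)).isSome =
      (c.ct (h (c.pt y z)) ((j + 1) * c.ℓ)).isSome) :
    ∃ (y' z' : ℤ → Bool) (B' : ℕ), h (c.pt y z) = c.pt y' z' ∧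
      ∀ j : ℤ, (j < -B' ∨ B' < j) → y' j = false ∧ z' j = false := by
  have hℓ : (1 : ℤ) ≤ c.ℓ := by have := c.ℓ_pos; omega
  obtain ⟨J, hJ⟩ := hh.exists_far hB
  set v := h (c.pt y z)
  have hfar : ∀ j : ℤ, (j < -(J + 1 : ℕ) ∨ (J + 1 : ℕ) < j) → c.ct v (j * c.ℓ) = some (false, false) := by
    intro j hj
    have h1 := ct_ptf (c := c) (fun _ => some (false, false)) j
    rw [← h1]
    refine ct_congr fun k h2 h3 => ?_
    rw [hJ, h0]
    push_cast at hj
    rcases hj with hj | hj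
    · left; nlinarith
    · right; nlinarith
  have hsome : ∀ j : ℤ, (c.ct v (j * c.ℓ)).isSome = true := by
    intro j
    induction j using Int.inductionOn' (b := (J + 2 : ℕ)) with
    | zero => rw [hfar _ (by push_cast; omega)]; rfl
    | succ k _ ih => rw [← hcell]; exact ih
    | pred k _ ih => rw [hcell, sub_add_cancel]; exact ih
  choose u hu using fun j => Option.isSome_iff_exists.1 (hsome j)
  refine ⟨fun j => (u j).1, fun j => (u j).2, J + 1, eq_pt_of_ct hu, fun j hj => ?_⟩
  have h1 := hu j
  rw [hfar j hj] at h1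
  have h2 := Option.some.inj h1
  exact ⟨(congrArg Prod.fst h2).symm, (congrArg Prod.snd h2).symm⟩

/-- On such points the belt is the shift by `-ℓ`, and so it is on their images. There the right
track is moved both ways at once, hence has period two; being `0` far out, it vanishes. -/
theorem Commuting.exists_left (hh : Commuting g h) (h0 : h c.zero = c.zero) (S : Finset ℤ) :
    ∃ S', h (c.pt (chi S) fun _ => false) = c.pt (chi S') fun _ => false := by
  obtain ⟨B, hB⟩ := exists_bound S
  have h1 : c.belt (c.pt (chi S) fun _ => false) = sh (-1 * c.ℓ) (c.pt (chi S) fun _ => false) := by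
    rw [belt_pt, sh_pt]; simp only [neg_add_eq_sub]
  have h2 : c.belt (h (c.pt (chi S) fun _ => false)) =
      sh (-1 * c.ℓ) (h (c.pt (chi S) fun _ => false)) := by
    rw [← hh.map_belt _ (pt_mem _ _), h1, hh.map_sh _ (pt_mem _ _)]
  obtain ⟨y', z', B', hyz, hB'⟩ := hh.exists_pt h0 (y := chi S) (z := fun _ => false)
    (fun j hj => ⟨hB j hj, rfl⟩) (fun j => by
      have h3 := congrArg (fun x => (c.ct x ((j + 1) * c.ℓ)).isSome) h2
      simp only [ct_belt, ct_sh, Option.isSome_map] at h3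
      rw [h3]; congr 2; ring)
  rw [hyz, belt_pt, sh_pt] at h2
  have h3 := (pt_inj h2).2
  have h4 : ∀ (n : ℕ) (j : ℤ), z' j = z' (j + 2 * n) := by
    intro n
    induction n with
    | zero => simp
    | succ n ih =>
      intro j
      rw [ih j]
      have := congrFun h3 (j + 2 * n + 1)
      rw [show -1 + (j + 2 * (n : ℤ) + 1) = j + 2 * n by ring] at this
      rw [← this]; congr 1; push_cast; ring
  have h5 : z' = fun _ => false := by
    funext j
    rw [h4 (B' + j.natAbs + 1) j]
    exact (hB' _ (by omega)).2
  obtain ⟨S', hS'⟩ := exists_chi fun j hj => (hB' j hj).1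
  exact ⟨S', by rw [hyz, h5, hS']⟩

theorem Commuting.exists_right (hh : Commuting g h) (h0 : h c.zero = c.zero) (S : Finset ℤ) :
    ∃ S', h (c.pt (fun _ => false) (chi S)) = c.pt (fun _ => false) (chi S') := by
  obtain ⟨B, hB⟩ := exists_bound S
  have h1 : c.belt (c.pt (fun _ => false) (chi S)) = sh (1 * c.ℓ) (c.pt (fun _ => false) (chi S)) := by
    rw [belt_pt, sh_pt]; simp only [add_comm]
  have h2 : c.belt (h (c.pt (fun _ => false) (chi S))) =
      sh (1 * c.ℓ) (h (c.pt (fun _ => false) (chi S))) := by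
    rw [← hh.map_belt _ (pt_mem _ _), h1, hh.map_sh _ (pt_mem _ _)]
  obtain ⟨y', z', B', hyz, hB'⟩ := hh.exists_pt h0 (y := fun _ => false) (z := chi S)
    (fun j hj => ⟨rfl, hB j hj⟩) (fun j => by
      have h3 := congrArg (fun x => (c.ct x (j * c.ℓ)).isSome) h2
      simp only [ct_belt, ct_sh, Option.isSome_map] at h3
      rw [h3]; congr 2; ring)
  rw [hyz, belt_pt, sh_pt] at h2
  have h3 := (pt_inj h2).1
  have h4 : ∀ (n : ℕ) (j : ℤ), y' j = y' (j + 2 * n) := by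
    intro n
    induction n with
    | zero => simp
    | succ n ih =>
      intro j
      rw [ih j]
      have := congrFun h3 (j + 2 * n + 1)
      rw [show j + 2 * (n : ℤ) + 1 - 1 = j + 2 * n by ring] at this
      rw [this]; congr 1; push_cast; ring
  have h5 : y' = fun _ => false := by
    funext j
    rw [h4 (B' + j.natAbs + 1) j]
    exact (hB' _ (by omega)).1
  obtain ⟨S', hS'⟩ := exists_chi fun j hj => (hB' j hj).2
  exact ⟨S', by rw [hyz, h5, hS']⟩

/-- Superposition: the belt drives the tracks apart until the local rule sees at most one of them at
a time. -/
theorem Commuting.pt_eq (hh : Commuting g h) {S T S' T' : Finset ℤ}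
    (hS : h (c.pt (chi S) fun _ => false) = c.pt (chi S') fun _ => false)
    (hT : h (c.pt (fun _ => false) (chi T)) = c.pt (fun _ => false) (chi T')) :
    h (c.pt (chi S) (chi T)) = c.pt (chi S') (chi T') := by
  have hℓ : (1 : ℤ) ≤ c.ℓ := by have := c.ℓ_pos; omega
  obtain ⟨R, hR⟩ := hh.loc
  obtain ⟨B1, hB1⟩ := exists_bound S
  obtain ⟨B2, hB2⟩ := exists_bound T
  obtain ⟨B3, hB3⟩ := exists_bound S'
  obtain ⟨B4, hB4⟩ := exists_bound T'
  set n : ℕ := R + B1 + B2 + B3 + B4 + 2 with hn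
  have hinj : Function.Injective (c.belt^[n]) := belt_injective.iterate n
  apply hinj
  rw [← hh.belt_iter (pt_mem _ _), belt_iter_pt, belt_iter_pt]
  have hP : h (c.pt (fun j => chi S (j - n)) fun _ => false) =
      c.pt (fun j => chi S' (j - n)) fun _ => false := by
    have := hh.belt_iter (pt_mem (c := c) (chi S) fun _ => false) n
    rwa [hS, belt_iter_pt, belt_iter_pt] at this
  have hQ : h (c.pt (fun _ => false) fun j => chi T (j + n)) =
      c.pt (fun _ => false) fun j => chi T' (j + n) := by
    have := hh.belt_iter (pt_mem (c := c) (fun _ => false) (chi T)) n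
    rwa [hT, belt_iter_pt, belt_iter_pt] at this
  funext k
  rcases le_or_gt 0 k with hk | hk
  · have h1 : h (c.pt (fun j => chi S (j - n)) fun j => chi T (j + n)) k =
        h (c.pt (fun j => chi S (j - n)) fun _ => false) k := by
      refine hR _ (pt_mem _ _) _ (pt_mem _ _) k fun k' h2 h3 => ptf_congr ?_
      have := le_div (c := c) (j := 0) (R := R) (k := k') (by linarith)
      simp only [hB2 (k' / c.ℓ + n) (by omega)]
    rw [h1, hP]
    refine ptf_congr ?_
    have := le_div (c := c) (j := 0) (R := 0) (k := k) (by simpa using hk)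
    simp only [hB4 (k / c.ℓ + n) (by omega)]
  · have h1 : h (c.pt (fun j => chi S (j - n)) fun j => chi T (j + n)) k =
        h (c.pt (fun _ => false) fun j => chi T (j + n)) k := by
      refine hR _ (pt_mem _ _) _ (pt_mem _ _) k fun k' h2 h3 => ptf_congr ?_
      have := div_lt (c := c) (j := 0) (R := R) (k := k') (by linarith)
      simp only [hB1 (k' / c.ℓ - n) (by omega)]
    rw [h1, hQ]
    refine ptf_congr ?_
    have := div_lt (c := c) (j := 0) (R := 0) (k := k) (by simpa using hk)
    simp only [hB3 (k / c.ℓ - n) (by omega)]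

/-- The swap copies the left track to an empty right track, which forces both tracks to be
transformed alike. -/
theorem Commuting.exists_action (hh : Commuting g h) (h0 : h c.zero = c.zero) :
    ∃ α : Finset ℤ → Finset ℤ, ∀ S T, h (c.pt (chi S) (chi T)) = c.pt (chi (α S)) (chi (α T)) := by
  choose α hα using hh.exists_left h0
  choose β hβ using hh.exists_right h0
  refine ⟨α, fun S T => ?_⟩
  have h1 := hh.pt_eq (hα S) (hβ S)
  have h2 : ∀ S, g.swap (c.pt (chi S) fun _ => false) = c.pt (chi S) (chi S) := fun S => by
    rw [Gadget.swap_pt_of_no_key (Gadget.no_key_pt (by simp))]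
    simp
  have h3 : α S = β S := by
    rw [← h2, hh.map_swap _ (pt_mem _ _), hα, h2] at h1
    exact chi_inj (pt_inj h1).2
  have h4 : α T = β T := by
    have h1 := hh.pt_eq (hα T) (hβ T)
    rw [← h2, hh.map_swap _ (pt_mem _ _), hα, h2] at h1
    exact chi_inj (pt_inj h1).2
  rw [hh.pt_eq (hα S) (hβ T), h4]

theorem chi_insert {S : Finset ℤ} {i : ℤ} (hi : i ∉ S) :
    (fun j => xor (chi {i} j) (chi S j)) = chi (insert i S) := by
  funext j
  simp only [chi, Finset.mem_singleton, Finset.mem_insert]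
  by_cases h1 : j = i
  · subst h1; simp [hi]
  · simp [h1]

theorem swap_pt_singleton {S : Finset ℤ} {i : ℤ} (hi : i ∉ S) :
    g.swap (c.pt (chi S) (chi {i})) = c.pt (chi S) (chi (insert i S)) := by
  rw [Gadget.swap_pt_of_no_key (Gadget.no_key_pt ?_), chi_insert hi]
  intro j h1 _ h3
  simp [chi] at h1 h3
  omega

/-- No exchange takes place: one of its two sides contains a position on the grid without a cell,
but both points consist of cells. So contents change at most by `addTrack`. -/
theorem swap_pt_eq {y z z' : ℤ → Bool} (h : g.swap (c.pt y z) = c.pt y z') {j : ℤ}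
    (hj : y j = false) : z' j = z j := by
  have hcell : ∀ (z : ℤ → Bool) (m : List A) (q : ℤ), (∃ j : ℤ, q = j * c.ℓ) → m ∈ g.M →
      ¬ Reads (c.pt y z) (g.mpos q) (g.mid m false) := by
    rintro z m _ ⟨j, rfl⟩ hm hr
    have h1 := Gadget.mid_false_ct_end hm hr
    rw [show g.mpos (j * c.ℓ) + g.K1 * c.ℓ = (j + g.K0 + g.K1) * c.ℓ by
      simp only [Gadget.mpos]; ring, ct_ptf] at h1
    simp at h1
  have hna : ∀ q m b, ¬ g.Active (c.pt y z) q m b := by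
    intro q m b hq
    have h0 := hq.1 0 (by have := g.le_K0; omega)
    have hex := exists_of_vcell_ptf (ct_eq_some.1 h0)
    rw [Nat.cast_zero, zero_mul, add_zero] at hex
    cases b
    · exact hcell z m q hex hq.2.1 hq.2.2.1
    · have := hq.reads_swap
      rw [h] at this
      exact hcell z' m q hex hq.2.1 this
  have h1 := Gadget.ct_swap_of_no_active hna (j * c.ℓ)
  rw [h, ct_ptf, ct_ptf, hj] at h1
  simp [addTrack] at h1
  exact h1

/-- With `a` and `b` the maximum and minimum of `α {0}`, the map `α` adds `a` to maxima and `b` to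
minima. The inverse image of `{0}` then satisfies `max + a = min + b`, which leaves only `a = b`. -/
theorem CommPair.exists_singleton [Finite A] (hh : CommPair g h h') (h0 : h c.zero = c.zero)
    {α : Finset ℤ → Finset ℤ}
    (hα : ∀ S T, h (c.pt (chi S) (chi T)) = c.pt (chi (α S)) (chi (α T))) :
    ∃ M, ∀ i, α {i} = {i + M} := by
  have h0' : h' c.zero = c.zero := by
    conv_lhs => rw [← h0]
    exact hh.left_inv _ zero_mem
  obtain ⟨β, hβ⟩ := hh.snd.exists_action h0'
  have hαβ : ∀ S, α (β S) = S := fun S => by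
    have h1 := hh.right_inv (c.pt (chi S) (chi S)) (pt_mem _ _)
    rw [hβ, hα] at h1
    exact chi_inj (pt_inj h1).1
  have hβα : ∀ S, β (α S) = S := fun S => by
    have h1 := hh.left_inv (c.pt (chi S) (chi S)) (pt_mem _ _)
    rw [hα, hβ] at h1
    exact chi_inj (pt_inj h1).1
  have hem : α ∅ = ∅ := by
    have h1 := hα ∅ ∅
    simp only [chi_empty] at h1
    change h c.zero = _ at h1
    rw [h0] at h1
    have := (pt_inj h1).1
    rw [← chi_empty] at this
    exact (chi_inj this).symm
  -- The swap sends the tracks `S, {i}` to `S, insert i S`; after applying `h`, the right track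
  -- cannot change where the left one is `0`.
  have hR : ∀ S i j, i ∉ S → j ∉ α S → (j ∈ α (insert i S) ↔ j ∈ α {i}) := by
    intro S i j hi hj
    have h1 := hh.fst.map_swap _ (pt_mem (c := c) (chi S) (chi {i}))
    rw [swap_pt_singleton hi, hα, hα] at h1
    have h2 := swap_pt_eq h1.symm (j := j) (by simpa [chi] using hj)
    simpa [chi] using h2
  have hsh : ∀ i j : ℤ, j ∈ α {i} ↔ j - i ∈ α {0} := by
    intro i j
    have h1 : sh (i * c.ℓ) (c.pt (chi {i}) (chi {i})) = c.pt (chi {0}) (chi {0}) := by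
      rw [sh_pt]
      have : (fun j => chi {i} (i + j)) = chi {0} := by
        funext j; simp [chi]
      rw [this]
    have h2 := hh.fst.map_sh _ (pt_mem (c := c) (chi {i}) (chi {i})) (i * c.ℓ)
    rw [h1, hα, hα, sh_pt] at h2
    have h3 := congrFun (pt_inj h2).1 (j - i)
    simp only [chi, add_sub_cancel] at h3
    rw [Bool.eq_iff_iff, decide_eq_true_iff, decide_eq_true_iff] at h3
    exact h3.symm
  have hne : (α {0}).Nonempty := by
    rw [Finset.nonempty_iff_ne_empty]
    intro h1
    have h2 := hβα {0}
    rw [h1, ← hem, hβα] at h2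
    simp at h2
  set a := (α {0}).max' hne with ha
  set b := (α {0}).min' hne with hb
  have hmax : ∀ S : Finset ℤ, ∀ s ∈ S, (∀ t ∈ S, t ≤ s) →
      s + a ∈ α S ∧ ∀ t ∈ α S, t ≤ s + a := by
    intro S
    induction S using Finset.induction_on_max with
    | empty => simp
    | insert i S hi ih =>
      intro s hs hst
      have hiS : i ∉ S := fun h => lt_irrefl _ (hi i h)
      obtain rfl : s = i := by
        rcases Finset.mem_insert.1 hs with h1 | h1
        · exact h1
        · have := hi s h1
          have := hst i (Finset.mem_insert_self _ _)
          omega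
      have hlt : ∀ t ∈ α S, t < s + a := by
        intro t ht
        have hSne : S.Nonempty := by
          rw [Finset.nonempty_iff_ne_empty]; rintro rfl; rw [hem] at ht; simp at ht
        have := (ih _ (S.max'_mem hSne) (S.le_max' ·)).2 t ht
        have := hi _ (S.max'_mem hSne)
        omega
      constructor
      · rw [hR S s (s + a) hiS (fun h => lt_irrefl _ (hlt _ h)), hsh, add_sub_cancel_left]
        exact Finset.max'_mem _ _
      · intro t ht
        by_contra hcon
        push Not at hcon
        rw [hR S s t hiS (fun h => by have := hlt _ h; omega), hsh] at ht
        have := Finset.le_max' _ _ ht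
        omega
  have hmin : ∀ S : Finset ℤ, ∀ s ∈ S, (∀ t ∈ S, s ≤ t) →
      s + b ∈ α S ∧ ∀ t ∈ α S, s + b ≤ t := by
    intro S
    induction S using Finset.induction_on_min with
    | empty => simp
    | insert i S hi ih =>
      intro s hs hst
      have hiS : i ∉ S := fun h => lt_irrefl _ (hi i h)
      obtain rfl : s = i := by
        rcases Finset.mem_insert.1 hs with h1 | h1
        · exact h1
        · have := hi s h1
          have := hst i (Finset.mem_insert_self _ _)
          omega
      have hlt : ∀ t ∈ α S, s + b < t := by
        intro t ht
        have hSne : S.Nonempty := by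
          rw [Finset.nonempty_iff_ne_empty]; rintro rfl; rw [hem] at ht; simp at ht
        have := (ih _ (S.min'_mem hSne) (S.min'_le ·)).2 t ht
        have := hi _ (S.min'_mem hSne)
        omega
      constructor
      · rw [hR S s (s + b) hiS (fun h => lt_irrefl _ (hlt _ h)), hsh, add_sub_cancel_left]
        exact Finset.min'_mem _ _
      · intro t ht
        by_contra hcon
        push Not at hcon
        rw [hR S s t hiS (fun h => by have := hlt _ h; omega), hsh] at ht
        have := Finset.min'_le _ _ ht
        omega
  have hβne : (β {0}).Nonempty := by
    rw [Finset.nonempty_iff_ne_empty]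
    intro h1
    have h2 := hαβ {0}
    rw [h1, hem] at h2
    simp at h2
  have h1 := (hmax (β {0}) _ (Finset.max'_mem _ hβne) (Finset.le_max' _ ·)).1
  have h2 := (hmin (β {0}) _ (Finset.min'_mem _ hβne) (Finset.min'_le _ ·)).1
  rw [hαβ, Finset.mem_singleton] at h1 h2
  have h3 := Finset.min'_le _ _ (Finset.max'_mem _ hβne)
  have h4 : b ≤ a := Finset.min'_le _ _ (Finset.max'_mem _ hne)
  refine ⟨a, fun i => ?_⟩
  ext j
  rw [hsh, Finset.mem_singleton]
  constructor
  · intro hj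
    have h5 := Finset.min'_le _ _ hj
    have h6 := Finset.le_max' _ _ hj
    omega
  · rintro rfl
    rw [add_sub_cancel_left]
    exact Finset.max'_mem _ _

/-- Up to a shift, an automorphism commuting with the belt map and the swap map fixes all points that
consist of cells only finitely many of which are not empty. -/
theorem CommPair.exists_fix [Finite A] (hh : CommPair g h h') :
    ∃ n : ℤ, Commuting g (fun x => sh n (h x)) ∧
      ∀ S T, sh n (h (c.pt (chi S) (chi T))) = c.pt (chi S) (chi T) := by
  obtain ⟨n, y, z, hn⟩ := hh.exists_const
  have hh1 := hh.comp_sh n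
  have h1 : sh n (h c.zero) = c.zero := hh1.const_eq hn
  obtain ⟨α, hα⟩ := hh1.fst.exists_action h1
  obtain ⟨M, hM⟩ := hh1.exists_singleton h1 hα
  have hh2 := hh1.comp_sh (M * c.ℓ)
  simp only [sh_sh] at hh2
  refine ⟨n + M * c.ℓ, hh2.fst, ?_⟩
  have h2 : sh (n + M * c.ℓ) (h c.zero) = c.zero := by
    rw [← sh_sh, h1, sh_cell_zero]
  obtain ⟨γ, hγ⟩ := hh2.fst.exists_action h2
  have hγ1 : ∀ i, γ {i} = {i} := by
    intro i
    have h3 := hγ {i} {i}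
    have h4 := hα {i} {i}
    rw [← sh_sh, h4, sh_pt, hM] at h3
    have h5 := (pt_inj h3).1
    apply chi_inj
    rw [← h5]
    funext j
    simp only [chi, Finset.mem_singleton]
    congr 1
    simp only [eq_iff_iff]
    omega
  have hγe : γ ∅ = ∅ := by
    have h3 := hγ ∅ ∅
    simp only [chi_empty] at h3
    rw [h2] at h3
    have := (pt_inj h3).1
    rw [← chi_empty] at this
    exact (chi_inj this).symm
  have hγS : ∀ S, γ S = S := by
    intro S
    induction S using Finset.induction_on with
    | empty => exact hγe
    | insert i S hi ih =>
      -- The swap inserts one element at a time, so fixing singletons implies fixing all finite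
      -- sets.
      have h3 := hh2.fst.map_swap _ (pt_mem (c := c) (chi S) (chi {i}))
      rw [swap_pt_singleton hi, hγ, hγ, ih, hγ1, swap_pt_singleton hi] at h3
      exact chi_inj (pt_inj h3).2
  intro S T
  rw [hγ, hγS, hγS]

end CellSystem

end OneDimShift

/-! ### Infinite runs with a right end -/

namespace OneDimShift

open SymbolicDynamics.FullShift

namespace CellSystem

variable {A : Type*} [TopologicalSpace A] {X : Subshift A ℤ} (c : CellSystem X)

/-- The position of the `k`-th cell to the left of `e`. -/
def lpos (e : ℤ) (k : ℕ) : ℤ := e - ((k : ℤ) + 1) * c.ℓ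

variable {c} {g : c.Gadget} {x y : ℤ → A} {e i q s : ℤ} {D : ℕ}

theorem lpos_zero_add (e : ℤ) : c.lpos e 0 + c.ℓ = e := by simp [lpos]

theorem lpos_sub (e : ℤ) (k : ℕ) : c.lpos e k - c.ℓ = c.lpos e (k + 1) := by
  simp only [lpos]; push_cast; ring

theorem lpos_succ_add (e : ℤ) (k : ℕ) : c.lpos e (k + 1) + c.ℓ = c.lpos e k := by
  simp only [lpos]; push_cast; ring

theorem lpos_lt (e : ℤ) (k : ℕ) : c.lpos e k + c.ℓ ≤ e := by
  have : (0 : ℤ) ≤ k * c.ℓ := by positivity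
  simp only [lpos]; linarith

theorem lpos_eq_add {e : ℤ} {n k : ℕ} (h : k < n) :
    e - n * c.ℓ + ((n - 1 - k : ℕ) : ℤ) * c.ℓ = c.lpos e k := by
  rw [show ((n - 1 - k : ℕ) : ℤ) = n - 1 - k by omega]
  simp only [lpos]; ring

variable (c) in
/-- There are cells all the way to the left of `e`, and from the `D`-th on they are empty. -/
structure LeftRun (x : ℤ → A) (e : ℤ) (D : ℕ) : Prop where
  cell : ∀ k, ∃ b, c.ct x (c.lpos e k) = some b
  far : ∀ k, D ≤ k → c.ct x (c.lpos e k) = some (false, false)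

theorem LeftRun.reads_p (h : c.LeftRun x e D) : Reads x e c.p := by
  obtain ⟨b, hb⟩ := h.cell 0
  have := (ct_eq_some.1 hb).reads_next
  rwa [lpos_zero_add] at this

theorem LeftRun.exists_lpos (h : c.LeftRun x e D) (hq : Reads x q c.p) (hqe : q < e) :
    ∃ k, q = c.lpos e k := by
  have hℓ : (1 : ℤ) ≤ c.ℓ := by have := c.ℓ_pos; omega
  set n := (e - q).toNat with hn
  have hn' : (n : ℤ) = e - q := by omega
  obtain ⟨j, hj, hj2⟩ := exists_of_run (c := c) (q := e - n * c.ℓ) (n := n) (fun j hj => by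
    obtain ⟨b, hb⟩ := h.cell (n - 1 - j)
    refine ⟨_, (ct_eq_some (b := b)).1 ?_⟩
    rw [← hb, ← lpos_eq_add (show n - 1 - j < n by omega)]
    rw [show n - 1 - (n - 1 - j) = j by omega]) hq (by nlinarith) (by linarith)
  refine ⟨n - 1 - j, ?_⟩
  rw [hj2, ← lpos_eq_add (show n - 1 - j < n by omega), show n - 1 - (n - 1 - j) = j by omega]

/-- How the belt map moves contents in an infinite run of cells with a right end. -/
theorem LeftRun.iterate (h : c.LeftRun x e D) (he : c.ct x e = none) (n : ℕ) :
    c.ct (c.belt^[n] x) e = none ∧ ∀ k, ∃ b, c.ct (c.belt^[n] x) (c.lpos e k) = some b ∧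
      (D ≤ k + n → b.1 = false) ∧ (D + k < n → b.2 = true) ∧ (D + n ≤ k → b.2 = false) := by
  induction n with
  | zero =>
    refine ⟨he, fun k => ?_⟩
    obtain ⟨b, hb⟩ := h.cell k
    refine ⟨b, hb, fun hk => ?_, fun hk => by omega, fun hk => ?_⟩
    · have := h.far k (by omega)
      rw [hb] at this
      rw [Option.some.inj this]
    · have := h.far k (by omega)
      rw [hb] at this
      rw [Option.some.inj this]
  | succ n ih =>
    obtain ⟨ih1, ih2⟩ := ih
    rw [Function.iterate_succ_apply']
    refine ⟨by rw [ct_belt, ih1]; rfl, fun k => ?_⟩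
    obtain ⟨b, hb, h1, h2, h3⟩ := ih2 k
    obtain ⟨l, hl, h4, -, -⟩ := ih2 (k + 1)
    rw [ct_belt, hb, lpos_sub, hl]
    cases k with
    | zero =>
      rw [lpos_zero_add, ih1]
      refine ⟨_, rfl, fun hk => h4 (by omega), fun hk => ?_, fun hk => by omega⟩
      -- By now the left track at the right end is `0`, so its negation feeds a steady stream of
      -- `1`s into the right track.
      simp [h1 (by omega)]
    | succ k =>
      obtain ⟨r, hr, h5, h6, h7⟩ := ih2 k
      rw [lpos_succ_add, hr]
      exact ⟨_, rfl, fun hk => h4 (by omega), fun hk => h6 (by omega), fun hk => h7 (by omega)⟩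

theorem LeftRun.belt_iter (h : c.LeftRun x e D) (he : c.ct x e = none) (n : ℕ) :
    c.LeftRun (c.belt^[n] x) e (D + n) where
  cell k := by
    obtain ⟨b, hb, -⟩ := (h.iterate he n).2 k
    exact ⟨b, hb⟩
  far k hk := by
    obtain ⟨⟨y, z⟩, hb, h1, -, h3⟩ := (h.iterate he n).2 k
    have h4 := h1 (by omega)
    have h5 := h3 (by omega)
    simp only at h4 h5
    rw [hb, h4, h5]

theorem isSome_belt_iter (x : ℤ → A) (i : ℤ) (n : ℕ) :
    (c.ct (c.belt^[n] x) i).isSome = (c.ct x i).isSome := by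
  induction n with
  | zero => rfl
  | succ n ih => rw [Function.iterate_succ_apply', ct_belt, Option.isSome_map, ih]

/-- If the content of a cell is `01` from some time on, the run of the cell has no left end. -/
theorem ne_none_of_eventually {n0 : ℕ}
    (h : ∀ n ≥ n0, c.ct (c.belt^[n] x) i = some (false, true)) (k : ℕ) :
    c.ct x (i - k * c.ℓ) ≠ none := by
  have key : ∀ k : ℕ, ∃ m, ∀ n ≥ m, c.ct (c.belt^[n] x) (i - k * c.ℓ) = some (false, true) := by
    intro k
    induction k with
    | zero => exact ⟨n0, by simpa using h⟩
    | succ k ih =>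
      obtain ⟨m, hm⟩ := ih
      have e1 : i - (k : ℤ) * c.ℓ - c.ℓ = i - ((k + 1 : ℕ) : ℤ) * c.ℓ := by push_cast; ring
      have e2 : i - ((k + 1 : ℕ) : ℤ) * c.ℓ + c.ℓ = i - (k : ℤ) * c.ℓ := by push_cast; ring
      -- Without a left neighbour, a cell `01` would turn its own `z = 1` into its next left bit.
      have h1 : ∀ n ≥ m, ∃ z, c.ct (c.belt^[n] x) (i - ((k + 1 : ℕ) : ℤ) * c.ℓ) = some (false, z) := by
        intro n hn
        have h2 := hm (n + 1) (by omega)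
        rw [Function.iterate_succ_apply', ct_belt, hm n hn, e1] at h2
        rcases hc : c.ct (c.belt^[n] x) (i - ((k + 1 : ℕ) : ℤ) * c.ℓ) with _ | ⟨y, z⟩
        · rw [hc] at h2; simp at h2
        · rw [hc] at h2; simp at h2
          exact ⟨z, by rw [h2.1]⟩
      refine ⟨m + 1, fun n hn => ?_⟩
      obtain ⟨n, rfl⟩ : ∃ n', n = n' + 1 := ⟨n - 1, by omega⟩
      obtain ⟨z, hz⟩ := h1 n (by omega)
      obtain ⟨z', hz'⟩ := h1 (n + 1) (by omega)
      rw [hz']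
      rw [Function.iterate_succ_apply', ct_belt, hz, e2, hm n (by omega)] at hz'
      simp at hz'
      rw [hz'.2]
  obtain ⟨m, hm⟩ := key k
  have h1 := isSome_belt_iter (c := c) x (i - k * c.ℓ) m
  rw [hm m le_rfl] at h1
  intro h2
  rw [h2] at h1
  simp at h1

variable (g) in
/-- An infinite run of cells with right end `e` and content suited for an exchange. -/
structure Primed (x : ℤ → A) (e : ℤ) : Prop where
  cell : ∀ k, ∃ z, c.ct x (c.lpos e k) = some (false, z)
  near : ∀ k < g.K0 + g.K1, c.ct x (c.lpos e k) = some (false, true)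
  isNone : c.ct x e = none

theorem LeftRun.primed (h : c.LeftRun x e D) (he : c.ct x e = none) {n : ℕ}
    (hn : D + g.K0 + g.K1 ≤ n) : Primed g (c.belt^[n] x) e where
  cell k := by
    obtain ⟨⟨y, z⟩, hb, h1, -⟩ := (h.iterate he n).2 k
    exact ⟨z, by rw [hb, ← h1 (by omega)]⟩
  near k hk := by
    obtain ⟨⟨y, z⟩, hb, h1, h2, -⟩ := (h.iterate he n).2 k
    have h4 := h1 (by omega)
    have h5 := h2 (by omega)
    simp only at h4 h5
    rw [hb, h4, h5]
  isNone := (h.iterate he n).1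

variable (g) in
/-- The key position of a primed run. -/
abbrev kpos (e : ℤ) : ℤ := e - (g.K0 + g.K1) * c.ℓ

theorem zpos_kpos (e : ℤ) : g.zpos (kpos g e) = e := by simp only [Gadget.zpos, kpos]; ring

theorem epos_kpos (e : ℤ) : g.epos (kpos g e) = e + g.d * c.ℓ := by
  simp only [Gadget.epos, kpos]; ring

theorem mpos_kpos (e : ℤ) : g.mpos (kpos g e) = e - g.K1 * c.ℓ := by
  simp only [Gadget.mpos, kpos]; ring

theorem kpos_add {e : ℤ} {j : ℕ} (h : j < g.K0 + g.K1) :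
    kpos g e + (j : ℤ) * c.ℓ = c.lpos e (g.K0 + g.K1 - 1 - j) := by
  have := lpos_eq_add (c := c) (e := e) (show g.K0 + g.K1 - 1 - j < g.K0 + g.K1 by omega)
  rw [← this, show g.K0 + g.K1 - 1 - (g.K0 + g.K1 - 1 - j) = j by omega]
  simp only [kpos]; push_cast; ring

theorem mpos_kpos_add {e : ℤ} {j : ℕ} (h : j < g.K1) :
    g.mpos (kpos g e) + (j : ℤ) * c.ℓ = c.lpos e (g.K1 - 1 - j) := by
  have := lpos_eq_add (c := c) (e := e) (show g.K1 - 1 - j < g.K1 by omega)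
  rw [← this, show g.K1 - 1 - (g.K1 - 1 - j) = j by omega, mpos_kpos]

theorem Primed.base (h : Primed g x e) : g.Base x (kpos g e) := by
  intro j hj
  rw [kpos_add (by omega)]
  exact h.near _ (by omega)

theorem Primed.key (h : Primed g x e) : g.Key x (kpos g e) := by
  refine ⟨h.base, Or.inr ⟨fun j hj => ?_, by rw [zpos_kpos]; exact h.isNone⟩⟩
  rw [mpos_kpos_add hj]
  exact h.near _ (by omega)

/-- The only place to the left of `e` where an exchange can be made. -/
theorem Primed.eq_of_active (hl : c.LeftRun x e D) (h : Primed g x e) {m b}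
    (ha : g.Active x q m b) (hq : q < e) : q = kpos g e ∧ b = false := by
  have hℓ : (1 : ℤ) ≤ c.ℓ := by have := c.ℓ_pos; omega
  have hK1 := g.K1_pos
  obtain ⟨k, hk⟩ := hl.exists_lpos ha.1.reads_p hq
  have hcell : ∀ j : ℕ, j ≤ k → q + (j : ℤ) * c.ℓ = c.lpos e (k - j) := by
    intro j hj
    rw [hk]; simp only [lpos]; rw [show ((k - j : ℕ) : ℤ) = k - j by omega]; ring
  have hend : q + ((k + 1 : ℕ) : ℤ) * c.ℓ = e := by
    rw [hk]; simp only [lpos]; push_cast; ring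
  have hm : g.mpos q = q + (g.K0 : ℤ) * c.ℓ := rfl
  rcases lt_trichotomy q (kpos g e) with hlt | heq | hgt
  · exfalso
    have h1 := ha.le_of_lt h.key hlt
    have hkK : g.K0 + g.K1 + g.d ≤ k := by
      have h2 : g.epos q < e := by
        refine lt_of_le_of_lt h1 ?_
        simp only [kpos]
        have : (0 : ℤ) < (g.K0 + g.K1) * c.ℓ := by
          have : (1 : ℤ) ≤ g.K1 := by omega
          positivity
        linarith
      rw [← hend] at h2
      simp only [Gadget.epos] at h2
      have h3 : ((g.K0 + g.K1 + g.d : ℕ) : ℤ) * c.ℓ < ((k + 1 : ℕ) : ℤ) * c.ℓ := by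
        push_cast at h2 ⊢; linarith
      have := lt_of_mul_lt_mul_right h3 (by omega)
      omega
    cases b
    · have h2 := Gadget.mid_false_ct_end ha.2.1 ha.2.2.1
      rw [hm, add_assoc, ← add_mul] at h2
      have h3 := hcell (g.K0 + g.K1) (by omega)
      push_cast at h3
      rw [h3] at h2
      obtain ⟨z, hz⟩ := h.cell (k - (g.K0 + g.K1))
      rw [hz] at h2
      simp at h2
    -- Here `T m` lies inside the run, so it is a word of cells with `y = 0` and has the followers
    -- of `V none`. But then `T_eq` says that its cells have `y = 1`.
    · have hr := Reads.right ha.2.2.1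
      rw [length_word, Gadget.length_hd] at hr
      simp only [if_true, Gadget.tl, cond_true] at hr
      have hpos : ∀ j : ℕ, j ≤ g.d - 1 → g.mpos q + ((g.K1 + 1) * c.ℓ : ℕ) + (j : ℤ) * c.ℓ =
          c.lpos e (k - (g.K0 + g.K1 + 1 + j)) := by
        intro j hj
        rw [← hcell _ (by have := g.two_le; omega), hm]; push_cast; ring
      choose z hz using h.cell
      let os : List (Option (Bool × Bool)) := List.ofFn fun j : Fin (g.d - 1) =>
        some (false, z (k - (g.K0 + g.K1 + 1 + j)))
      have hos : os.length = g.d - 1 := by simp [os]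
      have hne : os ≠ [] := by
        apply List.ne_nil_of_length_pos; have := g.two_le; omega
      have hw : Reads x (g.mpos q + ((g.K1 + 1) * c.ℓ : ℕ)) (c.word os ++ c.p) := by
        refine reads_word_of ?_ fun j hj => ?_
        · rw [hos, hpos _ le_rfl]
          exact (ct_eq_some.1 (hz _)).reads_p
        · rw [hpos j (by omega)]
          simp only [os, List.getElem_ofFn]
          exact (ct_eq_some.1 (hz _)).reads
      have hT : g.T m = c.word os :=
        hr.unique hw.left (by rw [g.T_len m ha.2.1, length_word, hos])
      have hf : foll X m = foll X (c.V none) := by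
        rw [← g.T_foll m ha.2.1, hT, c.foll_word hne]
      have hT' := g.T_eq m ha.2.1 hf
      have hd : g.d - 1 = (g.d - 2) + 1 := by have := g.two_le; omega
      rw [hT', hd, List.replicate_succ, word_cons] at hr
      have h4 := hz (k - (g.K0 + g.K1 + 1 + 0))
      rw [← hpos 0 (by omega)] at h4
      simp only [Nat.cast_zero, zero_mul, add_zero] at h4
      have h5 := reads_V_unique hr.left (ct_eq_some.1 h4).reads
      simp at h5
  · refine ⟨heq, ?_⟩
    cases b
    · rfl
    · exfalso
      have h2 := Gadget.mid_true_ct_zero ha.2.1 ha.2.2.1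
      rw [heq] at h2
      have h3 := mpos_kpos_add (g := g) (e := e) (j := 0) (by omega)
      rw [Nat.cast_zero, zero_mul, add_zero] at h3
      rw [h3, h.near _ (by omega)] at h2
      simp at h2
  -- A base or an exchanged word starting this late would need a cell at `e`, or a `00` among the
  -- cells `01` before `e`.
  · exfalso
    have hkK : k + 1 < g.K0 + g.K1 := by
      rw [← hend] at hgt
      simp only [kpos] at hgt
      have h3 : ((k + 1 : ℕ) : ℤ) * c.ℓ < ((g.K0 + g.K1 : ℕ) : ℤ) * c.ℓ := by
        push_cast at hgt ⊢; linarith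
      have := lt_of_mul_lt_mul_right h3 (by omega)
      omega
    have hkK0 : g.K0 ≤ k + 1 := by
      by_contra hcon
      have h2 := ha.1 (k + 1) (by omega)
      rw [hend, h.isNone] at h2
      simp at h2
    cases b
    · have h2 := Gadget.mid_false_ct ha.2.1 ha.2.2.1 (j := k + 1 - g.K0) (by omega)
      rw [hm, show ((k + 1 - g.K0 : ℕ) : ℤ) = (k + 1 : ℕ) - g.K0 by omega,
        show q + (g.K0 : ℤ) * c.ℓ + (((k + 1 : ℕ) : ℤ) - g.K0) * c.ℓ = q + ((k + 1 : ℕ) : ℤ) * c.ℓ by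
          ring, hend, h.isNone] at h2
      simp at h2
    · have h2 := Gadget.mid_true_ct_zero ha.2.1 ha.2.2.1
      rcases eq_or_lt_of_le hkK0 with h3 | h3
      · rw [hm, h3, hend, h.isNone] at h2
        simp at h2
      · rw [hm, hcell _ (by omega), h.near _ (by omega)] at h2
        simp at h2

end CellSystem

end OneDimShift

/-! ### Making exchanges possible, and right ends -/

namespace OneDimShift

open SymbolicDynamics.FullShift

theorem patch_congr_at {A : Type*} {x y : ℤ → A} {P Q : ℤ → List A → Prop} (hP : Compatible P)
    (hQ : Compatible Q) {k : ℤ} (hxy : x k = y k)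
    (h : ∀ i w, i ≤ k → k < i + w.length → (P i w ↔ Q i w)) : patch x P k = patch y Q k := by
  by_cases hc : ∃ i w, P i w ∧ i ≤ k ∧ k < i + w.length
  · obtain ⟨i, w, h1, h2, h3⟩ := hc
    exact (reads_patch (x := x) hP h1).eq_of (reads_patch (x := y) hQ ((h i w h2 h3).1 h1)) h2 h3
  · push Not at hc
    rw [patch_of_not, patch_of_not, hxy]
    · intro i w h1 h2 h3
      have := hc i w ((h i w h2 h3).2 h1) h2
      omega
    · intro i w h1 h2
      have := hc i w h1 h2
      omega

namespace CellSystem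

variable {A : Type*} [TopologicalSpace A] {X : Subshift A ℤ} {c : CellSystem X}
  {g : c.Gadget} {x y : ℤ → A} {e i q s : ℤ} {D al be : ℕ}

variable (c) in
/-- To the right of `s` there are `be` words `V none` and then only empty cells. -/
def RightEnd (x : ℤ → A) (s : ℤ) (be : ℕ) : Prop :=
  ∀ j : ℕ, c.vcell x (s + (j : ℤ) * c.ℓ) (if j < be then none else some (false, false))

theorem RightEnd.reads_p (h : c.RightEnd x s be) : Reads x s c.p := by
  have := (h 0).reads_p
  rwa [Nat.cast_zero, zero_mul, add_zero] at this

theorem RightEnd.shift (h : c.RightEnd x s be) (n : ℕ) : c.RightEnd x (s + n * c.ℓ) (be - n) := by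
  intro j
  have h1 := h (n + j)
  rw [show s + (n : ℤ) * c.ℓ + (j : ℤ) * c.ℓ = s + ((n + j : ℕ) : ℤ) * c.ℓ by push_cast; ring]
  have h2 : (j < be - n) ↔ (n + j < be) := by omega
  simpa only [h2] using h1

theorem RightEnd.eq_right (h : c.RightEnd x s be) (h' : c.RightEnd y s be) {k : ℤ} (hk : s ≤ k) :
    x k = y k := by
  have hℓ : (1 : ℤ) ≤ c.ℓ := by have := c.ℓ_pos; omega
  have h1 := Int.emod_nonneg (k - s) (b := (c.ℓ : ℤ)) (by omega)
  have h2 := Int.emod_lt_of_pos (k - s) (b := (c.ℓ : ℤ)) (by omega)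
  have h3 := Int.emod_add_mul_ediv (k - s) c.ℓ
  have h4 : 0 ≤ (k - s) / (c.ℓ : ℤ) := Int.ediv_nonneg (by omega) (by omega)
  have h5 : (((k - s) / (c.ℓ : ℤ)).toNat : ℤ) = (k - s) / (c.ℓ : ℤ) := Int.toNat_of_nonneg h4
  have h6 : s + (((k - s) / (c.ℓ : ℤ)).toNat : ℤ) * c.ℓ = k - (k - s) % (c.ℓ : ℤ) := by
    rw [h5]; linarith
  refine (h ((k - s) / (c.ℓ : ℤ)).toNat).reads.eq_of (h' _).reads (k := k) ?_ ?_
  · rw [h6]; linarith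
  · rw [c.len_V, h6]; linarith

theorem RightEnd.le_of_cell (h : c.RightEnd x s be) (hi : c.ct x i = some (false, true)) :
    i + c.ℓ ≤ s := by
  have hℓ : (1 : ℤ) ≤ c.ℓ := by have := c.ℓ_pos; omega
  have hv := ct_eq_some.1 hi
  by_contra hcon
  have hsi : s ≤ i := by
    by_contra hlt
    exact hcon (hv.le_of_lt h.reads_p (by omega))
  obtain ⟨j, -, rfl⟩ := exists_of_run (c := c) (q := s) (n := (i - s + 1).toNat) (fun j _ => ⟨_, h j⟩)
    hv.reads_p hsi (by rw [Int.toNat_of_nonneg (by omega)]; nlinarith)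
  have := hv.unique (h j)
  split_ifs at this
  simp at this

/-- At least one filler separates the empty cells from what lies before; at their left end `z = 0`
becomes `y = 0`. -/
theorem RightEnd.belt (h : c.RightEnd x s be) (hbe : 1 ≤ be) : c.RightEnd (c.belt x) s be := by
  intro j
  have hj := h j
  by_cases hb : j < be
  · rw [if_pos hb] at hj ⊢
    exact vcell_none_cellMap _ hj
  · rw [if_neg hb] at hj ⊢
    have h1 := h (j - 1)
    have h2 := h (j + 1)
    rw [if_neg (by omega)] at h2
    rw [show s + ((j - 1 : ℕ) : ℤ) * c.ℓ = s + (j : ℤ) * c.ℓ - c.ℓ by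
      rw [Nat.cast_sub (by omega)]; push_cast; ring] at h1
    rw [show s + ((j + 1 : ℕ) : ℤ) * c.ℓ = s + (j : ℤ) * c.ℓ + c.ℓ by push_cast; ring] at h2
    rw [← ct_eq_some] at hj h2 ⊢
    rw [ct_belt, hj, h2]
    split_ifs at h1 with h3
    · rw [h1.ct_none]; rfl
    · rw [ct_eq_some.2 h1]; rfl

theorem RightEnd.belt_iter (h : c.RightEnd x s be) (hbe : 1 ≤ be) (n : ℕ) :
    c.RightEnd (c.belt^[n] x) s be := by
  induction n with
  | zero => exact h
  | succ n ih => rw [Function.iterate_succ_apply']; exact ih.belt hbe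

/-- A base starting in the final part is longer than `2 * d` cells, so it covers the position `2 * d
* ℓ - 1` after `zpos q` by a cell beyond the rewritten word. That position does not depend on `s`.
-/
theorem exists_cell_of_base {w : List A} (hw : w.length = g.mlen)
    (hb : g.Base (splice x (g.mpos q) w) s) (h1 : g.zpos q ≤ s) (h2 : s < g.epos q) :
    ∃ i, i ≤ g.zpos q + 2 * g.d * c.ℓ - 1 ∧ g.zpos q + 2 * g.d * c.ℓ - 1 < i + c.ℓ ∧ g.epos q ≤ i ∧
      c.ct x i = some (false, true) := by
  have hℓ : (1 : ℤ) ≤ c.ℓ := by have := c.ℓ_pos; omega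
  have hK0 := g.le_K0
  have he : g.epos q = g.zpos q + g.d * c.ℓ := by simp only [Gadget.epos, Gadget.zpos]; ring
  set r := g.zpos q + 2 * g.d * c.ℓ - 1 - s with hr
  have h3 := Int.emod_nonneg r (b := (c.ℓ : ℤ)) (by omega)
  have h4 := Int.emod_lt_of_pos r (b := (c.ℓ : ℤ)) (by omega)
  have h5 := Int.emod_add_mul_ediv r c.ℓ
  have h6 : (g.d : ℤ) ≤ r / c.ℓ := by
    rw [Int.le_ediv_iff_mul_le (by omega)]; linarith
  have h7 : r / c.ℓ < 2 * g.d := by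
    rw [Int.ediv_lt_iff_lt_mul (by omega)]; linarith
  have h8 : ((r / c.ℓ).toNat : ℤ) = r / c.ℓ := Int.toNat_of_nonneg (by omega)
  have h9 := hb (r / c.ℓ).toNat (by omega)
  rw [h8] at h9
  have h10 : g.epos q ≤ s + r / c.ℓ * c.ℓ := by nlinarith
  refine ⟨s + r / c.ℓ * c.ℓ, by linarith, by linarith, h10, ?_⟩
  rw [← h9]
  refine ct_congr fun k hk _ => (splice_of_not (Or.inr ?_)).symm
  rw [hw, ← Gadget.epos_eq]; linarith

theorem reads_mid_false (h : Primed g x e) {m : List A} (hm : Reads x e m) (hp : c.p <+: m) :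
    Reads x (g.mpos (kpos g e)) (g.mid m false) := by
  have h1 : Reads x (g.mpos (kpos g e)) (c.word (List.replicate g.K1 (some (false, true))) ++ c.p) := by
    refine reads_word_of ?_ fun j hj => ?_
    · rw [List.length_replicate, mpos_kpos, sub_add_cancel]; exact hm.of_prefix hp
    · rw [List.length_replicate] at hj
      rw [mpos_kpos_add hj, List.getElem_replicate]
      exact (ct_eq_some.1 (h.near _ (by omega))).reads
  refine reads_append.2 ⟨h1.left, ?_⟩
  simp only [Gadget.hd, Gadget.tl, cond_false, length_word, List.length_replicate]
  rw [mpos_kpos]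
  push_cast
  rwa [sub_add_cancel]

/-- Applying the belt map sufficiently often allows an exchange at the right end of a run. -/
theorem LeftRun.exists_active (hx : x ∈ X.carrier) (h : c.LeftRun x e D) (he : c.ct x e = none)
    (n0 : ℕ) : ∃ n ≥ n0, g.Active (c.belt^[n] x) (kpos g e)
      (subword (c.belt^[n] x) e (g.d * c.ℓ)) false := by
  have hℓ : (1 : ℤ) ≤ c.ℓ := by have := c.ℓ_pos; omega
  have hd := g.two_le
  by_contra hcon
  push Not at hcon
  -- Once the run is primed, only an unwanted base can prevent activity, and it puts a cell `01`
  -- over a fixed position.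
  have key : ∀ n, n0 + D + g.K0 + g.K1 ≤ n → ∃ i, i ≤ e + 2 * g.d * c.ℓ - 1 ∧
      e + 2 * g.d * c.ℓ - 1 < i + c.ℓ ∧ e + g.d * c.ℓ ≤ i ∧
      c.ct (c.belt^[n] x) i = some (false, true) := by
    intro n hn
    have hpr : Primed g (c.belt^[n] x) e := h.primed he (by omega)
    set m := subword (c.belt^[n] x) e (g.d * c.ℓ) with hmdef
    have hmr : Reads (c.belt^[n] x) e m := reads_subword _ _ _
    have hml : m.length = g.d * c.ℓ := length_subword _ _ _
    have hp2 := c.length_p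
    have hmp : c.p <+: m := Reads.prefix_of_le (h.belt_iter he n).reads_p hmr (by rw [hml]; nlinarith)
    have hmM : m ∈ g.M := by
      refine ⟨hmr.mem_language (belt_iter_mem hx n), hml, hmp, fun b hb => ?_⟩
      have h1 := hmr.of_prefix hb
      have h2 := hpr.isNone
      rw [ct_eq_none] at h2
      exact h2 b h1
    by_contra hno
    refine hcon n (by omega) ⟨hpr.base, hmM, reads_mid_false hpr hmr hmp, fun b' s h1 h2 hb => hno ?_⟩
    have h3 := exists_cell_of_base (Gadget.length_mid hmM) hb h1 h2
    rwa [zpos_kpos, epos_kpos] at h3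
  obtain ⟨i, hi1, hi2, hi3, hi4⟩ := key _ le_rfl
  have hsome : ∀ n j, c.ct (c.belt^[n] x) j = some (false, true) → ∃ b, c.vcell x j (some b) := by
    intro n j hj
    have h1 := isSome_belt_iter (c := c) x j n
    rw [hj] at h1
    obtain ⟨b, hb⟩ := Option.isSome_iff_exists.1 h1.symm
    exact ⟨b, ct_eq_some.1 hb⟩
  obtain ⟨b, hb⟩ := hsome _ _ hi4
  have hev : ∀ n ≥ n0 + D + g.K0 + g.K1, c.ct (c.belt^[n] x) i = some (false, true) := by
    intro n hn
    obtain ⟨j, hj1, hj2, hj3, hj4⟩ := key n hn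
    obtain ⟨b', hb'⟩ := hsome _ _ hj4
    obtain rfl := hb.eq_of_overlap hb' hi1 hi2 hj1 hj2
    exact hj4
  -- Cells do not move, so it is one and the same cell that stays `01` forever. Its run has no left
  -- end and hence reaches back to `e`, where there is no cell.
  have hall := ne_none_of_eventually hev
  have hpos : 0 ≤ (i - e) / (c.ℓ : ℤ) := Int.ediv_nonneg (by nlinarith) (by omega)
  have h1 := hall ((i - e) / (c.ℓ : ℤ)).toNat
  have h2 := hall (((i - e) / (c.ℓ : ℤ)).toNat + 1)
  have h3 := Int.emod_nonneg (i - e) (b := (c.ℓ : ℤ)) (by omega)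
  have h4 := Int.emod_lt_of_pos (i - e) (b := (c.ℓ : ℤ)) (by omega)
  have h5 := Int.emod_add_mul_ediv (i - e) c.ℓ
  rw [Nat.cast_add, Int.toNat_of_nonneg hpos, Nat.cast_one] at h2
  rw [Int.toNat_of_nonneg hpos] at h1
  obtain ⟨d', hd'⟩ := Option.ne_none_iff_exists'.1 h2
  have h6 := (ct_eq_some.1 hd').le_of_lt h.reads_p (by linarith)
  have h7 : i - (i - e) / (c.ℓ : ℤ) * c.ℓ = e := by linarith
  rw [h7] at h1
  exact h1 he

theorem LeftRun.extend (h : c.LeftRun x e D) {b} (hb : c.ct x e = some b) :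
    c.LeftRun x (e + c.ℓ) (D + 1) := by
  have h0 : c.lpos (e + c.ℓ) 0 = e := by simp [lpos]
  have h1 : ∀ k, c.lpos (e + c.ℓ) (k + 1) = c.lpos e k := fun k => by
    simp only [lpos]; push_cast; ring
  refine ⟨fun k => ?_, fun k hk => ?_⟩
  · cases k with
    | zero => rw [h0]; exact ⟨b, hb⟩
    | succ k => rw [h1]; exact h.cell k
  · obtain ⟨k, rfl⟩ : ∃ k', k = k' + 1 := ⟨k - 1, by omega⟩
    rw [h1]; exact h.far k (by omega)

theorem LeftRun.extend_n (h : c.LeftRun x e D) (n : ℕ)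
    (hb : ∀ j < n, ∃ b, c.ct x (e + (j : ℕ) * c.ℓ) = some b) :
    c.LeftRun x (e + n * c.ℓ) (D + n) := by
  induction n with
  | zero => simpa using h
  | succ n ih =>
    obtain ⟨b, hb'⟩ := hb n (by omega)
    have := (ih fun j hj => hb j (by omega)).extend hb'
    rwa [show e + (n : ℤ) * c.ℓ + c.ℓ = e + ((n + 1 : ℕ) : ℤ) * c.ℓ by push_cast; ring] at this

theorem vcell_swap_of_not {o : Option (Bool × Bool)} (hv : c.vcell x i o)
    (ho : o = none ∨ o = some (false, false)) (hQ : ∀ t, g.mids x t → i < t ∨ t + g.mlen ≤ i) :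
    c.vcell (g.swap x) i o := by
  by_cases hi : ∃ b b', g.openCells x i b b'
  · obtain ⟨b, b', hi⟩ := hi
    have h1 := hv.unique hi.1
    rcases ho with rfl | rfl
    · simp at h1
    · have h2 := (Gadget.rel_swap x).vcell' hi
      rw [hi.2.2, ← Option.some.inj h1] at h2
      exact h2
  · exact (Gadget.rel_swap x).vcell_of_not hv hQ fun b b' hbb => hi ⟨b, b', hbb⟩

/-- The effect of the swap map on the cells of a primed run. -/
theorem Primed.ct_swap (hl : c.LeftRun x e D) (h : Primed g x e) (k : ℕ) :
    ∃ b, c.ct (g.swap x) (c.lpos e k) = some b ∧ (g.K1 ≤ k → c.ct x (c.lpos e k) = some b) := by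
  have hℓ : (1 : ℤ) ≤ c.ℓ := by have := c.ℓ_pos; omega
  obtain ⟨z, hz⟩ := h.cell k
  by_cases hc : (∃ m, g.Active x (kpos g e) m false) ∧ k < g.K1
  · obtain ⟨⟨m, hm⟩, hk⟩ := hc
    have h1 := Gadget.mid_true_ct (j := g.K1 - 1 - k) hm.2.1 hm.reads_swap (by omega)
    rw [mpos_kpos_add (by omega), show g.K1 - 1 - (g.K1 - 1 - k) = k by omega] at h1
    exact ⟨_, h1, fun h2 => absurd h2 (by omega)⟩
  · refine ⟨(false, z), (Gadget.rel_swap x).ct_01 Gadget.openCells_addTrack ?_ hz, fun _ => hz⟩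
    rintro t ⟨q, m, b, ha, rfl⟩
    left
    have h2 := lpos_lt (c := c) e k
    rcases lt_or_ge q e with hq | hq
    · obtain ⟨rfl, rfl⟩ := h.eq_of_active hl ha hq
      have h3 : g.K1 ≤ k := by
        by_contra h4
        exact hc ⟨⟨m, ha⟩, by omega⟩
      rw [mpos_kpos]
      have h5 : (g.K1 : ℤ) + 1 ≤ (k : ℤ) + 1 := by omega
      simp only [lpos]
      nlinarith
    · have := g.le_mpos q
      linarith

theorem Primed.leftRun_swap (hl : c.LeftRun x e D) (h : Primed g x e) :
    c.LeftRun (g.swap x) e (D + g.K1) where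
  cell k := by
    obtain ⟨b, hb, -⟩ := h.ct_swap hl k
    exact ⟨b, hb⟩
  far k hk := by
    obtain ⟨b, hb, h1⟩ := h.ct_swap hl k
    rw [hb, ← h1 (by omega), hl.far k (by omega)]

theorem Primed.leftRun_swap_succ (hl : c.LeftRun x e D) (h : Primed g x e) {m : List A}
    (ha : g.Active x (kpos g e) m false) : c.LeftRun (g.swap x) (e + c.ℓ) (D + g.K1 + 1) := by
  refine (h.leftRun_swap hl).extend (b := (false, false)) ?_
  have h1 := Gadget.mid_true_ct_last ha.2.1 ha.reads_swap
  rwa [mpos_kpos, sub_add_cancel] at h1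

/-- By `T_eq` the whole of `m` is replaced by cells, so the run grows by `d` cells at once. -/
theorem Primed.leftRun_swap_d (hl : c.LeftRun x e D) (h : Primed g x e) {m : List A}
    (ha : g.Active x (kpos g e) m false) (hf : foll X m = foll X (c.V none))
    (hp : Reads (g.swap x) (e + g.d * c.ℓ) c.p) :
    c.LeftRun (g.swap x) (e + g.d * c.ℓ) (D + g.K1 + 1 + (g.d - 1)) := by
  have hd := g.two_le
  have e1 : e + (g.d : ℤ) * c.ℓ = e + c.ℓ + ((g.d - 1 : ℕ) : ℤ) * c.ℓ := by
    rw [Nat.cast_sub (by omega)]; push_cast; ring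
  rw [e1]
  refine (h.leftRun_swap_succ hl ha).extend_n _ fun j hj => ⟨(true, false), ?_⟩
  have hr := Reads.right ha.reads_swap
  rw [length_word, Gadget.length_hd] at hr
  simp only [Bool.not_false, if_true, Gadget.tl, cond_true] at hr
  rw [g.T_eq m ha.2.1 hf, mpos_kpos] at hr
  rw [show e - (g.K1 : ℤ) * c.ℓ + (((g.K1 + 1) * c.ℓ : ℕ) : ℤ) = e + c.ℓ by push_cast; ring] at hr
  have hw : Reads (g.swap x) (e + c.ℓ)
      (c.word (List.replicate (g.d - 1) (some (true, false))) ++ c.p) := by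
    refine reads_append.2 ⟨hr, ?_⟩
    rw [length_word, List.length_replicate]
    push_cast
    rwa [← e1]
  have h1 := reads_word hw j (by simpa using hj)
  rw [List.getElem_replicate] at h1
  exact ct_eq_some.2 h1

/-- Where exchanges are made, if the run to the left of `e` is primed. -/
theorem Primed.mids_cases (hl : c.LeftRun x e D) (h : Primed g x e) (hr : c.RightEnd x s be) {t : ℤ}
    (ht : g.mids x t) : t = g.mpos (kpos g e) ∨ (∃ q, t = g.mpos q ∧ e ≤ q ∧ t ≤ s) := by
  obtain ⟨q, m, b, ha, rfl⟩ := ht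
  rcases lt_or_ge q e with hq | hq
  · obtain ⟨rfl, rfl⟩ := h.eq_of_active hl ha hq
    exact Or.inl rfl
  · right
    refine ⟨q, rfl, hq, ?_⟩
    have hK0 := g.le_K0
    have h1 := hr.le_of_cell (ha.1 (g.K0 - 1) (by omega))
    rw [Nat.cast_sub (by omega), Nat.cast_one] at h1
    simp only [Gadget.mpos]
    linarith

end CellSystem

end OneDimShift

/-! ### What happens to the right of a run -/

namespace OneDimShift

open SymbolicDynamics.FullShift

/-- `x` and `y` agree from `e` on. -/
def RAgree {A : Type*} (x y : ℤ → A) (e : ℤ) : Prop := ∀ k, e ≤ k → x k = y k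

theorem RAgree.symm {A : Type*} {x y : ℤ → A} {e : ℤ} (h : RAgree x y e) : RAgree y x e :=
  fun k hk => (h k hk).symm

theorem RAgree.reads {A : Type*} {x y : ℤ → A} {e i : ℤ} {w : List A} (h : RAgree x y e)
    (hr : Reads x i w) (hi : e ≤ i) : Reads y i w :=
  hr.congr fun k h1 _ => h k (by omega)

theorem RAgree.splice {A : Type*} {x y : ℤ → A} {e : ℤ} (h : RAgree x y e) (t : ℤ) (w : List A) :
    RAgree (splice x t w) (splice y t w) e := by
  intro k hk
  by_cases hc : t ≤ k ∧ k < t + w.length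
  · exact (reads_splice x t w).eq_of (reads_splice y t w) hc.1 hc.2
  · rw [splice_of_not (by omega), splice_of_not (by omega)]
    exact h k hk

namespace CellSystem

variable {A : Type*} [TopologicalSpace A] {X : Subshift A ℤ} {c : CellSystem X}
  {g : c.Gadget} {x y : ℤ → A} {e i q s : ℤ} {D D' al be : ℕ} {m : List A} {b : Bool}

theorem _root_.OneDimShift.RAgree.ct (h : RAgree x y e) (hi : e ≤ i) : c.ct x i = c.ct y i :=
  ct_congr fun k hk _ => h _ (by omega)

theorem _root_.OneDimShift.RAgree.base (h : RAgree x y e) (hq : e ≤ q) (hb : g.Base x q) :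
    g.Base y q := by
  intro j hj
  have : (0 : ℤ) ≤ (j : ℤ) * c.ℓ := by positivity
  rw [← hb j hj, h.ct (by omega)]

theorem _root_.OneDimShift.RAgree.key (h : RAgree x y e) (hq : e ≤ q) (hb : g.Key x q) :
    g.Key y q := by
  have h1 := g.le_mpos q
  have h2 := g.mpos_le_zpos q
  refine ⟨h.base hq hb.1, ?_⟩
  rw [← h.ct (by omega), ← h.ct (i := g.zpos q) (by omega)]
  refine hb.2.imp_right fun ⟨h3, h4⟩ => ⟨fun j hj => ?_, h4⟩
  have : (0 : ℤ) ≤ (j : ℤ) * c.ℓ := by positivity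
  rw [← h3 j hj, h.ct (by omega)]

theorem _root_.OneDimShift.RAgree.active (h : RAgree x y e) (hq : e ≤ q) (ha : g.Active x q m b) :
    g.Active y q m b := by
  have h1 := g.le_mpos q
  have h2 := g.mpos_le_zpos q
  refine ⟨h.base hq ha.1, ha.2.1, h.reads ha.2.2.1 (by omega), fun b' s h3 h4 hs => ?_⟩
  exact ha.2.2.2 b' s h3 h4 ((h.symm.splice _ _).base (by omega) hs)

theorem LeftRun.add_le (h : c.LeftRun x e D) (hq : Reads x q c.p) (hqe : q < e) : q + c.ℓ ≤ e := by
  obtain ⟨k, rfl⟩ := h.exists_lpos hq hqe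
  exact lpos_lt e k

theorem LeftRun.mpos_le (h : c.LeftRun x e D) (he : c.ct x e = none) (hb : g.Base x q)
    (hq : q < e) : g.mpos q ≤ e := by
  obtain ⟨k, hk⟩ := h.exists_lpos hb.reads_p hq
  by_contra hcon
  have hℓ : (0 : ℤ) ≤ c.ℓ := by omega
  have h1 : k + 1 < g.K0 := by
    by_contra h1
    have h2 : (g.K0 : ℤ) ≤ k + 1 := by omega
    simp only [Gadget.mpos, hk, lpos] at hcon
    nlinarith
  have h3 := hb (k + 1) h1
  rw [hk, show c.lpos e k + ((k + 1 : ℕ) : ℤ) * c.ℓ = e by simp only [lpos]; push_cast; ring, he] at h3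
  simp at h3

/-- On the right of a run, rules for cells only depend on what is there. -/
theorem _root_.OneDimShift.RAgree.cellMap (h : RAgree x y e) (hx : c.LeftRun x e D)
    (hy : c.LeftRun y e D') (he : c.ct x e = none) (r : Rule) :
    RAgree (c.cellMap r x) (c.cellMap r y) e := by
  have key : ∀ {x y : ℤ → A} {D D'}, RAgree x y e → c.LeftRun x e D → c.LeftRun y e D' →
      c.ct x e = none → ∀ k, e ≤ k → ∀ i w, i ≤ k → k < i + w.length →
      (∃ b, c.vcell x i (some b) ∧ w = c.V (some (c.newCt r x i b))) →
      ∃ b, c.vcell y i (some b) ∧ w = c.V (some (c.newCt r y i b)) := by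
    rintro x y D D' h hx hy he k hk i w h1 h2 ⟨b, hb, rfl⟩
    rw [c.len_V] at h2
    have hi : e ≤ i := by
      by_contra hcon
      have := hx.add_le hb.reads_p (by omega)
      omega
    have hne : i ≠ e := by
      rintro rfl
      rw [ct_eq_some.2 hb] at he
      simp at he
    refine ⟨b, h.reads hb hi, ?_⟩
    have hl : c.ct x (i - c.ℓ) = c.ct y (i - c.ℓ) := by
      by_cases hle : e ≤ i - c.ℓ
      · exact h.ct hle
      · have hn : ∀ {z : ℤ → A} {D}, c.LeftRun z e D → c.ct z (i - c.ℓ) = none := by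
          intro z D hz
          refine ct_eq_none.2 fun d hd => ?_
          have := hz.add_le hd.reads_p (by omega)
          omega
        rw [hn hx, hn hy]
    simp only [newCt]
    rw [hl, h.ct (i := i + c.ℓ) (by omega)]
  intro k hk
  exact patch_congr_at (compatible_cells _ fun _ _ => c.len_V _)
    (compatible_cells _ fun _ _ => c.len_V _) (h k hk) fun i w h1 h2 =>
    ⟨key h hx hy he k hk i w h1 h2, key h.symm hy hx (by rw [← h.ct le_rfl, he]) k hk i w h1 h2⟩

/-- On the right of a run, with some distance, the swap map only depends on what is there. -/
theorem _root_.OneDimShift.RAgree.swap (h : RAgree x y e) (hx : c.LeftRun x e D)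
    (hy : c.LeftRun y e D') (he : c.ct x e = none) :
    RAgree (g.swap x) (g.swap y) (e + (g.K1 + g.d + 1) * c.ℓ) := by
  have hℓ : (1 : ℤ) ≤ c.ℓ := by have := c.ℓ_pos; omega
  have hpos : 0 ≤ ((g.K1 : ℤ) + g.d) * c.ℓ := by positivity
  -- A base starting before `e` must end by `e`, so its zone ends by `e + (K1 + d) * ℓ`; one more
  -- `ℓ` in the bound takes care of a cell that straddles this position.
  have hep : ∀ {x : ℤ → A} {D q}, c.LeftRun x e D → c.ct x e = none → g.Base x q → q < e →
      g.epos q ≤ e + (g.K1 + g.d) * c.ℓ := by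
    intro x D q hx he hb hq
    have h1 := hx.mpos_le he hb hq
    rw [Gadget.epos_eq]
    push_cast
    linarith
  have key : ∀ {x y : ℤ → A} {D D'}, RAgree x y e → c.LeftRun x e D → c.LeftRun y e D' →
      c.ct x e = none → ∀ k, e + (g.K1 + g.d + 1) * c.ℓ ≤ k → ∀ i w, i ≤ k → k < i + w.length →
      g.writes x i w → g.writes y i w := by
    rintro x y D D' h hx hy he k hk i w h1 h2 (⟨q, m, b, ha, rfl, rfl⟩ | ⟨b, b', hb, rfl⟩)
    · refine Or.inl ⟨q, m, b, h.active ?_ ha, rfl, rfl⟩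
      by_contra hcon
      have h3 := hep hx he ha.1 (by omega)
      rw [Gadget.length_mid ha.2.1] at h2
      rw [Gadget.epos_eq] at h3
      have h4 : k < g.mpos q + g.mlen := h2
      linarith
    · rw [c.len_V] at h2
      have hi : e + (g.K1 + g.d) * c.ℓ < i := by linarith
      refine Or.inr ⟨b, b', ⟨h.reads hb.1 (by omega), fun q hq => ?_, hb.2.2⟩, rfl⟩
      rcases lt_or_ge q e with h3 | h3
      · have := hep hy (by rw [← h.ct le_rfl, he]) hq.1 h3
        right; omega
      · exact hb.2.1 q (h.symm.key h3 hq)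
  intro k hk
  exact patch_congr_at (Gadget.compatible_writes x) (Gadget.compatible_writes y)
    (h k (by linarith)) fun i w h1 h2 =>
    ⟨key h hx hy he k hk i w h1 h2, key h.symm hy hx (by rw [← h.ct le_rfl, he]) k hk i w h1 h2⟩

theorem RightEnd.congr (hr : c.RightEnd x s be) (h : RAgree x y e) (hs : e ≤ s) :
    c.RightEnd y s be := by
  intro j
  have : (0 : ℤ) ≤ (j : ℤ) * c.ℓ := by positivity
  exact h.reads (hr j) (by omega)

/-- On the right of `e` the inverse belt map depends only on what is there, so common iterations can
be cancelled. -/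
theorem LeftRun.rAgree_of_iterate (hx : c.LeftRun x e D) (he : c.ct x e = none) (n m : ℕ)
    (h : RAgree (c.belt^[n] x) (c.belt^[n + m] x) e) : RAgree x (c.belt^[m] x) e := by
  induction n with
  | zero => simpa using h
  | succ n ih =>
    apply ih
    rw [Nat.add_right_comm, Function.iterate_succ_apply', Function.iterate_succ_apply'] at h
    have h1 : ∀ n, c.LeftRun (c.belt (c.belt^[n] x)) e (D + (n + 1)) := fun n => by
      have := hx.belt_iter he (n + 1)
      rwa [Function.iterate_succ_apply'] at this
    have h2 := (hx.iterate he (n + 1)).1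
    rw [Function.iterate_succ_apply'] at h2
    have h3 := h.cellMap (h1 n) (h1 (n + m)) h2 beltRuleInv
    have h4 : ∀ z : ℤ → A, c.cellMap beltRuleInv (c.belt z) = z := beltInv_belt
    rwa [h4, h4] at h3

/-- The right part of a point with a right end returns under the belt map. -/
theorem LeftRun.exists_rAgree [Finite A] (hx : c.LeftRun x e D) (he : c.ct x e = none)
    (hr : c.RightEnd x s be) (hbe : 1 ≤ be) (L : ℕ) : ∃ n ≥ L, RAgree x (c.belt^[n] x) e := by
  -- From `s` on the belt changes nothing, so the right part has finitely many states, and the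
  -- pigeonhole principle applies.
  let f : ℕ → Fin (s - e).toNat → A := fun n k => c.belt^[n] x (e + (k : ℕ))
  obtain ⟨v, hv⟩ := Finite.exists_infinite_fiber f
  have hinf : (f ⁻¹' {v}).Infinite := Set.infinite_coe_iff.1 hv
  obtain ⟨n, hn⟩ := hinf.nonempty
  obtain ⟨m, hm, hnm⟩ := hinf.exists_gt (n + L)
  refine ⟨m - n, by omega, hx.rAgree_of_iterate he n _ fun k hk => ?_⟩
  rw [show n + (m - n) = m by omega]
  rcases lt_or_ge k s with hks | hks
  · have h1 : f n = f m := by rw [hn, hm]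
    have h2 := congrFun h1 ⟨(k - e).toNat, by omega⟩
    simp only [f] at h2
    rwa [show e + ((k - e).toNat : ℤ) = k by omega] at h2
  · exact (hr.belt_iter hbe n).eq_right (hr.belt_iter hbe m) hks

end CellSystem

end OneDimShift

/-! ### Fixing framed points -/

namespace OneDimShift

open SymbolicDynamics.FullShift

namespace CellSystem

variable {A : Type*} [TopologicalSpace A] {X : Subshift A ℤ} {c : CellSystem X}
  {g : c.Gadget} {x y : ℤ → A} {e i q s : ℤ} {D D' al be : ℕ} {m : List A} {b : Bool}
  {h : (ℤ → A) → (ℤ → A)}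

/-- Belt and swap are injective and commute with `h`, so being fixed passes back from the image to
the point. -/
theorem Commuting.fix_of_swap_belt (hh : Commuting g h) (hx : x ∈ X.carrier) (n : ℕ)
    (h1 : h (g.swap (c.belt^[n] x)) = g.swap (c.belt^[n] x)) : h x = x := by
  apply belt_injective.iterate n
  rw [← hh.belt_iter hx, ← Gadget.swap_swap (g := g) (h (c.belt^[n] x)),
    ← hh.map_swap _ (belt_iter_mem hx n), h1, Gadget.swap_swap]

theorem RightEnd.swap (hr : c.RightEnd x s be) (hm : ∀ t, g.mids x t → t + g.mlen ≤ s) :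
    c.RightEnd (g.swap x) s be := by
  intro j
  have : (0 : ℤ) ≤ (j : ℤ) * c.ℓ := by positivity
  refine vcell_swap_of_not (hr j) ?_ fun t ht => Or.inr (by have := hm t ht; omega)
  split_ifs <;> simp

/-- A word that reaches into the right end of a point has the same followers as the words `V`. -/
theorem RightEnd.foll_eq (hx : x ∈ X.carrier) (hr : c.RightEnd x (e + al * c.ℓ) be) {d : ℕ}
    (hd : al < d) : foll X (subword x e (d * c.ℓ)) = foll X (c.V none) := by
  let os : List (Option (Bool × Bool)) :=
    List.ofFn fun j : Fin (d - al) => if (j : ℕ) < be then none else some (false, false)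
  have hos : os.length = d - al := by simp [os]
  have hne : os ≠ [] := List.ne_nil_of_length_pos (by omega)
  have hw : Reads x (e + al * c.ℓ) (c.word os ++ c.p) := by
    refine reads_word_of ?_ fun j hj => ?_
    · rw [hos]; exact (hr _).reads_p
    · simp only [os, List.getElem_ofFn]
      exact (hr j).reads
  have h1 : subword x e (d * c.ℓ) = subword x e (al * c.ℓ) ++ c.word os := by
    refine (reads_subword x e (d * c.ℓ)).unique (reads_append.2 ⟨reads_subword _ _ _, ?_⟩) ?_
    · rw [length_subword]; push_cast; exact hw.left
    · rw [List.length_append, length_subword, length_subword, length_word, hos, ← add_mul]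
      congr 1; omega
  have h2 : subword x e (d * c.ℓ) ∈ language X := (reads_subword _ _ _).mem_language hx
  rw [h1] at h2 ⊢
  rw [c.sync.foll_append (c.pre_word hne) h2, c.foll_word hne]

variable (c) in
/-- A point with an infinite run of cells up to `e` and a right end `al` cells later. -/
structure Framed (x : ℤ → A) (e : ℤ) (al be : ℕ) : Prop where
  mem : x ∈ X.carrier
  left : ∃ D, c.LeftRun x e D
  right : c.RightEnd x (e + al * c.ℓ) be

theorem Framed.step_cell (hf : c.Framed x e al be) (h1 : 1 ≤ al) {d} (he : c.ct x e = some d) :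
    c.Framed x (e + c.ℓ) (al - 1) be where
  mem := hf.mem
  left := by
    obtain ⟨D, hD⟩ := hf.left
    exact ⟨_, hD.extend he⟩
  right := by
    have := hf.right
    rwa [show e + (c.ℓ : ℤ) + ((al - 1 : ℕ) : ℤ) * c.ℓ = e + (al : ℤ) * c.ℓ by
      rw [Nat.cast_sub h1]; push_cast; ring]

theorem Framed.exists_active (hf : c.Framed x e al be) (he : c.ct x e = none) :
    ∃ n D, c.LeftRun (c.belt^[n] x) e D ∧ Primed g (c.belt^[n] x) e ∧
      g.Active (c.belt^[n] x) (kpos g e) (subword (c.belt^[n] x) e (g.d * c.ℓ)) false := by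
  obtain ⟨D, hD⟩ := hf.left
  obtain ⟨n, hn, ha⟩ := hD.exists_active (g := g) hf.mem he (D + g.K0 + g.K1)
  exact ⟨n, _, hD.belt_iter he n, hD.primed he hn, ha⟩

theorem Commuting.fix_of_cells (hh : Commuting g h)
    (hfix : ∀ S T, h (c.pt (chi S) (chi T)) = c.pt (chi S) (chi T))
    (hx : x ∈ X.carrier) (hl : c.LeftRun x e D) (hr : c.RightEnd x e 0) : h x = x := by
  have hcell : ∀ j : ℤ, ∃ b, c.ct x (e + j * c.ℓ) = some b ∧
      ((j < -D ∨ D < j) → b = (false, false)) := by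
    intro j
    rcases lt_or_ge j 0 with hj | hj
    · have e1 : e + j * (c.ℓ : ℤ) = c.lpos e (-j - 1).toNat := by
        simp only [lpos]
        rw [Int.toNat_of_nonneg (by omega)]; ring
      obtain ⟨b, hb⟩ := hl.cell (-j - 1).toNat
      refine ⟨b, by rw [e1, hb], fun h1 => ?_⟩
      have := hl.far (-j - 1).toNat (by omega)
      rw [hb] at this
      exact Option.some.inj this
    · have h1 := hr j.toNat
      rw [Int.toNat_of_nonneg hj, if_neg (by omega)] at h1
      exact ⟨_, ct_eq_some.2 h1, fun _ => rfl⟩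
  choose b hb hb0 using hcell
  have hpt : sh e x = c.pt (fun j => (b j).1) fun j => (b j).2 :=
    eq_pt_of_ct fun j => by rw [ct_sh]; exact hb j
  obtain ⟨S, hS⟩ := exists_chi (y := fun j => (b j).1) (B := D) fun j hj => by
    simp only [hb0 j hj]
  obtain ⟨T, hT⟩ := exists_chi (y := fun j => (b j).2) (B := D) fun j hj => by
    simp only [hb0 j hj]
  have h1 := hfix S T
  rw [← hS, ← hT, ← hpt, hh.map_sh _ hx] at h1
  have h2 := congrArg (sh (-e)) h1
  rwa [sh_sh, sh_sh, add_neg_cancel, sh_zero, sh_zero] at h2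

/-- When the gap is shorter than a base, the exchange at the end of the run is the only one, and `al
+ be` can be lowered until only cells remain. -/
theorem Commuting.fix_of_short [Finite A] (hh : Commuting g h)
    (hfix : ∀ S T, h (c.pt (chi S) (chi T)) = c.pt (chi S) (chi T)) :
    ∀ (n : ℕ) {x : ℤ → A} {e : ℤ} {al be : ℕ}, al + be ≤ n → c.Framed x e al be → al + 1 ≤ g.K0 →
      (1 ≤ be ∨ al = 0) → h x = x := by
  intro n
  induction n with
  | zero =>
    intro x e al be hn hf _ _
    obtain ⟨D, hD⟩ := hf.left
    obtain rfl : al = 0 := by omega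
    obtain rfl : be = 0 := by omega
    have := hf.right
    simp only [Nat.cast_zero, zero_mul, add_zero] at this
    exact hh.fix_of_cells hfix hf.mem hD this
  | succ n ih =>
    intro x e al be hn hf hal hbe
    have hℓ : (1 : ℤ) ≤ c.ℓ := by have := c.ℓ_pos; omega
    by_cases h0 : al = 0 ∧ be = 0
    · exact ih (by omega) hf hal hbe
    have hbe1 : 1 ≤ be := by omega
    have hd := g.two_le
    cases he : c.ct x e with
    | some d =>
      have h1 : 1 ≤ al := by
        by_contra h1
        obtain rfl : al = 0 := by omega
        have h2 := hf.right 0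
        rw [if_pos (by omega), Nat.cast_zero, zero_mul, add_zero, add_zero] at h2
        rw [h2.ct_none] at he
        simp at he
      exact ih (by omega) (hf.step_cell h1 he) (by omega) (Or.inl hbe1)
    | none =>
      obtain ⟨k, D, hl, hp, ha⟩ := hf.exists_active (g := g) he
      apply hh.fix_of_swap_belt hf.mem k
      have hr := hf.right.belt_iter hbe1 k
      have hx := belt_iter_mem (c := c) hf.mem k
      set x1 := c.belt^[k] x with hx1
      have hmid : ∀ t, g.mids x1 t → t + g.mlen = e + g.d * c.ℓ := by
        intro t ht
        rcases hp.mids_cases hl hr ht with rfl | ⟨q, rfl, h2, h3⟩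
        · rw [mpos_kpos]; push_cast; ring
        · exfalso
          simp only [Gadget.mpos] at h3
          have h4 : (al : ℤ) + 1 ≤ g.K0 := by omega
          nlinarith
      -- If the exchanged word ends within the gap, the run gains one cell and the right end is
      -- untouched.
      by_cases hda : g.d ≤ al
      · refine ih (al := al - 1) (be := be) (by omega)
          ⟨Gadget.swap_mem hx, ⟨_, hp.leftRun_swap_succ hl ha⟩, ?_⟩ (by omega) (Or.inl hbe1)
        rw [show e + (c.ℓ : ℤ) + ((al - 1 : ℕ) : ℤ) * c.ℓ = e + (al : ℤ) * c.ℓ by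
          rw [Nat.cast_sub (by omega)]; push_cast; ring]
        refine hr.swap fun t ht => ?_
        rw [hmid t ht]
        have : (g.d : ℤ) ≤ al := by omega
        nlinarith
      -- Otherwise `m` reaches into the right end and so has the followers of `V none`; all of it
      -- becomes cells, at the cost of `d - al` of the fillers.
      · have hr2 := hr.shift (g.d - al)
        rw [show e + (al : ℤ) * c.ℓ + ((g.d - al : ℕ) : ℤ) * c.ℓ = e + g.d * c.ℓ by
          rw [Nat.cast_sub (by omega)]; ring] at hr2
        have hr3 := hr2.swap fun t ht => (hmid t ht).le
        refine ih (e := e + g.d * c.ℓ) (al := 0) (be := be - (g.d - al)) (by omega)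
          ⟨Gadget.swap_mem hx, ⟨_, hp.leftRun_swap_d hl ha ?_ hr3.reads_p⟩, ?_⟩ (by omega)
          (Or.inr rfl)
        · exact hr.foll_eq hx (by omega)
        · rwa [Nat.cast_zero, zero_mul, add_zero]

/-- In a long gap, exchanges other than the intended one may damage the right end. The remedy is to
swap, to apply the belt until the part right of the lengthened run recurs, and to swap again: far to
the right the second swap undoes the first, while the run stays longer. -/
theorem Commuting.fix_of_framed [Finite A] (hh : Commuting g h)
    (hfix : ∀ S T, h (c.pt (chi S) (chi T)) = c.pt (chi S) (chi T)) {be : ℕ}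
    (hbe : g.K1 + g.d + 1 ≤ be) :
    ∀ (al : ℕ) {x : ℤ → A} {e : ℤ}, c.Framed x e al be → h x = x := by
  intro al
  induction al using Nat.strong_induction_on with
  | _ al ih =>
  intro x e hf
  have hℓ : (1 : ℤ) ≤ c.ℓ := by have := c.ℓ_pos; omega
  have hK0 := g.le_K0
  have hbe1 : 1 ≤ be := by omega
  by_cases hal : al + 1 ≤ g.K0
  · exact hh.fix_of_short hfix _ le_rfl hf hal (Or.inl hbe1)
  cases he : c.ct x e with
  | some d => exact ih (al - 1) (by omega) (hf.step_cell (by omega) he)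
  | none =>
    obtain ⟨k, D, hl, hp, ha⟩ := hf.exists_active (g := g) he
    apply hh.fix_of_swap_belt hf.mem k
    have hr := hf.right.belt_iter hbe1 k
    have hx := belt_iter_mem (c := c) hf.mem k
    set x1 := c.belt^[k] x with hx1
    set x2 := g.swap x1 with hx2
    have hx2m : x2 ∈ X.carrier := Gadget.swap_mem hx
    have hl2 := hp.leftRun_swap_succ hl ha
    have hr2 : c.RightEnd x2 (e + al * c.ℓ + (g.K1 + g.d : ℕ) * c.ℓ) (be - (g.K1 + g.d)) := by
      refine (hr.shift (g.K1 + g.d)).swap fun t ht => ?_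
      -- Exchanged words start before the right end, so at most `K1 + d` of its fillers are spoiled.
      rcases hp.mids_cases hl hr ht with rfl | ⟨q, rfl, h2, h3⟩
      · rw [mpos_kpos]; push_cast; nlinarith
      · push_cast; nlinarith
    have hex : ∃ N, c.ct x2 (e + c.ℓ + (N : ℕ) * c.ℓ) = none := by
      refine ⟨al + (g.K1 + g.d) - 1, ?_⟩
      have h1 := hr2 0
      rw [if_pos (by omega), Nat.cast_zero, zero_mul, add_zero] at h1
      rw [← h1.ct_none, Nat.cast_sub (by omega)]
      congr 1; push_cast; ring
    classical
    set N := Nat.find hex with hN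
    have hNn : c.ct x2 (e + c.ℓ + (N : ℕ) * c.ℓ) = none := Nat.find_spec hex
    have hNle : N ≤ al + (g.K1 + g.d) - 1 := by
      refine Nat.find_min' hex ?_
      have h1 := hr2 0
      rw [if_pos (by omega), Nat.cast_zero, zero_mul, add_zero] at h1
      rw [← h1.ct_none, Nat.cast_sub (by omega)]
      congr 1; push_cast; ring
    have hl3 := hl2.extend_n N fun j hj => by
      have := Nat.find_min hex hj
      exact Option.ne_none_iff_exists'.1 this
    set e' := e + c.ℓ + (N : ℤ) * c.ℓ with he'
    -- In this case the new gap, spoiled fillers included, is at most `2 * (K1 + d)` cell lengths,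
    -- which `le_K0` makes short.
    by_cases hcase : al ≤ N + 1 + (g.K1 + g.d)
    · refine hh.fix_of_short hfix _ (al := al + (g.K1 + g.d) - (N + 1)) (be := be - (g.K1 + g.d))
        le_rfl ⟨hx2m, ⟨_, hl3⟩, ?_⟩ (by omega) (Or.inl (by omega))
      convert hr2 using 1
      rw [Nat.cast_sub (by omega), he']; push_cast; ring
    · have hs : e' ≤ e + al * c.ℓ + (g.K1 + g.d : ℕ) * c.ℓ := by
        have h1 : (N : ℤ) + 1 ≤ al := by omega
        rw [he']; push_cast; nlinarith
      -- The return time must also be large enough for the lengthened run to be primed.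
      obtain ⟨n, hn, hag⟩ := hl3.exists_rAgree hNn hr2 (by omega) (D + g.K1 + 1 + N + g.K0 + g.K1)
      apply hh.fix_of_swap_belt hx2m n
      have hl4 := hl3.belt_iter hNn n
      have hsw := hag.swap (g := g) hl3 hl4 hNn
      have h21 : g.swap x2 = x1 := Gadget.swap_swap x1
      rw [h21] at hsw
      refine ih (al - (N + 1)) (by omega) (e := e') ⟨Gadget.swap_mem (belt_iter_mem hx2m n),
        ⟨_, (hl3.primed hNn hn).leftRun_swap hl4⟩, ?_⟩
      rw [show e' + ((al - (N + 1) : ℕ) : ℤ) * c.ℓ = e + al * c.ℓ by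
        rw [Nat.cast_sub (by omega), he']; push_cast; ring]
      refine hr.congr hsw ?_
      have h1 : (N : ℤ) + 1 + (g.K1 + g.d) + 1 ≤ al := by omega
      rw [he']; nlinarith

end CellSystem

end OneDimShift

/-! ### Framed points contain every word -/

namespace OneDimShift

open SymbolicDynamics.FullShift

namespace CellSystem

variable {A : Type*} [TopologicalSpace A] {X : Subshift A ℤ} {c : CellSystem X}
  {g : c.Gadget} {x : ℤ → A} {h h' : (ℤ → A) → (ℤ → A)}

theorem replicate_mem {w : List A} (hw : w ++ c.p ∈ language X) (hp : c.p <+: w) (n : ℕ) :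
    (List.replicate n w).flatten ++ c.p ∈ language X := by
  induction n with
  | zero => simpa using c.sync.1
  | succ n ih =>
    rw [List.replicate_succ, List.flatten_cons, List.append_assoc]
    refine c.sync.append_mem hw ih ?_
    cases n with
    | zero => simp
    | succ n =>
      rw [List.replicate_succ, List.flatten_cons, List.append_assoc]
      exact hp.trans (List.prefix_append _ _)

/-- Every word of the language occurs in a word that can be exchanged with a word of cells. -/
theorem exists_exch (ht : IsTransitive X) {w : List A} (hw : w ∈ language X) :
    ∃ (a b : List A) (N : ℕ), c.p <+: a ++ w ++ b ∧ (a ++ w ++ b).length = N * c.ℓ ∧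
      Exch X (c.word (List.replicate N none)) (a ++ w ++ b) := by
  have hu : c.V none ∈ language X := language_left (c.mem none)
  obtain ⟨u1, -, h1⟩ := ht _ hu _ hw
  obtain ⟨u2, -, h2⟩ := ht _ h1 _ c.sync.1
  -- Repeating `E` exactly `ℓ` times makes the length a multiple of `ℓ`; the final `V none` gives
  -- the right follower set.
  set E := c.V none ++ u1 ++ w ++ u2 with hE
  have hpE : c.p <+: E := by
    rw [hE]
    simpa only [List.append_assoc] using (c.pre none).trans (List.prefix_append _ (u1 ++ (w ++ u2)))
  have hℓ : c.ℓ = (c.ℓ - 1) + 1 := by have := c.ℓ_pos; omega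
  have hW : (List.replicate c.ℓ E).flatten ++ c.V none =
      (c.V none ++ u1) ++ w ++ (u2 ++ ((List.replicate (c.ℓ - 1) E).flatten ++ c.V none)) := by
    conv_lhs => rw [hℓ, List.replicate_succ, List.flatten_cons]
    simp only [hE, List.append_assoc]
  have hlen : ((List.replicate c.ℓ E).flatten ++ c.V none).length = (E.length + 1) * c.ℓ := by
    rw [List.length_append, c.len_V, List.length_flatten, List.map_replicate, List.sum_replicate,
      smul_eq_mul]
    ring
  have hp : c.p <+: (List.replicate c.ℓ E).flatten ++ c.V none := by
    rw [hℓ, List.replicate_succ, List.flatten_cons, List.append_assoc]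
    exact hpE.trans (List.prefix_append _ _)
  refine ⟨c.V none ++ u1, u2 ++ ((List.replicate (c.ℓ - 1) E).flatten ++ c.V none), E.length + 1,
    ?_, ?_, ?_⟩
  · rwa [← hW]
  · rwa [← hW]
  · rw [← hW]
    have hne : List.replicate (E.length + 1) (none : Option (Bool × Bool)) ≠ [] := by simp
    refine c.sync.exch (c.pre_word hne) hp ?_ ?_
    · rw [length_word, List.length_replicate, hlen]
    · rw [c.foll_word hne, c.sync.foll_append (c.pre none)]
      exact c.sync.append_mem (replicate_mem h2 hpE _) hu (c.pre none)

/-- Every word of the language occurs in a framed point. -/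
theorem exists_framed (ht : IsTransitive X) {w : List A} (hw : w ∈ language X) (be : ℕ) :
    ∃ x N t, c.Framed x 0 N be ∧ Reads x t w := by
  obtain ⟨a, b, N, hp, hlen, hex⟩ := c.exists_exch ht hw
  have hℓ : (1 : ℤ) ≤ c.ℓ := by have := c.ℓ_pos; omega
  let f : ℤ → Option (Bool × Bool) := fun j => if 0 ≤ j ∧ j < N + be then none else some (false, false)
  have hr : Reads (c.ptf f) 0 (c.word (List.replicate N none)) := by
    have : Reads (c.ptf f) 0 (c.word (List.replicate N none) ++ c.p) := by
      refine reads_word_of ?_ fun j hj => ?_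
      · rw [zero_add]; exact (vcell_ptf f _).reads_p
      · rw [List.length_replicate] at hj
        have h1 := reads_ptf (c := c) f j
        rw [zero_add, List.getElem_replicate]
        simp only [f] at h1
        rwa [if_pos (by omega)] at h1
    exact this.left
  have hsp := reads_splice (c.ptf f) 0 (a ++ w ++ b)
  refine ⟨splice (c.ptf f) 0 (a ++ w ++ b), N, 0 + (a.length : ℤ),
    ⟨splice_mem (ptf_mem f) hr hex, ⟨0, ?_⟩, ?_⟩, hsp.left.right⟩
  · have key : ∀ k : ℕ, c.ct (splice (c.ptf f) 0 (a ++ w ++ b)) (c.lpos 0 k) =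
        some (false, false) := by
      intro k
      have h1 := reads_ptf (c := c) f (-((k : ℤ) + 1))
      have e1 : -((k : ℤ) + 1) * c.ℓ = c.lpos 0 k := by simp only [lpos]; ring
      simp only [f] at h1
      rw [if_neg (by omega), e1] at h1
      have h2 := lpos_lt (c := c) 0 k
      rw [ct_eq_some, vcell_iff]
      refine ⟨h1.congr fun t ht1 ht2 => ?_, ?_⟩
      · rw [c.len_V] at ht2
        exact (splice_of_not (Or.inl (by omega))).symm
      · cases k with
        | zero =>
          rw [lpos_zero_add]
          exact hsp.of_prefix hp
        | succ k =>
          rw [lpos_succ_add]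
          have h3 := (vcell_ptf (c := c) f (-((k : ℤ) + 1))).reads_p
          have e2 : -((k : ℤ) + 1) * c.ℓ = c.lpos 0 k := by simp only [lpos]; ring
          rw [e2] at h3
          have h4 := lpos_lt (c := c) 0 k
          have h5 := c.length_p
          exact h3.congr fun t ht1 ht2 => (splice_of_not (Or.inl (by omega))).symm
    exact ⟨fun k => ⟨_, key k⟩, fun k _ => key k⟩
  · intro j
    have h1 := vcell_ptf (c := c) f ((N + j : ℕ) : ℤ)
    rw [show ((N + j : ℕ) : ℤ) * c.ℓ = 0 + (N : ℤ) * c.ℓ + (j : ℤ) * c.ℓ by push_cast; ring] at h1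
    have h2 : f ((N + j : ℕ) : ℤ) = if j < be then none else some (false, false) := by
      simp only [f]
      have : (0 ≤ ((N + j : ℕ) : ℤ) ∧ ((N + j : ℕ) : ℤ) < N + be) ↔ j < be := by omega
      simp only [this]
    rw [h2] at h1
    have h3 : (0 : ℤ) ≤ (j : ℤ) * c.ℓ := by positivity
    refine Reads.congr h1 fun t ht1 ht2 => (splice_of_not (Or.inr ?_)).symm
    rw [hlen]; push_cast; linarith

/-- The value of `h x` at `i` depends on a finite word of `x`, which also occurs in a framed point,
where `h` is the identity. -/
theorem Commuting.eq_self [Finite A] (ht : IsTransitive X) (hh : Commuting g h)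
    (hfix : ∀ S T, h (c.pt (chi S) (chi T)) = c.pt (chi S) (chi T)) (hx : x ∈ X.carrier) :
    h x = x := by
  obtain ⟨R, hR⟩ := hh.loc
  funext i
  obtain ⟨y, N, t, hf, hr⟩ := c.exists_framed ht
    ((reads_subword x (i - R) (2 * R + 1)).mem_language hx) (g.K1 + g.d + 1)
  have h1 := hh.fix_of_framed hfix le_rfl N hf
  have h2 : ∀ k, i - R ≤ k → k ≤ i + R → x k = sh (t - (i - R)) y k := by
    intro k h3 h4
    have h5 := hr.apply (k := t - (i - R) + k) (by omega) (by rw [length_subword]; omega)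
    have h6 := (reads_subword x (i - R) (2 * R + 1)).apply (k := k) (by omega)
      (by rw [length_subword]; omega)
    rw [sh, h5, h6]
    congr 1; omega
  rw [hR x hx _ (sh_mem hf.mem _) i h2, hh.map_sh _ hf.mem, h1, h2 i (by omega) (by omega)]

/-- An automorphism that commutes with the belt map and the swap map is a power of the shift. -/
theorem CommPair.exists_sh [Finite A] (ht : IsTransitive X) (hh : CommPair g h h') :
    ∃ n, ∀ x ∈ X.carrier, sh n (h x) = x := by
  obtain ⟨n, h1, h2⟩ := hh.exists_fix
  exact ⟨n, fun x hx => h1.eq_self ht h2 hx⟩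

end CellSystem

end OneDimShift

/-! ### The centralizer and the lower bound -/

namespace OneDimShift

open SymbolicDynamics.FullShift

section Group

variable {A : Type*} [TopologicalSpace A] [Finite A] [DiscreteTopology A] {X : Subshift A ℤ}

theorem shiftAut_mul_comm (H : Aut X) : H * shiftAut X = shiftAut X * H :=
  Subtype.ext (Equiv.ext fun x => H.2.translate_comm 1 x)

theorem commute_of_mem_zpowers {T : Aut X} (hT : T ∈ Subgroup.zpowers (shiftAut X)) (H : Aut X) :
    Commute H T := by
  obtain ⟨n, rfl⟩ := Subgroup.mem_zpowers_iff.1 hT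
  exact Commute.zpow_right (shiftAut_mul_comm H) n

theorem shiftAut_zpow_apply (n : ℤ) (x : X.carrier) :
    (((shiftAut X ^ n : Aut X)).1 x).1 = sh n x.1 := by
  have h1 : ∀ (n : ℕ) (x : X.carrier), (((shiftAut X ^ n : Aut X)).1 x).1 = sh n x.1 := by
    intro n
    induction n with
    | zero => intro x; exact (sh_zero x.1).symm
    | succ n ih =>
      intro x
      rw [pow_succ]
      refine (ih _).trans ?_
      change sh n (sh 1 x.1) = _
      rw [sh_sh, Nat.cast_succ, add_comm]
  obtain ⟨k, rfl | rfl⟩ := n.eq_nat_or_neg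
  · rw [zpow_natCast]; exact h1 k x
  · set y := ((shiftAut X ^ (-(k : ℤ)) : Aut X)).1 x with hy
    have h2 : (shiftAut X ^ k : Aut X).1 y = x := by
      have h3 : (shiftAut X ^ k) * (shiftAut X ^ (-(k : ℤ))) = 1 := by
        rw [zpow_neg, zpow_natCast, mul_inv_cancel]
      exact congrArg (fun T : Aut X => T.1 x) h3
    rw [← h2, h1, sh_sh, add_neg_cancel, sh_zero]

open Classical in
/-- The map on all configurations that is `H` on `X` and the identity elsewhere. -/
noncomputable def extend (H : Aut X) (x : ℤ → A) : ℤ → A :=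
  if hx : x ∈ X.carrier then (H.1 ⟨x, hx⟩).1 else x

theorem extend_of_mem (H : Aut X) {x : ℤ → A} (hx : x ∈ X.carrier) :
    extend H x = (H.1 ⟨x, hx⟩).1 := dif_pos hx

theorem extend_mul (H T : Aut X) {x : ℤ → A} (hx : x ∈ X.carrier) :
    extend H (extend T x) = extend (H * T) x := by
  rw [extend_of_mem T hx, extend_of_mem H (Subtype.property _), extend_of_mem _ hx]
  rfl

theorem extend_one {x : ℤ → A} (hx : x ∈ X.carrier) : extend (1 : Aut X) x = x :=
  extend_of_mem 1 hx

theorem extend_mem (H : Aut X) {x : ℤ → A} (hx : x ∈ X.carrier) : extend H x ∈ X.carrier := by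
  rw [extend_of_mem H hx]; exact Subtype.property _

namespace CellSystem

variable {c : CellSystem X}

variable (c) in
/-- The belt map as an automorphism. -/
noncomputable def beltAut : Aut X :=
  autOfLocal c.belt c.beltInv (localFn_cellMap _) (fun _ hx => cellMap_mem _ hx)
    (fun _ hx => cellMap_mem _ hx) beltInv_belt belt_beltInv

/-- The swap map as an automorphism. -/
noncomputable def Gadget.swapAut (g : c.Gadget) : Aut X :=
  autOfLocal g.swap g.swap localFn_swap (fun _ hx => swap_mem hx) (fun _ hx => swap_mem hx)
    swap_swap swap_swap

theorem extend_beltAut {x : ℤ → A} (hx : x ∈ X.carrier) : extend c.beltAut x = c.belt x :=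
  extend_of_mem _ hx

theorem extend_swapAut {g : c.Gadget} {x : ℤ → A} (hx : x ∈ X.carrier) :
    extend g.swapAut x = g.swap x :=
  extend_of_mem _ hx

theorem commuting_extend {g : c.Gadget} {H : Aut X} (h1 : Commute H c.beltAut)
    (h2 : Commute H g.swapAut) : Commuting g (extend H) where
  mem _ hx := extend_mem H hx
  loc := by
    obtain ⟨m, a, -, f, hf⟩ := H.2
    refine ⟨m.natAbs + a.natAbs, fun x hx y hy i hxy => ?_⟩
    rw [extend_of_mem H hx, extend_of_mem H hy]
    refine (hf _ _).trans (Eq.trans ?_ (hf _ _).symm)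
    congr 1
    funext k
    have h3 := k.2
    rw [Set.mem_Icc] at h3
    exact hxy _ (by omega) (by omega)
  map_sh x hx n := by
    rw [extend_of_mem H hx, extend_of_mem H (sh_mem hx n)]
    exact congrArg Subtype.val (H.2.translate_comm n ⟨x, hx⟩)
  map_belt x hx := by
    rw [← extend_beltAut hx, ← extend_beltAut (extend_mem H hx), extend_mul _ _ hx,
      extend_mul _ _ hx, h1.eq]
  map_swap x hx := by
    rw [← extend_swapAut hx, ← extend_swapAut (extend_mem H hx), extend_mul _ _ hx,
      extend_mul _ _ hx, h2.eq]

theorem centralizerIsShift (ht : IsTransitive X) (g : c.Gadget) :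
    CentralizerIsShift X {c.beltAut, g.swapAut} := by
  ext H
  constructor
  · intro hH
    have h1 : Commute H c.beltAut := (Subgroup.mem_centralizer_iff.1 hH _ (Or.inl rfl)).symm
    have h2 : Commute H g.swapAut := (Subgroup.mem_centralizer_iff.1 hH _ (Or.inr rfl)).symm
    have hp : CommPair g (extend H) (extend H⁻¹) :=
      { fst := commuting_extend h1 h2
        snd := commuting_extend h1.inv_left h2.inv_left
        left_inv := fun x hx => by rw [extend_mul _ _ hx, inv_mul_cancel, extend_one hx]
        right_inv := fun x hx => by rw [extend_mul _ _ hx, mul_inv_cancel, extend_one hx] }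
    obtain ⟨n, hn⟩ := hp.exists_sh ht
    have h3 : shiftAut X ^ n * H = 1 := by
      refine Subtype.ext (Equiv.ext fun x => Subtype.ext ?_)
      refine (shiftAut_zpow_apply n (H.1 x)).trans ?_
      have := hn x.1 x.2
      rwa [extend_of_mem H x.2] at this
    rw [eq_inv_of_mul_eq_one_right h3]
    exact inv_mem (zpow_mem (Subgroup.mem_zpowers _) n)
  · exact fun hH => Subgroup.mem_centralizer_iff.2 fun T _ => (commute_of_mem_zpowers hH T).eq

/-- The swap fixes a point with a single right bit, so as a shift power it would be the identity;
but it changes the point with left bit at `0` and right bit at `1`. -/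
theorem Gadget.swapAut_notMem (g : c.Gadget) : g.swapAut ∉ Subgroup.zpowers (shiftAut X) := by
  intro hmem
  obtain ⟨k, hk⟩ := Subgroup.mem_zpowers_iff.1 hmem
  have h1 : ∀ x ∈ X.carrier, g.swap x = sh k x := fun x hx => by
    rw [← shiftAut_zpow_apply k ⟨x, hx⟩, hk, ← extend_swapAut hx, extend_of_mem _ hx]
  have h2 := h1 _ (pt_mem (c := c) (chi ∅) (chi {0}))
  rw [swap_pt_singleton (by simp), insert_empty_eq] at h2
  have h3 : c.ct (c.pt (chi ∅) (chi {0})) 0 = some (false, true) := by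
    have := ct_ptf (c := c) (fun j => some (chi ∅ j, chi {0} j)) 0
    rw [zero_mul] at this
    exact this.trans (by simp [chi])
  rw [h2, ct_sh, add_zero] at h3
  obtain ⟨j, rfl⟩ := exists_of_vcell_ptf (ct_eq_some.1 h3)
  have h4 := ct_ptf (c := c) (fun j => some (chi ∅ j, chi {0} j)) j
  have h5 : j = 0 := by
    have := h4.symm.trans h3
    simpa [chi] using this
  have h6 := h1 _ (pt_mem (c := c) (chi {0}) (chi {1}))
  rw [swap_pt_singleton (by simp), h5, zero_mul, sh_zero] at h6
  have h7 := congrFun (pt_inj h6).2 0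
  simp [chi] at h7

end CellSystem

/-- A single element centralizes itself, hence would be a power of the shift, and these commute with
all automorphisms, including `T`. -/
theorem two_le_encard {T : Aut X} (hT : T ∉ Subgroup.zpowers (shiftAut X)) {S : Set (Aut X)}
    (hS : CentralizerIsShift X S) : 2 ≤ S.encard := by
  by_contra hcon
  have h1 : S.encard ≤ 1 := by
    exact ENat.lt_two_iff.1 (not_le.1 hcon)
  rw [Set.encard_le_one_iff] at h1
  refine hT (hS ▸ Subgroup.mem_centralizer_iff.2 fun R hR => ?_)
  have h3 : R ∈ Subgroup.centralizer S :=
    Subgroup.mem_centralizer_iff.2 fun R' hR' => by rw [h1 R' R hR' hR]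
  rw [hS] at h3
  exact (commute_of_mem_zpowers h3 T).symm.eq

end Group

end OneDimShift

theorem mainTheorem2 {A : Type*} [Finite A] [TopologicalSpace A] [DiscreteTopology A]
    (X : SymbolicDynamics.FullShift.Subshift A ℤ) (hinf : X.carrier.Infinite)
    (htrans : OneDimShift.IsTransitive X) (hsofic : OneDimShift.IsSofic X) :
    OneDimShift.kInvariant X = 2 := by
  obtain ⟨c⟩ := OneDimShift.exists_cellSystem hinf htrans hsofic
  obtain ⟨g⟩ := c.exists_gadget hsofic
  have hS := c.centralizerIsShift htrans g
  have h1 : (⨅ S : {S : Set (OneDimShift.Aut X) // OneDimShift.CentralizerIsShift X S},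
      S.1.encard : ℕ∞) = 2 :=
    le_antisymm ((iInf_le _ ⟨_, hS⟩).trans ((Set.encard_insert_le _ _).trans_eq (by
      rw [Set.encard_singleton, one_add_one_eq_two])))
      (le_iInf fun S => OneDimShift.two_le_encard g.swapAut_notMem S.2)
  rw [OneDimShift.kInvariant, if_pos ⟨_, hS⟩, h1]
  rfl
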